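/- Let $\mathbb F$ be an algebraically closed field of characteristic $0$ and $n\ge 0$. The affine Hecke--Clifford algebra $\mathfrak H^{\mathfrak c}_n$ is the $\mathbb F$-superalgebra with even generators $s_1,\dots,s_{n-1},x_1,\dots,x_n$ and odd generators $c_1,\dots,c_n$ subject to: $s_k^2=1$, $s_ks_{k+1}s_k=s_{k+1}s_ks_{k+1}$, $s_ks_l=s_ls_k$ for $|k-l|>1$; $x_kx_l=x_lx_k$; $c_k^2=1$, $c_kc_l=-c_lc_k$ for $k\ne l$; $s_kx_k=x_{k+1}s_k-(1+c_kc_{k+1})$ and $s_kx_l=x_ls_k$ for $l\ne k,k+1$; $s_kc_k=c_{k+1}s_k$, $s_kc_{k+1}=c_ks_k$ and $s_kc_l=c_ls_k$ for $l\neq k,k+1$; $x_kc_k=-c_kx_k$ and $x_kc_l=c_lx_k$ for $k\ne l$. Modules are $\mathbb Z_2$-graded, and irreducible means having no proper nonzero graded submodule. Homomorphisms are sums of even and odd ones, where a homogeneous linear map $f$ is a homomorphism if $f(hm)=(-1)^{\bar f\bar h}hf(m)$; isomorphisms are bijective homomorphisms. A module is of type $\texttt M$ (resp. $\texttt Q$)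 if its endomorphism algebra has dimension $1$ (resp. $2$), and completely splittable if $x_1,\dots,x_n$ act semisimply. Put $q(i)=i(i+1)$. Let $\operatorname{Rep}_{\mathbb I}\mathfrak H^{\mathfrak c}_n$ be the category of finite dimensional modules on which all eigenvalues of $x_1^2,\dots,x_n^2$ are of the form $q(i)$ with $i\in\mathbb Z_{\ge0}$. A skew shifted Young diagram $\lambda/\mu$ is the difference of the shifted diagrams of two strict partitions $\mu\subseteq\lambda$ (row $k$ is shifted $k-1$ places to the right). A placed skew shifted Young diagram $(c,\lambda/\mu)$ is such a diagram with a function $c$ from its boxes to $\mathbb Z_{\ge 0}$, increasing from southwest to northeast in each connected component, such that: $c(A)=c(B)$ if and only if $A,B$ lie on the same diagonal; $c(A)=c(B)+1$ if and only if $A$ lies on the diagonal next to that of $B$ on the northeast side; and $c(A)=0$ whenever the box to the right of $A$ and the box diagonally below and to the right of $A$ belong to $\lambda/\mu$ but the box below $A$ does not. Two placed diagrams are identified if there is a content-preserving bijection between their boxes that preserves, in both directions, the relations "immediately to the right of" and "immediately below" (so the position of the connected components in the plane is irrelevant). Let $\mathcal{PS}(n)$ be the set of placed diagrams with $n$ boxes.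 A standard tableau $T$ of shape $\lambda/\mu$ is a bijective labeling of the boxes by $1,\dots,n$, strictly increasing along rows (to the right) and down columns; $T(k)$ is the box labeled $k$. Let $f^{\lambda/\mu}$ be the number of standard tableaux and $\gamma_0$ the number of boxes of content $0$. For $i\in\mathbb Z_{\ge0}$ let $L(i)=\mathbb Fv_0\oplus\mathbb Fv_1$ ($v_0$ even, $v_1$ odd) with $xv_0=\sqrt{q(i)}v_0$, $xv_1=-\sqrt{q(i)}v_1$, $cv_0=v_1$, $cv_1=v_0$. For $\underline i=(i_1,\dots,i_n)$ let $L(\underline i)$ be an irreducible component of the outer tensor product of supermodules $L(i_1)\boxtimes\cdots\boxtimes L(i_n)$, a module for the algebra generated by the $x_k,c_k$. Let $S_n$ act on words by $\tau\cdot\underline i=(i_{\tau^{-1}(1)},\dots,i_{\tau^{-1}(n)})$; call $s_k$ admissible for $\underline j$ if $j_k\ne j_{k+1}\pm1$, and let $P_{\underline i}$ be the set of permutations $s_{k_t}\cdots s_{k_1}$ ($t\ge 0$) with each $s_{k_l}$ admissible for $s_{k_{l-1}}\cdots s_{k_1}\cdot\underline i$. For $(c,\lambda/\mu)\in\mathcal{PS}(n)$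 choose a standard tableau $T$, put $\underline i=(c(T(1)),\dots,c(T(n)))$, and let $D(c,\lambda/\mu)=\bigoplus_{\tau\in P_{\underline i}}L(\underline i)^\tau$, where $L(\underline i)^\tau=\{z^\tau: z\in L(\underline i)\}$ is a copy of $L(\underline i)$, with $x_kz^\tau=(x_{\tau^{-1}(k)}z)^\tau$, $c_kz^\tau=(c_{\tau^{-1}(k)}z)^\tau$, and $$s_kz^\tau=\begin{cases}\Xi_kz^\tau+\Omega_kz^{s_k\tau}&\text{if } s_k \text{ is admissible for } \underline j:=\tau\cdot\underline i,\\ \Xi_kz^\tau&\text{otherwise,}\end{cases}$$ where $\Xi_k=-\dfrac{(x_k+x_{k+1})+c_kc_{k+1}(x_k-x_{k+1})}{q(j_k)-q(j_{k+1})}$ and $\Omega_k=\sqrt{1-\dfrac{2(q(j_k)+q(j_{k+1}))}{(q(j_k)-q(j_{k+1}))^2}}$ (for a fixed choice of square roots in $\mathbb F$). **Theorem.** For every $(c,\lambda/\mu)\in\mathcal{PS}(n)$, $D(c,\lambda/\mu)$ is an $\mathfrak H^{\mathfrak c}_n$-module, for every choice of $T$ and $L(\underline i)$ (choices of which exist),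 and up to isomorphism it does not depend on them. Moreover: (1) $D(c,\lambda/\mu)$ is of type $\texttt M$ if $\gamma_0$ is even and of type $\texttt Q$ if $\gamma_0$ is odd, and $\dim D(c,\lambda/\mu)=2^{\,n-\lfloor\gamma_0/2\rfloor}f^{\lambda/\mu}$. (2) The modules $D(c,\lambda/\mu)$, $(c,\lambda/\mu)\in\mathcal{PS}(n)$, form a complete set of pairwise non-isomorphic irreducible completely splittable $\mathfrak H^{\mathfrak c}_n$-modules in $\operatorname{Rep}_{\mathbb I}\mathfrak H^{\mathfrak c}_n$. -/

import Mathlib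

universe u v w w₁

/-! ## Superalgebras and supermodules

A superalgebra is an algebra `A` over `F` together with its even and odd parts `gr 0`, `gr 1`. -/

namespace Super

variable {F : Type u} [Field F] {A : Type v} [Ring A] [Algebra F A]

/-- A `ℤ/2`-graded left module over the superalgebra `(A, gr)`. -/
structure Supermodule (gr : ZMod 2 → Submodule F A) where
  carrier : Type w
  [addCommGroup : AddCommGroup carrier]
  [moduleBase : Module F carrier]
  [moduleAlg : Module A carrier]
  [tower : IsScalarTower F A carrier]
  /-- the homogeneous parts -/
  part : ZMod 2 → Submodule F carrier
  internal : DirectSum.IsInternal part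
  smul_mem : ∀ (a b : ZMod 2) (h : A) (m : carrier),
    h ∈ gr a → m ∈ part b → h • m ∈ part (a + b)

attribute [instance] Supermodule.addCommGroup Supermodule.moduleBase Supermodule.moduleAlg
  Supermodule.tower

variable {gr : ZMod 2 → Submodule F A}

/-- The homogeneous homomorphisms of parity `b`: linear maps `f` shifting degrees by `b` with
`f (h m) = (-1)^(b * deg h) h f(m)` for homogeneous `h`. -/
def homPart (b : ZMod 2) (M : Supermodule.{u, v, w} gr) (N : Supermodule.{u, v, w₁} gr) :
    Submodule F (M.carrier →ₗ[F] N.carrier) where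
  carrier := {f | (∀ (a : ZMod 2), ∀ m ∈ M.part a, f m ∈ N.part (a + b)) ∧
    ∀ (a : ZMod 2), ∀ h ∈ gr a, ∀ m : M.carrier,
      f (h • m) = ((-1 : F) ^ (a.val * b.val)) • (h • f m)}
  add_mem' := by
    rintro f g ⟨hf, hf2⟩ ⟨hg, hg2⟩
    refine ⟨fun a m hm => Submodule.add_mem _ (hf a m hm) (hg a m hm), fun a h hh m => ?_⟩
    simp [hf2 a h hh m, hg2 a h hh m]
  zero_mem' := by
    refine ⟨fun a m _ => Submodule.zero_mem _, fun a h _ m => ?_⟩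
    simp
  smul_mem' := by
    rintro r f ⟨hf, hf2⟩
    refine ⟨fun a m hm => Submodule.smul_mem _ r (hf a m hm), fun a h hh m => ?_⟩
    simp only [LinearMap.smul_apply, hf2 a h hh m]
    rw [smul_comm r, smul_algebra_smul_comm r h (f m)]

/-- All homomorphisms: sums of an even and an odd one. -/
def hom (M : Supermodule.{u, v, w} gr) (N : Supermodule.{u, v, w₁} gr) :
    Submodule F (M.carrier →ₗ[F] N.carrier) :=
  homPart 0 M N ⊔ homPart 1 M N

/-- Two supermodules are isomorphic if there is a bijective homomorphism (not necessarily even). -/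
def Isomorphic (M : Supermodule.{u, v, w} gr) (N : Supermodule.{u, v, w₁} gr) : Prop :=
  ∃ f ∈ hom M N, Function.Bijective f

/-- A submodule is graded if it contains the homogeneous components of each of its elements. -/
def IsGradedSubmodule (M : Supermodule.{u, v, w} gr) (N : Submodule A M.carrier) : Prop :=
  ∀ m ∈ N, ∃ m₀ ∈ M.part 0, ∃ m₁ ∈ M.part 1, m₀ ∈ N ∧ m₁ ∈ N ∧ m = m₀ + m₁

/-- Irreducible: nonzero, and without graded submodules other than `0` and the whole module. -/
def IsIrreducible (M : Supermodule.{u, v, w} gr) : Prop :=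
  Nontrivial M.carrier ∧
    ∀ N : Submodule A M.carrier, IsGradedSubmodule M N → N = ⊥ ∨ N = ⊤

/-- Type `M`: the endomorphism algebra (even and odd endomorphisms) is one dimensional. -/
def IsTypeM (M : Supermodule.{u, v, w} gr) : Prop := Module.finrank F (hom M M) = 1

/-- Type `Q`: the endomorphism algebra (even and odd endomorphisms) is two dimensional. -/
def IsTypeQ (M : Supermodule.{u, v, w} gr) : Prop := Module.finrank F (hom M M) = 2

end Super

/-! ## The affine Hecke-Clifford algebra

Indices are shifted by one: `x_1, …, x_n` and `c_1, …, c_n` are indexed by `Fin n`, and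
`s_1, …, s_{n-1}` by `Fin (n - 1)`; `s_k` exchanges the positions `lo k` and `hi k = lo k + 1`. -/

namespace HeckeClifford

/-- The first of the two positions exchanged by `s_k`. -/
def lo {n : ℕ} (k : Fin (n - 1)) : Fin n := ⟨k.1, by omega⟩

/-- The second of the two positions exchanged by `s_k`. -/
def hi {n : ℕ} (k : Fin (n - 1)) : Fin n := ⟨k.1 + 1, by omega⟩

/-- The generators. -/
inductive Gen (n : ℕ) : Type
  | s (k : Fin (n - 1)) : Gen n
  | x (k : Fin n) : Gen n
  | c (k : Fin n) : Gen n

/-- Parity of the generators: the `c_k` are odd, the others even. -/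
def Gen.parity {n : ℕ} : Gen n → ZMod 2
  | .s _ => 0
  | .x _ => 0
  | .c _ => 1

section Algebra

variable (F : Type u) [Field F] (n : ℕ)

/-- The generators `s_k` in the free algebra. -/
abbrev fs (k : Fin (n - 1)) : FreeAlgebra F (Gen n) := FreeAlgebra.ι F (Gen.s k)

/-- The generators `x_k` in the free algebra. -/
abbrev fx (k : Fin n) : FreeAlgebra F (Gen n) := FreeAlgebra.ι F (Gen.x k)

/-- The generators `c_k` in the free algebra. -/
abbrev fc (k : Fin n) : FreeAlgebra F (Gen n) := FreeAlgebra.ι F (Gen.c k)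

/-- The defining relations. -/
inductive Rel : FreeAlgebra F (Gen n) → FreeAlgebra F (Gen n) → Prop
  | s_sq (k : Fin (n - 1)) : Rel (fs F n k * fs F n k) 1
  | s_comm (k l : Fin (n - 1)) (h : k.1 + 1 < l.1) :
      Rel (fs F n k * fs F n l) (fs F n l * fs F n k)
  | braid (k l : Fin (n - 1)) (h : k.1 + 1 = l.1) :
      Rel (fs F n k * fs F n l * fs F n k) (fs F n l * fs F n k * fs F n l)
  | x_comm (k l : Fin n) : Rel (fx F n k * fx F n l) (fx F n l * fx F n k)
  | c_sq (k : Fin n) : Rel (fc F n k * fc F n k) 1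
  | c_anti (k l : Fin n) (h : k ≠ l) : Rel (fc F n k * fc F n l) (-(fc F n l * fc F n k))
  | s_x (k : Fin (n - 1)) :
      Rel (fs F n k * fx F n (lo k))
        (fx F n (hi k) * fs F n k - (1 + fc F n (lo k) * fc F n (hi k)))
  | s_x_far (k : Fin (n - 1)) (l : Fin n) (h₁ : l ≠ lo k) (h₂ : l ≠ hi k) :
      Rel (fs F n k * fx F n l) (fx F n l * fs F n k)
  | s_c_lo (k : Fin (n - 1)) : Rel (fs F n k * fc F n (lo k)) (fc F n (hi k) * fs F n k)
  | s_c_hi (k : Fin (n - 1)) : Rel (fs F n k * fc F n (hi k)) (fc F n (lo k) * fs F n k)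
  | s_c_far (k : Fin (n - 1)) (l : Fin n) (h₁ : l ≠ lo k) (h₂ : l ≠ hi k) :
      Rel (fs F n k * fc F n l) (fc F n l * fs F n k)
  | x_c_same (k : Fin n) : Rel (fx F n k * fc F n k) (-(fc F n k * fx F n k))
  | x_c_far (k l : Fin n) (h : k ≠ l) : Rel (fx F n k * fc F n l) (fc F n l * fx F n k)

/-- The affine Hecke-Clifford algebra `H^c_n` over `F`. -/
abbrev Alg : Type u := RingQuot (Rel F n)

variable {n}

/-- The generators, as elements of `H^c_n`. -/
noncomputable def gen (g : Gen n) : Alg F n := RingQuot.mkAlgHom F (Rel F n) (FreeAlgebra.ι F g)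

variable (n)

/-- The homogeneous part of `H^c_n` of degree `a`: the span of the words in the generators in
which the number of letters `c_k` has parity `a`. -/
noncomputable def algPart (a : ZMod 2) : Submodule F (Alg F n) :=
  Submodule.span F {h | ∃ l : List (Gen n), (l.map Gen.parity).sum = a ∧ h = (l.map (gen F)).prod}

/-- `H^c_n`-modules (always `ℤ/2`-graded). -/
abbrev Mod : Type (max u (v + 1)) := Super.Supermodule.{u, u, v} (algPart F n)

end Algebra

section Modules

variable {F : Type u} [Field F] {n : ℕ}

/-- The linear operator by which `h ∈ H^c_n` acts on the module `M`. -/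
noncomputable def act (M : Mod.{u, v} F n) (h : Alg F n) : Module.End F M.carrier :=
  Algebra.lsmul F F M.carrier h

/-- Completely splittable: `x_1, …, x_n` act semisimply. -/
def IsCompletelySplittable (M : Mod.{u, v} F n) : Prop :=
  ∀ k : Fin n, (act M (gen F (Gen.x k))).IsSemisimple

/-- `q(i) = i (i + 1)`. -/
def q (F : Type u) [Field F] (i : ℕ) : F := (i : F) * ((i : F) + 1)

/-- Integral modules (in characteristic zero): finite dimensional, and all eigenvalues of the
`x_k ^ 2` are of the form `q(i)` with `i` a nonnegative integer. -/
def IsIntegral (M : Mod.{u, v} F n) : Prop :=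
  FiniteDimensional F M.carrier ∧
    ∀ (k : Fin n) (t : F), (act M (gen F (Gen.x k) ^ 2)).HasEigenvalue t → ∃ i : ℕ, t = q F i

end Modules

/-! ## The modules `L(i)` for the subalgebra generated by the `x_k` and `c_k` -/

section Clifford

variable {F : Type u} [Field F] [IsAlgClosed F] {n : ℕ}

/-- A chosen square root in an algebraically closed field. -/
noncomputable def sqrtF (a : F) : F := (IsAlgClosed.exists_pow_nat_eq a (n := 2) two_pos).choose

theorem sqrtF_sq (a : F) : sqrtF a ^ 2 = a :=
  (IsAlgClosed.exists_pow_nat_eq a (n := 2) two_pos).choose_spec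

variable (F n) in
/-- The space of `L(i_1) ⊠ ⋯ ⊠ L(i_n)`, where `L(i_k)` has the basis `v_0` (even), `v_1` (odd).
An element is given by its coordinates with respect to the basis
`v_S = v_{ε_1} ⊗ ⋯ ⊗ v_{ε_n}`, `S ⊆ {1, …, n}`, with `ε_k = 1` if `k ∈ S` and `ε_k = 0` if not. -/
abbrev Box : Type u := Finset (Fin n) → F

/-- The action of `x_k` on `L(i_1) ⊠ ⋯ ⊠ L(i_n)`, which comes from `x v_0 = √q(i) v_0` and
`x v_1 = -√q(i) v_1` on `L(i)`. -/
noncomputable def boxX (i : Fin n → ℕ) (k : Fin n) : Module.End F (Box F n) where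
  toFun f := fun S => (if k ∈ S then -sqrtF (q F (i k)) else sqrtF (q F (i k))) * f S
  map_add' f g := by
    funext S
    simp [mul_add]
  map_smul' r f := by
    funext S
    simp [mul_left_comm]

/-- The action of `c_k` on `L(i_1) ⊠ ⋯ ⊠ L(i_n)`, which comes from `c v_0 = v_1` and
`c v_1 = v_0` on `L(i)`; the odd operator `c_k` picks up the sign `(-1)^(ε_1 + ⋯ + ε_{k-1})`. -/
def boxC (k : Fin n) : Module.End F (Box F n) where
  toFun f := fun S => (-1 : F) ^ (S.filter (fun l => l < k)).card * f (symmDiff S {k})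
  map_add' f g := by
    funext S
    simp [mul_add]
  map_smul' r f := by
    funext S
    simp [mul_left_comm]

variable (F n) in
/-- The homogeneous part of degree `a` of `L(i_1) ⊠ ⋯ ⊠ L(i_n)`. -/
def boxPart (a : ZMod 2) : Submodule F (Box F n) where
  carrier := {f | ∀ S : Finset (Fin n), (S.card : ZMod 2) ≠ a → f S = 0}
  add_mem' hf hg S hS := by simp [hf S hS, hg S hS]
  zero_mem' _ _ := rfl
  smul_mem' r f hf S hS := by simp [hf S hS]

/-- Subspaces of `L(i_1) ⊠ ⋯ ⊠ L(i_n)` which are graded submodules for the algebra generated by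
the `x_k` and `c_k`. -/
structure IsBoxSubmodule (i : Fin n → ℕ) (N : Submodule F (Box F n)) : Prop where
  x_mem : ∀ k : Fin n, ∀ f ∈ N, boxX i k f ∈ N
  c_mem : ∀ k : Fin n, ∀ f ∈ N, boxC k f ∈ N
  graded : ∀ f ∈ N, ∃ f₀ ∈ boxPart F n 0, ∃ f₁ ∈ boxPart F n 1, f₀ ∈ N ∧ f₁ ∈ N ∧ f = f₀ + f₁

variable (F) in
/-- `L(i) = L(i_1) ⊛ ⋯ ⊛ L(i_n)`: an irreducible component of `L(i_1) ⊠ ⋯ ⊠ L(i_n)`. -/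
structure Component (i : Fin n → ℕ) where
  space : Submodule F (Box F n)
  isSub : IsBoxSubmodule i space
  ne_bot : space ≠ ⊥
  minimal : ∀ N : Submodule F (Box F n), IsBoxSubmodule i N → N ≤ space → N = ⊥ ∨ N = space

/-- The action of `x_k` on `L(i)`. -/
noncomputable def Component.X {i : Fin n → ℕ} (L : Component F i) (k : Fin n) :
    Module.End F L.space :=
  (boxX i k).restrict (L.isSub.x_mem k)

/-- The action of `c_k` on `L(i)`. -/
noncomputable def Component.C {i : Fin n → ℕ} (L : Component F i) (k : Fin n) :
    Module.End F L.space :=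
  (boxC k).restrict (L.isSub.c_mem k)

/-- The operator
`-((x_a + x_b) / (x_a ^ 2 - x_b ^ 2) + c_a c_b (x_a - x_b) / (x_a ^ 2 - x_b ^ 2))`
on `L(i)`, where `x_a ^ 2 - x_b ^ 2` is the scalar `q(i_a) - q(i_b)`. -/
noncomputable def Component.Xi {i : Fin n → ℕ} (L : Component F i) (a b : Fin n) :
    Module.End F L.space :=
  -((q F (i a) - q F (i b))⁻¹ • (L.X a + L.X b + L.C a * L.C b * (L.X a - L.X b)))

variable (F) in
/-- The scalar `√(1 - 2 (q(a) + q(b)) / (q(a) - q(b)) ^ 2)`. -/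
noncomputable def omega (a b : ℕ) : F :=
  sqrtF (1 - 2 * (q F a + q F b) / (q F a - q F b) ^ 2)

end Clifford

/-! ## Admissible permutations and the modules `D^i` -/

section Construction

variable {n : ℕ}

/-- The simple transposition `s_k`. -/
def simpleSwap (k : Fin (n - 1)) : Equiv.Perm (Fin n) := Equiv.swap (lo k) (hi k)

/-- `τ · i = (i_{τ⁻¹(1)}, …, i_{τ⁻¹(n)})`. -/
def permWord (τ : Equiv.Perm (Fin n)) (i : Fin n → ℕ) : Fin n → ℕ := fun k => i (τ⁻¹ k)

/-- `s_k` is admissible with respect to `i` if `i_k ≠ i_{k+1} ± 1`. -/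
def Admissible (i : Fin n → ℕ) (k : Fin (n - 1)) : Prop :=
  i (lo k) ≠ i (hi k) + 1 ∧ i (hi k) ≠ i (lo k) + 1

/-- The set `P_i` of the permutations `s_{k_t} ⋯ s_{k_1}` such that each `s_{k_l}` is admissible
with respect to `s_{k_{l-1}} ⋯ s_{k_1} · i`. -/
inductive InP (i : Fin n → ℕ) : Equiv.Perm (Fin n) → Prop
  | one : InP i 1
  | step (τ : Equiv.Perm (Fin n)) (k : Fin (n - 1)) (hτ : InP i τ)
      (hk : Admissible (permWord τ i) k) : InP i (simpleSwap k * τ)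

variable {F : Type u} [Field F] [IsAlgClosed F]

open Classical in
/-- The element `z^τ` of the direct sum `⨁_{τ ∈ P_i} L(i)^τ`. -/
noncomputable def twisted {i : Fin n → ℕ} (L : Component F i) (τ : {τ // InP i τ})
    (z : L.space) : {τ // InP i τ} → L.space :=
  Pi.single τ z

/-- `D` is the module `D^i = ⨁_{τ ∈ P_i} L(i)^τ` built from the component `L = L(i)`: through a
linear bijection `e` with the direct sum that respects the gradings, the generators act by
`x_k z^τ = (x_{τ⁻¹(k)} z)^τ`, `c_k z^τ = (c_{τ⁻¹(k)} z)^τ` and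
`s_k z^τ = Ξ_k z^τ + Ω_k z^{s_k τ}` if `s_k` is admissible with respect to `τ · i`,
`s_k z^τ = Ξ_k z^τ` otherwise. -/
def Affords {i : Fin n → ℕ} (L : Component F i) (D : Mod.{u, v} F n) : Prop :=
  ∃ e : ({τ // InP i τ} → L.space) ≃ₗ[F] D.carrier,
    (∀ (a : ZMod 2) (τ : {τ // InP i τ}) (z : L.space),
      (z : Box F n) ∈ boxPart F n a → e (twisted L τ z) ∈ D.part a) ∧
    (∀ (k : Fin n) (τ : {τ // InP i τ}) (z : L.space),
      gen F (Gen.x k) • e (twisted L τ z) = e (twisted L τ (L.X (τ.1⁻¹ k) z))) ∧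
    (∀ (k : Fin n) (τ : {τ // InP i τ}) (z : L.space),
      gen F (Gen.c k) • e (twisted L τ z) = e (twisted L τ (L.C (τ.1⁻¹ k) z))) ∧
    (∀ (k : Fin (n - 1)) (τ : {τ // InP i τ}) (z : L.space)
      (hk : Admissible (permWord τ.1 i) k),
      gen F (Gen.s k) • e (twisted L τ z) =
        e (twisted L τ (L.Xi (τ.1⁻¹ (lo k)) (τ.1⁻¹ (hi k)) z)) +
          omega F (permWord τ.1 i (lo k)) (permWord τ.1 i (hi k)) •
            e (twisted L ⟨simpleSwap k * τ.1, InP.step τ.1 k τ.2 hk⟩ z)) ∧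
    (∀ (k : Fin (n - 1)) (τ : {τ // InP i τ}) (z : L.space),
      ¬ Admissible (permWord τ.1 i) k →
      gen F (Gen.s k) • e (twisted L τ z) =
        e (twisted L τ (L.Xi (τ.1⁻¹ (lo k)) (τ.1⁻¹ (hi k)) z)))

end Construction

/-! ## Placed skew shifted Young diagrams -/

/-- A strict partition `λ_0 > λ_1 > ⋯ > λ_{l-1} > 0 = λ_l = λ_{l+1} = ⋯`. -/
structure StrictPartition where
  parts : ℕ → ℕ
  strict : ∀ k, parts k ≠ 0 → parts (k + 1) < parts k
  zero : ∀ k, parts k = 0 → parts (k + 1) = 0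

/-- The boxes `(r, c)` (row `r` from the top, column `c` from the left, counted from `0`) of the
skew shifted diagram `λ/μ`: row `r` is shifted to the right by `r`. -/
def skewBoxes (lam mu : StrictPartition) : Set (ℕ × ℕ) :=
  {A | A.1 + mu.parts A.1 ≤ A.2 ∧ A.2 < A.1 + lam.parts A.1}

/-- The number of the diagonal on which a box lies; it grows by one when moving to the right or
up. -/
def diagonal (A : ℕ × ℕ) : ℤ := (A.2 : ℤ) - (A.1 : ℤ)

/-- Placed skew shifted Young diagrams `(c, λ/μ)` with `n` boxes. Condition `content_succ` says
in particular that contents increase from southwest to northeast in each connected component. -/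
structure PlacedDiagram (n : ℕ) where
  outer : StrictPartition
  inner : StrictPartition
  inner_le : ∀ k, inner.parts k ≤ outer.parts k
  card_boxes : (skewBoxes outer inner).encard = n
  content : skewBoxes outer inner → ℕ
  content_eq : ∀ A B, content A = content B ↔ diagonal A.1 = diagonal B.1
  content_succ : ∀ A B, content A = content B + 1 ↔ diagonal A.1 = diagonal B.1 + 1
  content_zero : ∀ A : skewBoxes outer inner,
    (A.1.1, A.1.2 + 1) ∈ skewBoxes outer inner →
    (A.1.1 + 1, A.1.2 + 1) ∈ skewBoxes outer inner →
    (A.1.1 + 1, A.1.2) ∉ skewBoxes outer inner → content A = 0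

namespace PlacedDiagram

variable {n : ℕ}

/-- The boxes of a placed diagram. -/
abbrev Boxes (d : PlacedDiagram n) : Type := skewBoxes d.outer d.inner

/-- Two placed diagrams are the same if they have the same connected components with the same
contents, the position of the components in the plane being irrelevant: there is a
content-preserving bijection between the boxes which preserves the relations "immediately to the
right of" and "immediately below" in both directions. -/
def Same (d e : PlacedDiagram n) : Prop :=
  ∃ φ : d.Boxes ≃ e.Boxes, (∀ A, e.content (φ A) = d.content A) ∧
    (∀ A B, (B.1.1 = A.1.1 ∧ B.1.2 = A.1.2 + 1) ↔
      ((φ B).1.1 = (φ A).1.1 ∧ (φ B).1.2 = (φ A).1.2 + 1)) ∧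
    (∀ A B, (B.1.1 = A.1.1 + 1 ∧ B.1.2 = A.1.2) ↔
      ((φ B).1.1 = (φ A).1.1 + 1 ∧ (φ B).1.2 = (φ A).1.2))

/-- Standard tableaux: labelings of the boxes by `1, …, n` (here `0, …, n - 1`) which strictly
increase from left to right along each row and down each column. -/
structure Tableau (d : PlacedDiagram n) where
  label : d.Boxes ≃ Fin n
  row : ∀ A B : d.Boxes, A.1.1 = B.1.1 → A.1.2 < B.1.2 → label A < label B
  col : ∀ A B : d.Boxes, A.1.2 = B.1.2 → A.1.1 < B.1.1 → label A < label B

/-- The word `(c(T(1)), …, c(T(n)))` of contents, `T(k)` being the box labeled by `k`. -/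
def Tableau.word {d : PlacedDiagram n} (T : d.Tableau) : Fin n → ℕ :=
  fun k => d.content (T.label.symm k)

/-- The number `f^{λ/μ}` of standard tableaux. -/
noncomputable def numTableaux (d : PlacedDiagram n) : ℕ := Nat.card d.Tableau

/-- The number `γ_0` of boxes with content zero. -/
noncomputable def gammaZero (d : PlacedDiagram n) : ℕ := Nat.card {A : d.Boxes // d.content A = 0}

end PlacedDiagram

/-- `D` is the module `D(c, λ/μ)`, that is, it is `D^i` for the word of contents `i` of some
standard tableau. -/
def IsD {F : Type u} [Field F] [IsAlgClosed F] {n : ℕ} (d : PlacedDiagram n)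
    (D : Mod.{u, v} F n) : Prop :=
  ∃ (T : d.Tableau) (L : Component F T.word), Affords L D

end HeckeClifford

/-! Everything rests on the intertwiners φ_k = s_k (x_k² − x_{k+1}²) + u with u = x_k + x_{k+1} +
c_k c_{k+1} (x_k − x_{k+1}) (`inter`, `uhat`). They move past all x and c by the transposition s_k,
so they permute the joint eigenspaces of the x_k² (the weight spaces, indexed by words j). On the
weight space of j, φ_k² is the scalar 2(a + b) − (a − b)² with a = q(j_k), b = q(j_{k+1}); for
distinct letters it vanishes exactly when they differ by one (`inter_scalar_eq_zero_iff`).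

Weights. In a completely splittable module no weight has two equal adjacent letters
(`eq_zero_of_adjacent_eq`), and a pattern (a, b, a) must be (0, 1, 0) (`eq_of_three`). Admissible
transpositions carry weights to weights, and this forces every weight to be alternating: between two
equal letters all neighbours of that letter occur (`alternating_of_closed`). Alternating words are
exactly the content words of standard tableaux (`alternating_word`, `Alternating.word_tableau`). The
word determines the placed diagram (`same_of_word_eq`), and changing the tableau of a fixed diagram
amounts to acting by P_i (`equivInP`), which consists of the permutations keeping the order of
neighbouring letters (`inP_iff`).

Existence. For alternating i the formulas of D^i satisfy the relations (`hcRel_twOp`): the quadratic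
one comes from u² = 2(x_a² + x_b²), the braid relation from an associative Yang-Baxter equation for
u, with the pattern (0, 1, 0) covered by a cubic identity. The weights of D^i are the distinct words
τ·i with τ ∈ P_i, each weight space is a copy of L(i), and Ω_k ≠ 0 at admissible steps; hence D^i is
irreducible (`isIrr_twOp`).

Uniqueness. The intertwiners satisfy the braid relations, so composites ψ_w along reduced words are
well defined. An x,c-stable subspace Y of a weight space generates Σ ψ_w Y, which meets that weight
space only in Y (`exists_generated`). Inside a weight space, commuting involutions (x_t/√q(j_t) at
nonzero letters, √−1 c_t c_{πt} for pairs of zeros) single out vacuum vectors; those in the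
x,c-module generated by a homogeneous vacuum vector v form the span of v, together with c_r v if one
zero r is left unpaired. For irreducible modules with vacuum vectors v, v' of the same weight and
parity, the submodule of the product generated by (v, v') contains neither (v, 0) nor (0, v'), so it
is the graph of an isomorphism (`exists_equiv_of_vacuum_even`). Applied to v and c_r v this gives
the odd automorphism of type Q; with an even number of zeros there is none. The count 2^{n − ⌊γ₀/2⌋}
of L(i) times the size of P_i gives the dimension. -/

namespace HeckeClifford

/-! ## Identities in the algebra generated by commuting `x` and anticommuting `c` -/

/-- The relations between commuting elements `x` and Clifford elements `c`. -/
structure XCRel {ι A : Type*} [Ring A] (x c : ι → A) : Prop where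
  xx : ∀ k l, x k * x l = x l * x k
  c_sq : ∀ k, c k * c k = 1
  cc : ∀ k l, k ≠ l → c k * c l = -(c l * c k)
  xc_same : ∀ k, x k * c k = -(c k * x k)
  xc : ∀ k l, k ≠ l → x k * c l = c l * x k

/-- `x_a + x_b + c_a c_b (x_a - x_b)`. -/
def uhat {ι A : Type*} [Ring A] (x c : ι → A) (a b : ι) : A :=
  x a + x b + c a * c b * (x a - x b)

variable {ι A : Type*} [Ring A]

/-- These three forms, with an arbitrary tail z, let `simp` move a letter inside a right-associated
product; they produce the normal forms that prove the identities for `uhat`. -/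
theorem mul_left_of_comm {a b : A} (e : a * b = b * a) (z : A) : a * (b * z) = b * (a * z) := by
  rw [← mul_assoc, e, mul_assoc]

theorem mul_left_of_anti {a b : A} (e : a * b = -(b * a)) (z : A) :
    a * (b * z) = -(b * (a * z)) := by
  rw [← mul_assoc, e, neg_mul, mul_assoc]

theorem mul_left_of_sq {a : A} (e : a * a = 1) (z : A) : a * (a * z) = z := by
  rw [← mul_assoc, e, one_mul]

namespace XCRel

variable {x c : ι → A} (h : XCRel x c)
include h

theorem sq_comm_x (k l : ι) : x k * x k * x l = x l * (x k * x k) := by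
  rw [mul_assoc, h.xx k l, ← mul_assoc, h.xx k l, mul_assoc]

theorem sq_comm_c (k l : ι) : x k * x k * c l = c l * (x k * x k) := by
  by_cases e : k = l
  · subst e
    rw [mul_assoc, h.xc_same, mul_neg, ← mul_assoc, h.xc_same, neg_mul, neg_neg, mul_assoc]
  · rw [mul_assoc, h.xc k l e, ← mul_assoc, h.xc k l e, mul_assoc]

theorem uhat_symm (a b : ι) (hab : a ≠ b) : uhat x c a b = uhat x c b a := by
  rw [uhat, uhat, h.cc a b hab]
  noncomm_ring

theorem sq_comm_uhat (k a b : ι) :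
    x k * x k * uhat x c a b = uhat x c a b * (x k * x k) := by
  have e : Commute (x k * x k) (uhat x c a b) := by
    have h1 : Commute (x k * x k) (x a) := h.sq_comm_x k a
    have h2 : Commute (x k * x k) (x b) := h.sq_comm_x k b
    have h3 : Commute (x k * x k) (c a) := h.sq_comm_c k a
    have h4 : Commute (x k * x k) (c b) := h.sq_comm_c k b
    exact (h1.add_right h2).add_right ((h3.mul_right h4).mul_right (h1.sub_right h2))
  exact e

theorem uhat_comm_x (a b d : ι) (ha : d ≠ a) (hb : d ≠ b) :
    uhat x c a b * x d = x d * uhat x c a b := by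
  have h1 : Commute (x d) (x a) := h.xx _ _
  have h2 : Commute (x d) (x b) := h.xx _ _
  have h3 : Commute (x d) (c a) := h.xc _ _ ha
  have h4 : Commute (x d) (c b) := h.xc _ _ hb
  exact ((h1.add_right h2).add_right ((h3.mul_right h4).mul_right (h1.sub_right h2))).symm

theorem uhat_comm_c (a b d : ι) (ha : d ≠ a) (hb : d ≠ b) :
    uhat x c a b * c d = c d * uhat x c a b := by
  have h1 : Commute (c d) (x a) := (h.xc _ _ ha.symm).symm
  have h2 : Commute (c d) (x b) := (h.xc _ _ hb.symm).symm
  have h3 : Commute (c d) (c a * c b) := by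
    rw [commute_iff_eq, ← mul_assoc, h.cc d a ha, neg_mul, mul_assoc, h.cc d b hb]
    noncomm_ring
  exact ((h1.add_right h2).add_right (h3.mul_right (h1.sub_right h2))).symm

theorem uhat_comm_uhat (a b d e : ι) (h1 : d ≠ a) (h2 : d ≠ b) (h3 : e ≠ a) (h4 : e ≠ b) :
    uhat x c a b * uhat x c d e = uhat x c d e * uhat x c a b := by
  have e1 : Commute (uhat x c a b) (x d) := h.uhat_comm_x a b d h1 h2
  have e2 : Commute (uhat x c a b) (x e) := h.uhat_comm_x a b e h3 h4
  have e3 : Commute (uhat x c a b) (c d) := h.uhat_comm_c a b d h1 h2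
  have e4 : Commute (uhat x c a b) (c e) := h.uhat_comm_c a b e h3 h4
  exact (e1.add_right e2).add_right ((e3.mul_right e4).mul_right (e1.sub_right e2))

/-- The correction term is what cancels the inhomogeneous term of the relation between s_k and x_k,
once that is multiplied by x_k² − x_{k+1}²; see `inter_mul_x`. -/
theorem uhat_mul_x (a b : ι) (hab : a ≠ b) :
    uhat x c a b * x a = x b * uhat x c a b + (1 + c a * c b) * (x a * x a - x b * x b) := by
  have r1 := h.xx b a
  have r6 := h.xc_same b
  have r8 := h.xc b a hab.symm
  simp only [uhat, mul_add, add_mul, mul_sub, sub_mul, mul_assoc, r1,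
    mul_left_of_anti r6, mul_left_of_comm r8, mul_neg, one_mul]
  abel

theorem uhat_mul_c (a b : ι) (hab : a ≠ b) : uhat x c a b * c a = c b * uhat x c a b := by
  have h1 := h.xc_same a
  have h2 := h.xc b a hab.symm
  have e1 : c a * c b * c a = - c b := by
    rw [mul_assoc, h.cc b a hab.symm, mul_neg, ← mul_assoc, h.c_sq, one_mul]
  have e2 : c b * (c a * c b) = - c a := by
    rw [← mul_assoc, h.cc b a hab.symm, neg_mul, mul_assoc, h.c_sq, mul_one]
  have e3 : c b * (c a * c b * (x a - x b)) = - (c a * (x a - x b)) := by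
    rw [← mul_assoc, e2, neg_mul]
  have e4 : c a * c b * (x a - x b) * c a = c b * (x a + x b) := by
    rw [mul_assoc, sub_mul, h1, h2, ← neg_add', ← mul_add, mul_neg, ← mul_assoc, e1]
    noncomm_ring
  rw [uhat, mul_add (c b), e3, add_mul, e4, add_mul, h1, h2]
  noncomm_ring

/-- Both x_a and x_b anticommute with c_a c_b, whose square is −1: the mixed terms cancel, and (x_a
+ x_b)² and (x_a − x_b)² add up. -/
theorem uhat_sq (a b : ι) (hab : a ≠ b) :
    uhat x c a b * uhat x c a b = 2 * (x a * x a + x b * x b) := by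
  have r1 := h.xx b a
  have r2 := h.c_sq a
  have r3 := h.c_sq b
  have r4 := h.cc b a hab.symm
  have r5 := h.xc_same a
  have r6 := h.xc_same b
  have r7 := h.xc a b hab
  have r8 := h.xc b a hab.symm
  simp only [uhat, mul_add, add_mul, mul_sub, sub_mul, mul_assoc, r1,
    mul_left_of_sq r2, mul_left_of_sq r3, mul_left_of_anti r4,
    mul_left_of_anti r5, mul_left_of_anti r6, mul_left_of_comm r7, mul_left_of_comm r8,
    mul_neg, neg_neg, two_mul]
  abel

/-- The associative Yang-Baxter equation, with denominators cleared. -/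
theorem uhat_yangBaxter (a b d : ι) (hab : a ≠ b) (hbd : b ≠ d) (had : a ≠ d) :
    uhat x c a b * uhat x c b d * (x a * x a - x d * x d) =
      uhat x c b d * uhat x c a d * (x a * x a - x b * x b) +
        uhat x c a d * uhat x c a b * (x b * x b - x d * x d) := by
  have x1 := h.xx b a
  have x2 := h.xx d a
  have x3 := h.xx d b
  have s1 := h.c_sq a
  have s2 := h.c_sq b
  have s3 := h.c_sq d
  have c1 := h.cc b a hab.symm
  have c2 := h.cc d a had.symm
  have c3 := h.cc d b hbd.symm
  have p1 := h.xc_same a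
  have p2 := h.xc_same b
  have p3 := h.xc_same d
  have y1 := h.xc a b hab
  have y2 := h.xc b a hab.symm
  have y3 := h.xc a d had
  have y4 := h.xc d a had.symm
  have y5 := h.xc b d hbd
  have y6 := h.xc d b hbd.symm
  simp only [uhat, mul_add, add_mul, mul_sub, sub_mul, mul_assoc, x1, x2, x3,
    mul_left_of_comm x1, mul_left_of_comm x2, mul_left_of_comm x3,
    mul_left_of_sq s1, mul_left_of_sq s2, mul_left_of_sq s3,
    mul_left_of_anti c1, mul_left_of_anti c2, mul_left_of_anti c3,
    mul_left_of_anti p1, mul_left_of_anti p2, mul_left_of_anti p3,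
    mul_left_of_comm y1, mul_left_of_comm y2, mul_left_of_comm y3,
    mul_left_of_comm y4, mul_left_of_comm y5, mul_left_of_comm y6,
    mul_neg, neg_mul, neg_neg]
  abel

/-- The failure of a braid relation for `uhat` is a multiple of the outer `uhat x c a d`. This
complements the Yang-Baxter equation, and replaces it for patterns (a, b, a), where the factor x_a²
− x_d² vanishes. -/
theorem uhat_cubic (a b d : ι) (hab : a ≠ b) (hbd : b ≠ d) (had : a ≠ d) :
    uhat x c a b * uhat x c b d * uhat x c a b * (x b * x b - x d * x d) -
      uhat x c b d * uhat x c a b * uhat x c b d * (x a * x a - x b * x b) =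
      2 * (uhat x c a d * (3 * (x b * x b * (x b * x b)) - x a * x a * (x d * x d) -
        x b * x b * (x a * x a + x d * x d))) := by
  have x1 := h.xx b a
  have x2 := h.xx d a
  have x3 := h.xx d b
  have s1 := h.c_sq a
  have s2 := h.c_sq b
  have s3 := h.c_sq d
  have c1 := h.cc b a hab.symm
  have c2 := h.cc d a had.symm
  have c3 := h.cc d b hbd.symm
  have p1 := h.xc_same a
  have p2 := h.xc_same b
  have p3 := h.xc_same d
  have y1 := h.xc a b hab
  have y2 := h.xc b a hab.symm
  have y3 := h.xc a d had
  have y4 := h.xc d a had.symm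
  have y5 := h.xc b d hbd
  have y6 := h.xc d b hbd.symm
  -- The numeral is expanded so that its products distribute into words which `abel` can compare.
  have t3 : (3 : A) = 1 + 1 + 1 := by norm_num
  simp only [uhat, mul_add, add_mul, mul_sub, sub_mul, mul_assoc, x1, x2, x3,
    mul_left_of_comm x1, mul_left_of_comm x2, mul_left_of_comm x3,
    mul_left_of_sq s1, mul_left_of_sq s2, mul_left_of_sq s3,
    mul_left_of_anti c1, mul_left_of_anti c2, mul_left_of_anti c3,
    mul_left_of_anti p1, mul_left_of_anti p2, mul_left_of_anti p3,
    mul_left_of_comm y1, mul_left_of_comm y2, mul_left_of_comm y3,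
    mul_left_of_comm y4, mul_left_of_comm y5, mul_left_of_comm y6,
    mul_neg, neg_mul, neg_neg, one_mul, two_mul, t3]
  abel

end XCRel

/-! ## The relations of the affine Hecke-Clifford algebra and its intertwiners -/

/-- The defining relations of the affine Hecke-Clifford algebra, in an arbitrary ring. -/
structure HCRel {A : Type*} [Ring A] {n : ℕ} (s : Fin (n - 1) → A) (x c : Fin n → A) : Prop
    extends XCRel x c where
  s_sq : ∀ k, s k * s k = 1
  s_comm : ∀ k l : Fin (n - 1), k.1 + 1 < l.1 → s k * s l = s l * s k
  braid : ∀ k l : Fin (n - 1), k.1 + 1 = l.1 → s k * s l * s k = s l * s k * s l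
  s_x : ∀ k, s k * x (lo k) = x (hi k) * s k - (1 + c (lo k) * c (hi k))
  s_x_far : ∀ k l, l ≠ lo k → l ≠ hi k → s k * x l = x l * s k
  s_c_lo : ∀ k, s k * c (lo k) = c (hi k) * s k
  s_c_hi : ∀ k, s k * c (hi k) = c (lo k) * s k
  s_c_far : ∀ k l, l ≠ lo k → l ≠ hi k → s k * c l = c l * s k

theorem lo_ne_hi {n : ℕ} (k : Fin (n - 1)) : lo k ≠ hi k := by
  simp [lo, hi, Fin.ext_iff]

theorem simpleSwap_lo {n : ℕ} (k : Fin (n - 1)) : simpleSwap k (lo k) = hi k :=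
  Equiv.swap_apply_left _ _

theorem simpleSwap_hi {n : ℕ} (k : Fin (n - 1)) : simpleSwap k (hi k) = lo k :=
  Equiv.swap_apply_right _ _

theorem simpleSwap_far {n : ℕ} {k : Fin (n - 1)} {l : Fin n} (h₁ : l ≠ lo k) (h₂ : l ≠ hi k) :
    simpleSwap k l = l :=
  Equiv.swap_apply_of_ne_of_ne h₁ h₂

/-- The intertwining elements `s_k (x_k ^ 2 - x_{k+1} ^ 2) + (x_k + x_{k+1}) + c_k c_{k+1} (x_k -
x_{k+1})`. -/
def inter {A : Type*} [Ring A] {n : ℕ} (s : Fin (n - 1) → A) (x c : Fin n → A)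
    (k : Fin (n - 1)) : A :=
  s k * (x (lo k) * x (lo k) - x (hi k) * x (hi k)) + uhat x c (lo k) (hi k)

namespace HCRel

variable {A : Type*} [Ring A] {n : ℕ} {s : Fin (n - 1) → A} {x c : Fin n → A} (h : HCRel s x c)
include h

/-- Multiply `s_x` by s_k on both sides and use s_k² = 1. The Clifford term changes sign because s_k
exchanges two anticommuting generators. -/
theorem s_x_hi (k : Fin (n - 1)) :
    s k * x (hi k) = x (lo k) * s k + 1 - c (lo k) * c (hi k) := by
  have h1 : s k * (s k * x (lo k)) * s k = s k * (x (hi k) * s k - (1 + c (lo k) * c (hi k))) * s k := by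
    rw [h.s_x]
  rw [← mul_assoc, h.s_sq, one_mul, mul_sub, sub_mul, mul_add, add_mul, mul_one, h.s_sq,
    ← mul_assoc (s k) (c _), h.s_c_lo, mul_assoc (c _) (s k), h.s_c_hi, mul_assoc (c _),
    mul_assoc (c _), h.s_sq, mul_one, mul_assoc (s k), mul_assoc (x _), h.s_sq, mul_one,
    h.cc _ _ (lo_ne_hi k).symm] at h1
  rw [h1]
  abel

theorem s_mul_c (k : Fin (n - 1)) (a : Fin n) : s k * c a = c (simpleSwap k a) * s k := by
  by_cases h₁ : a = lo k
  · rw [h₁, simpleSwap_lo, h.s_c_lo]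
  by_cases h₂ : a = hi k
  · rw [h₂, simpleSwap_hi, h.s_c_hi]
  rw [simpleSwap_far h₁ h₂, h.s_c_far k a h₁ h₂]

/-- Moving x_k² through s_k costs exactly `uhat`. This dictates the shape of φ_k: adding `uhat` to
s_k (x_k² − x_{k+1}²) removes the defect. -/
theorem s_sq_lo (k : Fin (n - 1)) :
    s k * (x (lo k) * x (lo k)) = x (hi k) * x (hi k) * s k - uhat x c (lo k) (hi k) := by
  have r1 := h.xc_same (hi k)
  have r2 := h.xc _ _ (lo_ne_hi k).symm
  rw [← mul_assoc, h.s_x, sub_mul, mul_assoc, h.s_x, uhat, add_mul, mul_sub, mul_add, mul_one,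
    ← mul_assoc (x _) (c _), r2, mul_assoc (c _) (x _), r1]
  noncomm_ring

theorem s_sq_hi (k : Fin (n - 1)) :
    s k * (x (hi k) * x (hi k)) = x (lo k) * x (lo k) * s k + uhat x c (lo k) (hi k) := by
  have r1 := h.xc_same (lo k)
  have r2 := h.xc _ _ (lo_ne_hi k)
  have e : x (lo k) * (c (lo k) * c (hi k)) = - (c (lo k) * c (hi k) * x (lo k)) := by
    rw [← mul_assoc, r1, neg_mul, mul_assoc, r2, mul_assoc]
  rw [← mul_assoc, h.s_x_hi, sub_mul, add_mul, mul_assoc, h.s_x_hi, uhat, mul_sub, mul_add, e]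
  noncomm_ring

theorem s_uhat (k : Fin (n - 1)) :
    s k * uhat x c (lo k) (hi k) = uhat x c (lo k) (hi k) * s k := by
  have e : s k * (c (lo k) * c (hi k)) = - (c (lo k) * c (hi k) * s k) := by
    rw [← mul_assoc, h.s_c_lo, mul_assoc, h.s_c_hi, ← mul_assoc, h.cc _ _ (lo_ne_hi k).symm,
      neg_mul]
  have e2 : c (lo k) * c (hi k) * (c (lo k) * c (hi k)) = -1 := by
    rw [mul_assoc, ← mul_assoc (c (hi k)), h.cc _ _ (lo_ne_hi k).symm, neg_mul, mul_assoc, h.c_sq,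
      mul_neg, mul_one, h.c_sq]
  have e3 : s k * (x (lo k) - x (hi k)) = (x (hi k) - x (lo k)) * s k - 2 := by
    rw [mul_sub, h.s_x, h.s_x_hi, ← one_add_one_eq_two]
    noncomm_ring
  have e4 : s k * (c (lo k) * c (hi k) * (x (lo k) - x (hi k))) =
      c (lo k) * c (hi k) * (x (lo k) - x (hi k)) * s k + 2 * (c (lo k) * c (hi k)) := by
    rw [← mul_assoc, e, neg_mul, mul_assoc, e3]
    noncomm_ring
  rw [uhat, mul_add, e4, mul_add, h.s_x, h.s_x_hi]
  noncomm_ring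

/-- The intertwiner `φ_k` moves past the `x` by the transposition `s_k`. -/
theorem inter_mul_x (k : Fin (n - 1)) (a : Fin n) :
    inter s x c k * x a = x (simpleSwap k a) * inter s x c k := by
  set Q := x (lo k) * x (lo k) - x (hi k) * x (hi k) with hQ
  have hQx : Commute Q (x a) := by
    have e1 : Commute (x (lo k) * x (lo k)) (x a) := h.sq_comm_x _ _
    have e2 : Commute (x (hi k) * x (hi k)) (x a) := h.sq_comm_x _ _
    exact e1.sub_left e2
  rw [inter, ← hQ, add_mul, mul_assoc, hQx.eq, ← mul_assoc]
  by_cases h₁ : a = lo k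
  · rw [h₁, simpleSwap_lo, h.s_x, h.uhat_mul_x _ _ (lo_ne_hi k), ← hQ]
    noncomm_ring
  by_cases h₂ : a = hi k
  · rw [h₂, simpleSwap_hi, h.s_x_hi, h.uhat_symm _ _ (lo_ne_hi k),
      h.uhat_mul_x _ _ (lo_ne_hi k).symm, h.cc _ _ (lo_ne_hi k).symm, ← neg_sub (x (lo k) * _), ← hQ]
    noncomm_ring
  rw [simpleSwap_far h₁ h₂, h.s_x_far k a h₁ h₂, h.uhat_comm_x _ _ _ h₁ h₂]
  noncomm_ring

theorem inter_mul_c (k : Fin (n - 1)) (a : Fin n) :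
    inter s x c k * c a = c (simpleSwap k a) * inter s x c k := by
  set Q := x (lo k) * x (lo k) - x (hi k) * x (hi k) with hQ
  have hQx : Commute Q (c a) := by
    have e1 : Commute (x (lo k) * x (lo k)) (c a) := h.sq_comm_c _ _
    have e2 : Commute (x (hi k) * x (hi k)) (c a) := h.sq_comm_c _ _
    exact e1.sub_left e2
  rw [inter, ← hQ, add_mul, mul_assoc, hQx.eq, ← mul_assoc, h.s_mul_c]
  have : uhat x c (lo k) (hi k) * c a = c (simpleSwap k a) * uhat x c (lo k) (hi k) := by
    by_cases h₁ : a = lo k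
    · rw [h₁, simpleSwap_lo, h.uhat_mul_c _ _ (lo_ne_hi k)]
    by_cases h₂ : a = hi k
    · rw [h₂, simpleSwap_hi, h.uhat_symm _ _ (lo_ne_hi k), h.uhat_mul_c _ _ (lo_ne_hi k).symm]
    rw [simpleSwap_far h₁ h₂, h.uhat_comm_c _ _ _ h₁ h₂]
  rw [this]
  noncomm_ring

theorem inter_mul_uhat (k : Fin (n - 1)) (a b : Fin n) :
    inter s x c k * uhat x c a b =
      uhat x c (simpleSwap k a) (simpleSwap k b) * inter s x c k := by
  simp only [uhat, mul_add, add_mul, mul_sub, sub_mul, h.inter_mul_x, mul_assoc]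
  rw [← mul_assoc (inter s x c k) (c a), ← mul_assoc (inter s x c k) (c a)]
  simp only [h.inter_mul_c, mul_assoc]
  rw [← mul_assoc (inter s x c k) (c b), ← mul_assoc (inter s x c k) (c b)]
  simp only [h.inter_mul_c, h.inter_mul_x, mul_assoc]

/-- Put Q = x_k² − x_{k+1}² and U = `uhat`. Then s_k Q = −Q s_k − 2U, while U commutes with Q and
with s_k; in (s_k Q + U)² the terms containing s_k cancel and U² − Q² remains. -/
theorem inter_sq (k : Fin (n - 1)) :
    inter s x c k * inter s x c k =
      2 * (x (lo k) * x (lo k) + x (hi k) * x (hi k)) -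
        (x (lo k) * x (lo k) - x (hi k) * x (hi k)) *
          (x (lo k) * x (lo k) - x (hi k) * x (hi k)) := by
  set Q := x (lo k) * x (lo k) - x (hi k) * x (hi k) with hQ
  set U := uhat x c (lo k) (hi k) with hU
  have e1 : s k * Q = -Q * s k - 2 * U := by
    rw [hQ, mul_sub, h.s_sq_lo, h.s_sq_hi]
    noncomm_ring
  have e2 : Q * U = U * Q := by
    rw [hQ, hU, sub_mul, h.sq_comm_uhat, h.sq_comm_uhat, mul_sub]
  have e3 : s k * U = U * s k := h.s_uhat k
  have e4 : U * U = 2 * (x (lo k) * x (lo k) + x (hi k) * x (hi k)) := h.uhat_sq _ _ (lo_ne_hi k)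
  have e5 : s k * Q * (s k * Q) = - (Q * Q) - 2 * (U * (s k * Q)) := by
    rw [e1, sub_mul, ← e1, mul_assoc (-Q), ← mul_assoc (s k) (s k) Q, h.s_sq]
    noncomm_ring
  have e6 : s k * Q * U = U * (s k * Q) := by
    rw [mul_assoc, e2, ← mul_assoc, e3, mul_assoc]
  rw [inter, ← hQ, ← hU, ← e4, mul_add, add_mul, add_mul, e5, e6]
  noncomm_ring

theorem inter_comm (k l : Fin (n - 1)) (hkl : k.1 + 1 < l.1) :
    inter s x c k * inter s x c l = inter s x c l * inter s x c k := by
  have n1 : lo l ≠ lo k := by simp [lo, Fin.ext_iff]; omega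
  have n2 : lo l ≠ hi k := by simp [lo, hi, Fin.ext_iff]; omega
  have n3 : hi l ≠ lo k := by simp [lo, hi, Fin.ext_iff]; omega
  have n4 : hi l ≠ hi k := by simp [hi, Fin.ext_iff]; omega
  have f1 : Commute (inter s x c k) (x (lo l)) := by
    have := h.inter_mul_x k (lo l)
    rwa [simpleSwap_far n1 n2] at this
  have f2 : Commute (inter s x c k) (x (hi l)) := by
    have := h.inter_mul_x k (hi l)
    rwa [simpleSwap_far n3 n4] at this
  have f3 : Commute (inter s x c k) (uhat x c (lo l) (hi l)) := by
    have := h.inter_mul_uhat k (lo l) (hi l)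
    rwa [simpleSwap_far n1 n2, simpleSwap_far n3 n4] at this
  have g1 : Commute (s l) (x (lo k)) := h.s_x_far _ _ n1.symm n3.symm
  have g2 : Commute (s l) (x (hi k)) := h.s_x_far _ _ n2.symm n4.symm
  have g3 : Commute (s l) (c (lo k)) := h.s_c_far _ _ n1.symm n3.symm
  have g4 : Commute (s l) (c (hi k)) := h.s_c_far _ _ n2.symm n4.symm
  have g5 : Commute (s l) (s k) := (h.s_comm k l hkl).symm
  have g6 : Commute (inter s x c k) (s l) :=
    ((g5.mul_right ((g1.mul_right g1).sub_right (g2.mul_right g2))).add_right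
      ((g1.add_right g2).add_right ((g3.mul_right g4).mul_right (g1.sub_right g2)))).symm
  exact (g6.mul_right ((f1.mul_right f1).sub_right (f2.mul_right f2))).add_right f3

end HCRel

/-! ## Weight spaces -/

section Scalars

variable {F : Type*} [Field F] [CharZero F]

omit [CharZero F] in
theorem q_eq_cast (i : ℕ) : q F i = ((i * (i + 1) : ℕ) : F) := by
  simp [q]

theorem q_injective : Function.Injective (q F) := by
  intro a b hab
  rw [q_eq_cast, q_eq_cast, Nat.cast_inj] at hab
  rcases lt_trichotomy a b with h | h | h
  · nlinarith
  · exact h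
  · nlinarith

omit [CharZero F] in
theorem q_zero : q F 0 = 0 := by simp [q]

theorem q_eq_zero_iff (i : ℕ) : q F i = 0 ↔ i = 0 := by
  rw [← q_zero (F := F), q_injective.eq_iff]

theorem q_sub_ne_zero {a b : ℕ} (h : a ≠ b) : q F a - q F b ≠ 0 :=
  sub_ne_zero.2 fun e => h (q_injective e)

/-- The scalar by which the square of an intertwiner acts. -/
theorem inter_scalar_eq_zero_iff {a b : ℕ} (h : a ≠ b) :
    2 * (q F a + q F b) - (q F a - q F b) * (q F a - q F b) = 0 ↔ a = b + 1 ∨ b = a + 1 := by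
  -- Since q(a) − q(b) = (a − b)(a + b + 1), the expression splits into linear factors; a + b and a
  -- + b + 2 are nonzero for a ≠ b.
  have e : 2 * (q F a + q F b) - (q F a - q F b) * (q F a - q F b) =
      -(((a : F) - (b + 1 : ℕ)) * ((a + 1 : ℕ) - (b : F)) * (((a + b : ℕ) : F) * (a + b + 2 : ℕ))) := by
    simp only [q]
    push_cast
    ring
  rw [e, neg_eq_zero, mul_eq_zero, mul_eq_zero, mul_eq_zero, sub_eq_zero, sub_eq_zero,
    Nat.cast_inj, Nat.cast_inj, Nat.cast_eq_zero, Nat.cast_eq_zero]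
  omega

end Scalars

section Weights

variable {F : Type*} [Field F] {V : Type*} [AddCommGroup V] [Module F V] {n : ℕ}

/-- The weight space of the word `j`: the joint eigenspace of the `x_k ^ 2` with eigenvalues
`q (j_k)`. -/
def wt (x : Fin n → Module.End F V) (j : Fin n → ℕ) : Submodule F V :=
  ⨅ k, Module.End.eigenspace (x k * x k) (q F (j k))

theorem mem_wt {x : Fin n → Module.End F V} {j : Fin n → ℕ} {m : V} :
    m ∈ wt x j ↔ ∀ k, x k (x k m) = q F (j k) • m := by
  simp [wt, Submodule.mem_iInf]

/-- The space is spanned by weight vectors, and the `x_k` are semisimple. -/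
structure IsCS (x : Fin n → Module.End F V) : Prop where
  span : ⨆ j, wt x j = ⊤
  nil : ∀ k m, x k (x k m) = 0 → x k m = 0

/-- Joint generalized eigenspaces of commuting operators are independent, and distinct words give
distinct eigenvalue tuples because q is injective in characteristic zero. -/
theorem iSupIndep_wt [CharZero F] {x : Fin n → Module.End F V}
    (hx : ∀ k l, x k * x l = x l * x k) : iSupIndep (wt x) := by
  have h := Module.End.independent_iInf_maxGenEigenspace_of_forall_mapsTo (fun k => x k * x k)
    (fun i j φ => Module.End.mapsTo_maxGenEigenspace_of_comm (by
      have : Commute (x j) (x i) := hx j i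
      exact (this.mul_left this).mul_right (this.mul_left this)) φ)
  refine (h.comp (f := fun j : Fin n → ℕ => fun k => q F (j k)) ?_).mono ?_
  · intro a b hab
    funext k
    exact q_injective (congrFun hab k)
  · intro j
    refine iInf_mono fun k => ?_
    exact ((x k * x k).genEigenspace (q F (j k))).monotone le_top

theorem XCRel.map_wt_x {x c : Fin n → Module.End F V} (h : XCRel x c) {j : Fin n → ℕ} {m : V}
    (hm : m ∈ wt x j) (a : Fin n) : x a m ∈ wt x j := by
  rw [mem_wt] at *
  intro k
  have := LinearMap.congr_fun (h.sq_comm_x k a) m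
  simp only [Module.End.mul_apply] at this
  rw [this, hm k, map_smul]

theorem XCRel.map_wt_c {x c : Fin n → Module.End F V} (h : XCRel x c) {j : Fin n → ℕ} {m : V}
    (hm : m ∈ wt x j) (a : Fin n) : c a m ∈ wt x j := by
  rw [mem_wt] at *
  intro k
  have := LinearMap.congr_fun (h.sq_comm_c k a) m
  simp only [Module.End.mul_apply] at this
  rw [this, hm k, map_smul]

theorem uhat_mem {x c : Fin n → Module.End F V} {Y : Submodule F V}
    (hx : ∀ k, ∀ m ∈ Y, x k m ∈ Y) (hc : ∀ k, ∀ m ∈ Y, c k m ∈ Y) (a b : Fin n) {m : V}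
    (hm : m ∈ Y) : uhat x c a b m ∈ Y :=
  add_mem (add_mem (hx a m hm) (hx b m hm))
    (hc _ _ (hc _ _ (sub_mem (hx a m hm) (hx b m hm))))

theorem XCRel.map_wt_uhat {x c : Fin n → Module.End F V} (h : XCRel x c) {j : Fin n → ℕ} {m : V}
    (hm : m ∈ wt x j) (a b : Fin n) : uhat x c a b m ∈ wt x j :=
  uhat_mem (fun k _ hm => h.map_wt_x hm k) (fun k _ hm => h.map_wt_c hm k) a b hm

/-- No Jordan blocks: the image of x_k² − t lies in the sum of the other eigenspaces, so (x_k² − t)²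
y = 0 already gives (x_k² − t) y = 0. -/
theorem IsCS.sub_eq_zero {x : Fin n → Module.End F V} (h : IsCS x) (k : Fin n) (t : F) (y : V)
    (hy : x k (x k (x k (x k y) - t • y)) = t • (x k (x k y) - t • y)) :
    x k (x k y) - t • y = 0 := by
  set f := x k * x k with hf
  have h1 : x k (x k y) - t • y ∈ ⨆ (μ : F) (_ : μ ≠ t), f.eigenspace μ := by
    clear hy
    have hy : y ∈ ⨆ j, wt x j := h.span ▸ Submodule.mem_top
    induction hy using Submodule.iSup_induction' with
    | mem j z hz =>
      have e := mem_wt.1 hz k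
      by_cases hq : q F (j k) = t
      · rw [e, hq, sub_self]
        exact zero_mem _
      · rw [e, ← sub_smul]
        refine Submodule.smul_mem _ _ ?_
        refine Submodule.mem_iSup_of_mem _ (Submodule.mem_iSup_of_mem hq ?_)
        rw [Module.End.mem_eigenspace_iff]
        exact e
    | zero => simp
    | add a b _ _ ha hb =>
      have : x k (x k (a + b)) - t • (a + b) =
          (x k (x k a) - t • a) + (x k (x k b) - t • b) := by
        simp only [map_add, smul_add]
        abel
      rw [this]
      exact add_mem ha hb
  have h2 : x k (x k y) - t • y ∈ f.eigenspace t := Module.End.mem_eigenspace_iff.2 hy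
  exact Submodule.disjoint_def.1 (f.eigenspaces_iSupIndep t) _ h2 h1

variable {s : Fin (n - 1) → Module.End F V} {x c : Fin n → Module.End F V}

theorem permWord_simpleSwap_lo (k : Fin (n - 1)) (j : Fin n → ℕ) :
    permWord (simpleSwap k) j (lo k) = j (hi k) := by
  simp [permWord, simpleSwap]

theorem permWord_simpleSwap_hi (k : Fin (n - 1)) (j : Fin n → ℕ) :
    permWord (simpleSwap k) j (hi k) = j (lo k) := by
  simp [permWord, simpleSwap]

theorem permWord_simpleSwap_far {k : Fin (n - 1)} {l : Fin n} (h₁ : l ≠ lo k) (h₂ : l ≠ hi k)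
    (j : Fin n → ℕ) : permWord (simpleSwap k) j l = j l := by
  have : (simpleSwap k)⁻¹ = simpleSwap k := Equiv.swap_inv _ _
  rw [permWord, this, simpleSwap_far h₁ h₂]

theorem simpleSwap_inv (k : Fin (n - 1)) : (simpleSwap k)⁻¹ = simpleSwap k :=
  Equiv.swap_inv _ _

theorem simpleSwap_apply_apply (k : Fin (n - 1)) (a : Fin n) :
    simpleSwap k (simpleSwap k a) = a :=
  Equiv.swap_apply_self _ _ _

theorem XCRel.uhat_uhat_apply {x c : Fin n → Module.End F V} (h : XCRel x c)
    {j : Fin n → ℕ} {m : V} (hm : m ∈ wt x j) {a b : Fin n} (hab : a ≠ b) :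
    uhat x c a b (uhat x c a b m) = (2 * (q F (j a) + q F (j b))) • m := by
  have := LinearMap.congr_fun (h.uhat_sq a b hab) m
  rw [mem_wt] at hm
  simp only [Module.End.mul_apply, two_mul, LinearMap.add_apply, hm] at this
  rw [this]
  module

namespace HCRel

variable (h : HCRel s x c)
include h

theorem inter_x_apply (k : Fin (n - 1)) (a : Fin n) (m : V) :
    inter s x c k (x a m) = x (simpleSwap k a) (inter s x c k m) :=
  LinearMap.congr_fun (h.inter_mul_x k a) m

theorem inter_c_apply (k : Fin (n - 1)) (a : Fin n) (m : V) :
    inter s x c k (c a m) = c (simpleSwap k a) (inter s x c k m) :=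
  LinearMap.congr_fun (h.inter_mul_c k a) m

theorem inter_uhat_apply (k : Fin (n - 1)) (a b : Fin n) (m : V) :
    inter s x c k (uhat x c a b m) =
      uhat x c (simpleSwap k a) (simpleSwap k b) (inter s x c k m) :=
  LinearMap.congr_fun (h.inter_mul_uhat k a b) m

theorem map_wt_inter {j : Fin n → ℕ} {m : V} (hm : m ∈ wt x j) (k : Fin (n - 1)) :
    inter s x c k m ∈ wt x (permWord (simpleSwap k) j) := by
  rw [mem_wt] at *
  intro a
  have := h.inter_x_apply k (simpleSwap k a) (x (simpleSwap k a) m)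
  rw [hm, h.inter_x_apply, simpleSwap_apply_apply, map_smul] at this
  rw [← this, permWord, simpleSwap_inv]

omit h in
-- Wherever the letters at k and k + 1 differ, this recovers s_k from φ_k and `uhat`.
theorem smul_s_apply {j : Fin n → ℕ} {m : V} (hm : m ∈ wt x j) (k : Fin (n - 1)) :
    (q F (j (lo k)) - q F (j (hi k))) • s k m =
      inter s x c k m - uhat x c (lo k) (hi k) m := by
  rw [mem_wt] at hm
  simp only [inter, LinearMap.add_apply, Module.End.mul_apply, LinearMap.sub_apply, hm]
  rw [← sub_smul, map_smul]
  abel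

theorem inter_inter_apply {j : Fin n → ℕ} {m : V} (hm : m ∈ wt x j) (k : Fin (n - 1)) :
    inter s x c k (inter s x c k m) =
      (2 * (q F (j (lo k)) + q F (j (hi k))) - (q F (j (lo k)) - q F (j (hi k))) *
        (q F (j (lo k)) - q F (j (hi k)))) • m := by
  have := LinearMap.congr_fun (h.inter_sq k) m
  rw [mem_wt] at hm
  simp only [Module.End.mul_apply, LinearMap.sub_apply, two_mul, LinearMap.add_apply, hm,
    map_sub, map_smul] at this
  rw [this]
  module

/-- No weight has two equal adjacent letters. -/
theorem eq_zero_of_adjacent_eq [CharZero F] (hcs : IsCS x) {j : Fin n → ℕ} {m : V}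
    (hm : m ∈ wt x j) (k : Fin (n - 1)) (hk : j (lo k) = j (hi k)) : m = 0 := by
  have hm' := mem_wt.1 hm
  have key : ∀ m ∈ wt x j, uhat x c (lo k) (hi k) m = 0 := by
    intro m hm
    have hm' := mem_wt.1 hm
    have e := LinearMap.congr_fun (h.s_sq_lo k) m
    simp only [Module.End.mul_apply, LinearMap.sub_apply, hm', map_smul] at e
    have e2 : x (hi k) (x (hi k) (s k m)) - q F (j (hi k)) • s k m =
        uhat x c (lo k) (hi k) m := by
      rw [← hk, e]
      abel
    -- The vector uhat m has again weight j, so (x_{k+1}² − q)² kills s_k m; by semisimplicity the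
    -- first power kills it too, and its value is uhat m.
    rw [← e2]
    apply hcs.sub_eq_zero
    rw [e2]
    exact mem_wt.1 (h.map_wt_uhat hm _ _) _
  -- The square of `uhat` is the scalar 4 q(j_k) here, so either m = 0 or the repeated letter is 0.
  have e := h.uhat_uhat_apply hm (lo_ne_hi k)
  rw [key m hm, map_zero, ← hk, eq_comm, smul_eq_zero] at e
  rcases e with e | e
  swap
  · exact e
  have hq : q F (j (lo k)) = 0 := by
    rw [← two_mul, mul_eq_zero, mul_eq_zero] at e
    simpa using e
  have hq' : q F (j (hi k)) = 0 := hk ▸ hq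
  have h1 : x (lo k) m = 0 := hcs.nil _ _ (by rw [hm', hq, zero_smul])
  have h2 : x (hi k) (s k m) = 0 := by
    apply hcs.nil
    have e := LinearMap.congr_fun (h.s_sq_lo k) m
    simp only [Module.End.mul_apply, LinearMap.sub_apply, key m hm, h1, map_zero, sub_zero] at e
    exact e.symm
  -- All terms with x vanish, and the relation between s_k and x_k leaves (1 + c_k c_{k+1}) m = 0.
  -- As c_k c_{k+1} squares to −1, this yields 2m = 0.
  have e := LinearMap.congr_fun (h.s_x k) m
  simp only [Module.End.mul_apply, LinearMap.sub_apply, h1, h2, map_zero, zero_sub,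
    LinearMap.add_apply, Module.End.one_apply] at e
  have e3 : m + c (lo k) (c (hi k) m) = 0 := by rw [← neg_eq_zero, ← e]
  have e4 := congrArg (c (lo k)) e3
  have e5 := congrArg (c (hi k)) e4
  have csq : ∀ a m, c a (c a m) = m := fun a m => LinearMap.congr_fun (h.c_sq a) m
  have canti := LinearMap.congr_fun (h.cc _ _ (lo_ne_hi k)) m
  simp only [Module.End.mul_apply, LinearMap.neg_apply] at canti
  rw [map_add, csq, map_zero, map_add, csq, map_zero] at e5
  rw [canti] at e3
  have : (2 : F) • m = 0 := by
    rw [two_smul]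
    linear_combination (norm := module) e3 + e5
  simpa using this

end HCRel
end Weights

/-! ### The braid relation of the intertwiners on weights with distinct letters -/

section Braid

variable {F : Type*} [Field F] {V : Type*} [AddCommGroup V] [Module F V] {n : ℕ}
  {s : Fin (n - 1) → Module.End F V} {x c : Fin n → Module.End F V}

namespace XCRel

variable (h : XCRel x c)
include h

theorem uhat_yangBaxter_apply {j : Fin n → ℕ} {m : V} (hm : m ∈ wt x j) {a b d : Fin n}
    (hab : a ≠ b) (hbd : b ≠ d) (had : a ≠ d) :
    (q F (j a) - q F (j d)) • uhat x c a b (uhat x c b d m) =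
      (q F (j a) - q F (j b)) • uhat x c b d (uhat x c a d m) +
        (q F (j b) - q F (j d)) • uhat x c a d (uhat x c a b m) := by
  have := LinearMap.congr_fun (h.uhat_yangBaxter a b d hab hbd had) m
  simp only [Module.End.mul_apply, LinearMap.sub_apply, LinearMap.add_apply, mem_wt.1 hm,
    map_sub, map_smul] at this
  linear_combination (norm := module) this

theorem uhat_cubic_apply {j : Fin n → ℕ} {m : V} (hm : m ∈ wt x j) {a b d : Fin n}
    (hab : a ≠ b) (hbd : b ≠ d) (had : a ≠ d) :
    (q F (j b) - q F (j d)) • uhat x c a b (uhat x c b d (uhat x c a b m)) -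
      (q F (j a) - q F (j b)) • uhat x c b d (uhat x c a b (uhat x c b d m)) =
      (2 * (3 * (q F (j b) * q F (j b)) - q F (j a) * q F (j d) -
        q F (j b) * (q F (j a) + q F (j d)))) • uhat x c a d m := by
  have e := LinearMap.congr_fun (h.uhat_cubic a b d hab hbd had) m
  have t3 : (3 : Module.End F V) = 1 + 1 + 1 := by norm_num
  simp only [Module.End.mul_apply, LinearMap.sub_apply, LinearMap.add_apply, mem_wt.1 hm,
    map_sub, map_add, map_smul, two_mul, t3, add_mul, one_mul] at e
  linear_combination (norm := module) e

end XCRel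

namespace HCRel

variable (h : HCRel s x c)
include h

/-- The image φ_k m would have a weight with two equal adjacent letters. -/
theorem inter_eq_zero [CharZero F] (hcs : IsCS x) {j : Fin n → ℕ} {m : V} (hm : m ∈ wt x j)
    {k l : Fin (n - 1)} (hk : permWord (simpleSwap k) j (lo l) = permWord (simpleSwap k) j (hi l)) :
    inter s x c k m = 0 :=
  h.eq_zero_of_adjacent_eq hcs (h.map_wt_inter hm k) l hk

/-- The braid relation for the intertwiners, on a weight space with three distinct letters. -/
theorem inter_braid_of_ne [CharZero F] {j : Fin n → ℕ} {m : V} (hm : m ∈ wt x j)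
    {k l : Fin (n - 1)} (hkl : k.1 + 1 = l.1) (h12 : j (lo k) ≠ j (hi k))
    (h23 : j (hi k) ≠ j (hi l)) (h13 : j (lo k) ≠ j (hi l)) :
    inter s x c k (inter s x c l (inter s x c k m)) =
      inter s x c l (inter s x c k (inter s x c l m)) := by
  have el : lo l = hi k := by simp [lo, hi, hkl]
  have n12 : lo k ≠ hi k := lo_ne_hi k
  have n23 : hi k ≠ hi l := el ▸ lo_ne_hi l
  have n13 : lo k ≠ hi l := by simp [lo, hi, Fin.ext_iff]; omega
  have S1 : simpleSwap k (lo k) = hi k := simpleSwap_lo k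
  have S2 : simpleSwap k (hi k) = lo k := simpleSwap_hi k
  have S3 : simpleSwap k (hi l) = hi l := simpleSwap_far n13.symm n23.symm
  have R1 : simpleSwap l (lo k) = lo k := simpleSwap_far (el ▸ n12) n13
  have R2 : simpleSwap l (hi k) = hi l := el ▸ simpleSwap_lo l
  have R3 : simpleSwap l (hi l) = hi k := el ▸ simpleSwap_hi l
  have us := fun a b (hab : a ≠ b) => h.uhat_symm a b hab
  have P := h.inter_uhat_apply (k := k)
  have R := h.inter_uhat_apply (k := l)
  have mP := fun {j m} (hm : m ∈ wt x j) => h.map_wt_inter hm k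
  have mR := fun {j m} (hm : m ∈ wt x j) => h.map_wt_inter hm l
  have mu := fun {j m} (hm : m ∈ wt x j) a b => h.map_wt_uhat hm a b
  have sk := fun {j m} (hm : m ∈ wt x j) => smul_s_apply (s := s) (c := c) hm k
  have sl := fun {j m} (hm : m ∈ wt x j) => smul_s_apply (s := s) (c := c) hm l
  have br := LinearMap.congr_fun (h.braid k l hkl) m
  have y1 := h.uhat_yangBaxter_apply (mP hm) n12 n23 n13
  have y2 := h.uhat_yangBaxter_apply (mR hm) n23.symm n12.symm n13.symm
  have cu := h.uhat_cubic_apply hm n12 n23 n13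
  have sqk := h.inter_inter_apply hm k
  have sql := h.inter_inter_apply hm l
  have w1 : ∀ j : Fin n → ℕ, permWord (simpleSwap k) j (lo k) = j (hi k) :=
    permWord_simpleSwap_lo k
  have w2 : ∀ j : Fin n → ℕ, permWord (simpleSwap k) j (hi k) = j (lo k) :=
    permWord_simpleSwap_hi k
  have w3 : ∀ j : Fin n → ℕ, permWord (simpleSwap k) j (hi l) = j (hi l) :=
    permWord_simpleSwap_far n13.symm n23.symm
  have v1 : ∀ j : Fin n → ℕ, permWord (simpleSwap l) j (lo k) = j (lo k) :=
    permWord_simpleSwap_far (el ▸ n12) n13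
  have v2 : ∀ j : Fin n → ℕ, permWord (simpleSwap l) j (hi k) = j (hi l) := fun j =>
    el ▸ permWord_simpleSwap_lo l j
  have v3 : ∀ j : Fin n → ℕ, permWord (simpleSwap l) j (hi l) = j (hi k) := fun j =>
    el ▸ permWord_simpleSwap_hi l j
  simp only [Module.End.mul_apply] at br
  -- In s_k s_l s_k m (equations a) and s_l s_k s_l m (equations b) each s is replaced in turn by φ
  -- − uhat, divided by the difference of the two scalars involved.
  have a1 := congrArg (fun z => s k (s l z)) (sk hm)
  have a2 := congrArg (s k) (sl (mP hm))
  have a3 := congrArg (s k) (sl (mu hm (lo k) (hi k)))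
  have a4 := sk (mR (mP hm))
  have a5 := sk (mu (mP hm) (hi k) (hi l))
  have a6 := sk (mR (mu hm (lo k) (hi k)))
  have a7 := sk (mu (mu hm (lo k) (hi k)) (hi k) (hi l))
  have b1 := congrArg (fun z => s l (s k z)) (sl hm)
  have b2 := congrArg (s l) (sk (mR hm))
  have b3 := congrArg (s l) (sk (mu hm (hi k) (hi l)))
  have b4 := sl (mP (mR hm))
  have b5 := sl (mu (mR hm) (lo k) (hi k))
  have b6 := sl (mP (mu hm (hi k) (hi l)))
  have b7 := sl (mu (mu hm (hi k) (hi l)) (lo k) (hi k))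
  simp only [map_smul, map_sub, el, w1, w2, w3, v1, v2, v3, P, R, S1, S2, S3, R1, R2, R3,
    us _ _ n12.symm, us _ _ n23.symm, us _ _ n13.symm, sqk, sql] at a1 a2 a3 a4 a5 a6 a7 b1 b2 b3 b4 b5 b6 b7 y1 y2 cu
  have na := q_sub_ne_zero (F := F) h12
  have nb := q_sub_ne_zero (F := F) h23
  have nd := q_sub_ne_zero (F := F) h13
  set A := q F (j (lo k))
  set B := q F (j (hi k))
  set D := q F (j (hi l))
  -- With denominators cleared, the terms with one intertwiner cancel by the Yang-Baxter equation at
  -- the weights of φ_k m and φ_l m. The terms with none cancel by the cubic identity together with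
  -- the scalars φ_k² and φ_l². Only the two triple products survive.
  have key : ((A - B) * (B - D)) • (inter s x c k (inter s x c l (inter s x c k m)) -
      inter s x c l (inter s x c k (inter s x c l m))) = 0 := by
    linear_combination (norm := module)
      ((A - B) * (A - B) * (A - D) * (B - D) * (B - D)) • br
      - ((B - D) * (A - B) * (A - D) * (B - D)) • a1 - ((B - D) * (A - B) * (B - D)) • a2
      + ((B - D) * (A - B) * (A - D)) • a3 - ((B - D) * (A - B)) • a4
      - ((B - D) * (B - D)) • a5 + ((B - D) * (A - B)) • a6 - ((B - D) * (A - D)) • a7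
      + ((A - B) * (A - B) * (A - D) * (B - D)) • b1 + ((A - B) * (A - B) * (B - D)) • b2
      - ((A - B) * (A - D) * (B - D)) • b3 + ((A - B) * (B - D)) • b4
      + ((A - B) * (A - B)) • b5 - ((A - B) * (B - D)) • b6 + ((A - B) * (A - D)) • b7
      + (B - D) • y1 + (A - B) • y2 + (A - D) • cu
  rwa [smul_eq_zero_iff_right (mul_ne_zero na nb), sub_eq_zero] at key

end HCRel
end Braid

/-! ## Descents of permutations -/

section Descents

variable {n : ℕ}

theorem perm_apply_inv (σ : Equiv.Perm (Fin n)) (a : Fin n) : σ (σ⁻¹ a) = a :=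
  σ.apply_symm_apply a

theorem perm_inv_apply (σ : Equiv.Perm (Fin n)) (a : Fin n) : σ⁻¹ (σ a) = a :=
  σ.symm_apply_apply a

/-- `s_k` is a left descent of `w`. -/
def Desc (w : Equiv.Perm (Fin n)) (k : Fin (n - 1)) : Prop := w⁻¹ (hi k) < w⁻¹ (lo k)

/-- A measure that decreases along left descents. -/
def permSize (w : Equiv.Perm (Fin n)) : ℕ := ∑ a : Fin n, a.1 * (n - (w⁻¹ a).1)

theorem simpleSwap_mul_inv_apply (k : Fin (n - 1)) (w : Equiv.Perm (Fin n)) (a : Fin n) :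
    (simpleSwap k * w)⁻¹ a = w⁻¹ (simpleSwap k a) := by
  rw [mul_inv_rev, simpleSwap_inv, Equiv.Perm.mul_apply]

theorem simpleSwap_mul_self (k : Fin (n - 1)) : simpleSwap k * simpleSwap k = 1 :=
  Equiv.swap_mul_self _ _

theorem simpleSwap_mul_mul (k : Fin (n - 1)) (w : Equiv.Perm (Fin n)) :
    simpleSwap k * (simpleSwap k * w) = w := by
  rw [← mul_assoc, simpleSwap_mul_self, one_mul]

theorem simpleSwap_mul_comm {k l : Fin (n - 1)} (hkl : k.1 + 1 < l.1) :
    simpleSwap k * simpleSwap l = simpleSwap l * simpleSwap k := by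
  refine Equiv.Perm.Disjoint.commute fun a => ?_
  by_cases h₁ : a = lo k ∨ a = hi k
  · right
    apply simpleSwap_far <;> rcases h₁ with rfl | rfl <;> simp [lo, hi, Fin.ext_iff] <;> omega
  · rw [not_or] at h₁
    exact Or.inl (simpleSwap_far h₁.1 h₁.2)

theorem simpleSwap_braid {k l : Fin (n - 1)} (hkl : k.1 + 1 = l.1) :
    simpleSwap k * simpleSwap l * simpleSwap k = simpleSwap l * simpleSwap k * simpleSwap l := by
  have el : lo l = hi k := by simp [lo, hi, hkl]
  have n13 : lo k ≠ hi l := by simp [lo, hi, Fin.ext_iff]; omega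
  have n12 : lo k ≠ hi k := lo_ne_hi k
  have n23 : hi k ≠ hi l := el ▸ lo_ne_hi l
  rw [simpleSwap, simpleSwap, el, Equiv.swap_mul_swap_mul_swap n12 n13, Equiv.swap_comm (hi k),
    Equiv.swap_comm (lo k) (hi k), Equiv.swap_mul_swap_mul_swap n23.symm n13.symm]
  exact Equiv.swap_comm _ _

/-- At a descent the larger index meets the larger factor; exchanging the two factors lowers the sum
by w⁻¹(lo k) − w⁻¹(hi k), and the other terms do not change. -/
theorem permSize_lt {w : Equiv.Perm (Fin n)} {k : Fin (n - 1)} (hk : Desc w k) :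
    permSize (simpleSwap k * w) < permSize w := by
  have e : permSize (simpleSwap k * w) = ∑ a : Fin n, (simpleSwap k a).1 * (n - (w⁻¹ a).1) := by
    rw [permSize, ← Equiv.sum_comp (simpleSwap k)]
    simp only [simpleSwap_mul_inv_apply, simpleSwap_apply_apply]
  rw [e, permSize]
  zify
  rw [← sub_pos, ← Finset.sum_sub_distrib, Fintype.sum_eq_add (lo k) (hi k) (lo_ne_hi k)]
  · rw [simpleSwap_lo, simpleSwap_hi]
    have h1 : ((w⁻¹ (hi k)).1 : ℤ) < (w⁻¹ (lo k)).1 := by exact_mod_cast hk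
    have h2 := (w⁻¹ (lo k)).2
    have h3 := (w⁻¹ (hi k)).2
    have h4 : ((hi k).1 : ℤ) = (lo k).1 + 1 := by simp [lo, hi]
    rw [h4, Nat.cast_sub h2.le, Nat.cast_sub h3.le]
    ring_nf
    linarith
  · rintro a ⟨h1, h2⟩
    rw [simpleSwap_far h1 h2, sub_self]

/-- Without descents w⁻¹ is strictly increasing, and the identity is the only increasing bijection
of `Fin n`. -/
theorem exists_desc {w : Equiv.Perm (Fin n)} (hw : w ≠ 1) : ∃ k, Desc w k := by
  by_contra! hk
  apply hw
  have hlt : ∀ d : ℕ, ∀ a b : Fin n, a.1 + d + 1 = b.1 → w⁻¹ a < w⁻¹ b := by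
    have step : ∀ a b : Fin n, a.1 + 1 = b.1 → w⁻¹ a < w⁻¹ b := by
      intro a b hab
      have := hk ⟨a.1, by omega⟩
      rw [Desc, not_lt] at this
      have ea : lo (n := n) ⟨a.1, by omega⟩ = a := rfl
      have eb : hi (n := n) ⟨a.1, by omega⟩ = b := Fin.ext hab
      rw [ea, eb] at this
      refine lt_of_le_of_ne this fun e => ?_
      have := w⁻¹.injective e
      omega
    intro d
    induction d with
    | zero => exact step
    | succ d ih =>
      intro a b hab
      exact (ih a ⟨a.1 + d + 1, by omega⟩ rfl).trans (step _ _ (by simp; omega))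
  have hmono : StrictMono (w⁻¹ : Equiv.Perm (Fin n)) := by
    intro a b hab
    have : a.1 < b.1 := hab
    exact hlt (b.1 - a.1 - 1) a b (by omega)
  have := (StrictMono.range_inj hmono strictMono_id).1 (by simp)
  rw [← inv_inj]
  ext a
  simp [this]

/-- Plays the role of induction on Coxeter length: stripping descents lowers `permSize` until the
identity is reached. -/
theorem desc_induction {P : Equiv.Perm (Fin n) → Prop} (one : P 1)
    (step : ∀ w k, Desc w k → P (simpleSwap k * w) → P w) (w : Equiv.Perm (Fin n)) : P w := by
  induction hN : permSize w using Nat.strong_induction_on generalizing w with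
  | _ N ih =>
    by_cases hw : w = 1
    · exact hw ▸ one
    obtain ⟨k, hk⟩ := exists_desc hw
    exact step w k hk (ih _ (hN ▸ permSize_lt hk) _ rfl)

theorem not_desc_iff {w : Equiv.Perm (Fin n)} {k : Fin (n - 1)} :
    ¬ Desc w k ↔ Desc (simpleSwap k * w) k := by
  rw [Desc, Desc, simpleSwap_mul_inv_apply, simpleSwap_mul_inv_apply, simpleSwap_lo,
    simpleSwap_hi, not_lt]
  refine ⟨fun h => lt_of_le_of_ne h fun e => lo_ne_hi k (w⁻¹.injective e), le_of_lt⟩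

theorem simpleSwap_lt {k : Fin (n - 1)} {a b : Fin n} (hab : a < b)
    (h : ¬ (a = lo k ∧ b = hi k)) : simpleSwap k a < simpleSwap k b := by
  have h1 : (lo k).1 = k.1 := rfl
  have h2 : (hi k).1 = k.1 + 1 := rfl
  rw [Fin.lt_def] at *
  simp only [Fin.ext_iff, h1, h2] at h
  by_cases a1 : a = lo k
  · by_cases b1 : b = hi k
    · simp_all
    · have : b ≠ lo k := by rintro rfl; simp_all
      rw [a1, simpleSwap_lo, simpleSwap_far this b1]
      simp_all only [Fin.ext_iff]
      omega
  by_cases a2 : a = hi k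
  · have b1 : b ≠ lo k := by rintro rfl; rw [a2] at hab; omega
    have b2 : b ≠ hi k := by rintro rfl; rw [a2] at hab; omega
    rw [a2, simpleSwap_hi, simpleSwap_far b1 b2]
    rw [a2] at hab
    omega
  rw [simpleSwap_far a1 a2]
  by_cases b1 : b = lo k
  · rw [b1, simpleSwap_lo]
    rw [b1] at hab
    omega
  by_cases b2 : b = hi k
  · rw [b2, simpleSwap_hi]
    rw [b2] at hab
    simp only [Fin.ext_iff] at a1
    omega
  rwa [simpleSwap_far b1 b2]

theorem permWord_mul (σ τ : Equiv.Perm (Fin n)) (j : Fin n → ℕ) :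
    permWord (σ * τ) j = permWord σ (permWord τ j) := by
  funext a
  simp [permWord]

theorem permWord_one (j : Fin n → ℕ) : permWord 1 j = j := by
  funext a
  simp [permWord]

/-- A permutation keeping the order of equal letters sends the r-th occurrence of a letter to the
r-th occurrence in the permuted word, so that word determines it. The inverse images are compared
position by position from the left. -/
theorem perm_eq_of_permWord_eq {j : Fin n → ℕ} {w w' : Equiv.Perm (Fin n)}
    (e : permWord w j = permWord w' j) (hw : ∀ a b, a < b → j a = j b → w a < w b)
    (hw' : ∀ a b, a < b → j a = j b → w' a < w' b) : w = w' := by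
  have key : ∀ N : ℕ, ∀ p : Fin n, p.1 = N → w⁻¹ p = w'⁻¹ p := by
    intro N
    induction N using Nat.strong_induction_on with
    | _ N ih =>
      intro p hp
      have ej : j (w⁻¹ p) = j (w'⁻¹ p) := congrFun e p
      rcases lt_trichotomy (w⁻¹ p) (w'⁻¹ p) with hlt | heq | hlt
      · have h1 := hw' _ _ hlt ej
        rw [perm_apply_inv] at h1
        have h2 := ih (w' (w⁻¹ p)).1 (by rw [← hp]; exact h1) _ rfl
        rw [perm_inv_apply, Equiv.Perm.inv_eq_iff_eq, perm_apply_inv] at h2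
        exact absurd h2 h1.ne
      · exact heq
      · have h1 := hw _ _ hlt ej.symm
        rw [perm_apply_inv] at h1
        have h2 := ih (w (w'⁻¹ p)).1 (by rw [← hp]; exact h1) _ rfl
        rw [perm_inv_apply, eq_comm, Equiv.Perm.inv_eq_iff_eq,
          perm_apply_inv] at h2
        exact absurd h2 h1.ne
  rw [← inv_inj]
  ext p
  rw [key _ p rfl]

end Descents

/-! ## Words in which neighbouring letters alternate -/

section Alternating

variable {n : ℕ}

/-- Between two occurrences of a letter all its neighbours occur. -/
def Alternating (i : Fin n → ℕ) : Prop :=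
  ∀ k l, k < l → i k = i l → ∀ b, (b = i k + 1 ∨ i k = b + 1) → ∃ p, k < p ∧ p < l ∧ i p = b

/-- Induction on the distance of two equal letters, which may be taken consecutive. If an end can be
moved inwards by an admissible transposition, the distance drops. Otherwise a neighbouring letter
stands next to each end. If neither of these is b, both are the other neighbour. When they are
distinct positions, induction puts i k strictly between them, which is excluded; when they coincide
the pattern is (0, 1, 0), and 1 is the only neighbour of 0. -/
theorem alternating_of_closed {S : Set (Fin n → ℕ)}
    (closed : ∀ i ∈ S, ∀ k, Admissible i k → permWord (simpleSwap k) i ∈ S)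
    (adj : ∀ i ∈ S, ∀ k, i (lo k) ≠ i (hi k))
    (three : ∀ i ∈ S, ∀ k l : Fin (n - 1), k.1 + 1 = l.1 → i (lo k) = i (hi l) →
      i (lo k) = 0 ∧ i (hi k) = 1) : ∀ i ∈ S, Alternating i := by
  suffices H : ∀ N : ℕ, ∀ i ∈ S, ∀ k l : Fin n, k < l → l.1 - k.1 = N → i k = i l →
      ∀ b, (b = i k + 1 ∨ i k = b + 1) → ∃ p, k < p ∧ p < l ∧ i p = b from
    fun i hi k l hkl => H _ i hi k l hkl rfl
  intro N
  induction N using Nat.strong_induction_on with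
  | _ N ih =>
    intro i hiS k l hkl hN hikl b hb
    rw [Fin.lt_def] at hkl
    by_cases hmid : ∃ p, k < p ∧ p < l ∧ i p = i k
    · obtain ⟨p, hkp, hpl, hp⟩ := hmid
      obtain ⟨r, h1, h2, h3⟩ := ih (p.1 - k.1) (by omega) i hiS k p hkp rfl hp.symm b hb
      exact ⟨r, h1, h2.trans hpl, h3⟩
    push Not at hmid
    -- the case of adjacent positions
    have hk1 : k.1 + 1 < l.1 := by
      by_contra hcon
      refine adj i hiS ⟨k.1, by omega⟩ ?_
      have e1 : lo (n := n) ⟨k.1, by omega⟩ = k := rfl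
      have e2 : hi (n := n) ⟨k.1, by omega⟩ = l := Fin.ext (by simp [hi]; omega)
      rw [e1, e2, hikl]
    set k' : Fin n := ⟨k.1 + 1, by omega⟩ with hk'
    set l' : Fin n := ⟨l.1 - 1, by omega⟩ with hl'
    have elok : lo (n := n) ⟨k.1, by omega⟩ = k := rfl
    have ehik : hi (n := n) ⟨k.1, by omega⟩ = k' := rfl
    have elol : lo (n := n) ⟨l.1 - 1, by omega⟩ = l' := rfl
    have ehil : hi (n := n) ⟨l.1 - 1, by omega⟩ = l := Fin.ext (by simp [hi]; omega)
    by_cases ak : Admissible i ⟨k.1, by omega⟩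
    · have hS := closed i hiS _ ak
      set i' := permWord (simpleSwap (n := n) ⟨k.1, by omega⟩) i with hi'
      have e1 : i' k' = i k := by rw [hi', ← ehik, permWord_simpleSwap_hi, elok]
      have e2 : ∀ p, k' < p → i' p = i p := by
        intro p hp
        have hp : k.1 + 1 < p.1 := hp
        rw [hi', permWord_simpleSwap_far]
        · rw [elok]; intro e; subst e; omega
        · rw [ehik]; intro e; rw [e] at hp; simp [hk'] at hp
      have hkl' : k' < l := hk1
      obtain ⟨p, h1, h2, h3⟩ := ih (l.1 - k'.1) (by simp [hk']; omega) i' hS k' l hk1 rfl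
        (by rw [e1, e2 l hkl', hikl]) b (by rw [e1]; exact hb)
      refine ⟨p, ?_, h2, by rw [← e2 p h1, h3]⟩
      have h1 : k.1 + 1 < p.1 := h1
      rw [Fin.lt_def]; omega
    by_cases al : Admissible i ⟨l.1 - 1, by omega⟩
    · have hS := closed i hiS _ al
      set i' := permWord (simpleSwap (n := n) ⟨l.1 - 1, by omega⟩) i with hi'
      have e1 : i' l' = i l := by rw [hi', ← elol, permWord_simpleSwap_lo, ehil]
      have e2 : ∀ p, p < l' → i' p = i p := by
        intro p hp
        have hp : p.1 < l.1 - 1 := hp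
        rw [hi', permWord_simpleSwap_far]
        · rw [elol]; intro e; rw [e] at hp; simp [hl'] at hp
        · rw [ehil]; intro e; subst e; omega
      have hkl' : k < l' := by rw [Fin.lt_def]; simp [hl']; omega
      obtain ⟨p, h1, h2, h3⟩ := ih (l'.1 - k.1) (by simp [hl']; omega) i' hS k l' hkl' rfl
        (by rw [e1, e2 k hkl', hikl]) b (by rw [e2 k hkl']; exact hb)
      refine ⟨p, h1, ?_, by rw [← e2 p h2, h3]⟩
      have h2 : p.1 < l.1 - 1 := h2
      rw [Fin.lt_def]; omega
    rw [Admissible, elok, ehik, not_and_or, not_not, not_not] at ak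
    rw [Admissible, elol, ehil, ← hikl, not_and_or, not_not, not_not] at al
    have hkk' : k < k' := by rw [Fin.lt_def]; simp [hk']
    have hll' : l' < l := by rw [Fin.lt_def]; simp [hl']; omega
    by_cases hb1 : i k' = b
    · exact ⟨k', hkk', hk1, hb1⟩
    by_cases hb2 : i l' = b
    · exact ⟨l', by rw [Fin.lt_def]; simp [hl']; omega, hll', hb2⟩
    exfalso
    -- A letter has at most two neighbours, and b appears at neither end.
    have hkl2 : i k' = i l' := by omega
    rcases Nat.lt_or_ge k'.1 l'.1 with hlt | hge
    · obtain ⟨p, h1, h2, h3⟩ := ih (l'.1 - k'.1) (by simp [hk', hl'] at *; omega) i hiS k' l' hlt rfl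
        hkl2 (i k) (by omega)
      exact hmid p (hkk'.trans h1) (h2.trans hll') h3
    · have e : k.1 + 2 = l.1 := by simp [hk', hl'] at hge; omega
      have := three i hiS ⟨k.1, by omega⟩ ⟨l.1 - 1, by omega⟩ (by simp; omega)
        (by rw [elok, ehil, hikl])
      rw [elok, ehik] at this
      omega

theorem Alternating.adj_ne {i : Fin n → ℕ} (h : Alternating i) (k : Fin (n - 1)) :
    i (lo k) ≠ i (hi k) := by
  intro e
  obtain ⟨p, h1, h2, -⟩ := h (lo k) (hi k) (by simp [lo, hi, Fin.lt_def]) e _ (Or.inl rfl)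
  rw [Fin.lt_def] at h1 h2
  simp [lo, hi] at h1 h2
  omega

theorem Alternating.three {i : Fin n → ℕ} (h : Alternating i) {k l : Fin (n - 1)}
    (hkl : k.1 + 1 = l.1) (e : i (lo k) = i (hi l)) : i (lo k) = 0 ∧ i (hi k) = 1 := by
  have hlt : lo k < hi l := by simp [lo, hi, Fin.lt_def]; omega
  have uniq : ∀ p : Fin n, lo k < p → p < hi l → p = hi k := by
    intro p h1 h2
    rw [Fin.lt_def] at h1 h2
    apply Fin.ext
    simp [lo, hi] at *
    omega
  obtain ⟨p, h1, h2, h3⟩ := h _ _ hlt e _ (Or.inl rfl)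
  rw [uniq p h1 h2] at h3
  by_cases h0 : i (lo k) = 0
  · omega
  obtain ⟨r, h4, h5, h6⟩ := h _ _ hlt e (i (lo k) - 1) (by omega)
  rw [uniq r h4 h5] at h6
  omega

/-- Permuting the letters of an alternating word by an element of `P_i` keeps the order of equal
and of neighbouring letters. -/
theorem InP.alternating_and_lt {i : Fin n → ℕ} (h : Alternating i) {τ : Equiv.Perm (Fin n)}
    (hτ : InP i τ) : Alternating (permWord τ i) ∧ ∀ a b, a < b →
      (i a = i b ∨ i a = i b + 1 ∨ i b = i a + 1) → τ a < τ b := by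
  suffices H : ∀ a b, a < b → (i a = i b ∨ i a = i b + 1 ∨ i b = i a + 1) → τ a < τ b by
    refine ⟨?_, H⟩
    intro k l hkl e b hb
    simp only [permWord] at e hb ⊢
    have h1 : τ⁻¹ k < τ⁻¹ l := by
      rcases lt_trichotomy (τ⁻¹ k) (τ⁻¹ l) with h1 | h1 | h1
      · exact h1
      · exact absurd (τ⁻¹.injective h1) hkl.ne
      · have := H _ _ h1 (Or.inl e.symm)
        simp only [perm_apply_inv] at this
        exact absurd this hkl.asymm
    obtain ⟨p, h2, h3, h4⟩ := h _ _ h1 e b hb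
    refine ⟨τ p, ?_, ?_, by simpa using h4⟩
    · have := H _ _ h2 (by omega)
      simpa using this
    · have := H _ _ h3 (by omega)
      simpa using this
  induction hτ with
  | one => intro a b hab _; simpa using hab
  | step τ k hτ hk ih =>
    intro a b hab e
    have h1 := ih a b hab e
    rw [Equiv.Perm.mul_apply, Equiv.Perm.mul_apply]
    apply simpleSwap_lt h1
    rintro ⟨e1, e2⟩
    rw [Admissible, ← e1, ← e2] at hk
    simp only [permWord, perm_inv_apply] at hk
    -- Admissibility rules out neighbouring letters, so the exchanged letters would be equal. The
    -- neighbour found between them in i would have to stay strictly between two adjacent positions.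
    have e3 : i a = i b := by omega
    obtain ⟨p, h2, h3, h4⟩ := h a b hab e3 _ (Or.inl rfl)
    have h5 := ih a p h2 (by omega)
    have h6 := ih p b h3 (by omega)
    rw [e1] at h5
    rw [e2] at h6
    rw [Fin.lt_def] at h5 h6
    simp [lo, hi] at h5 h6
    omega

/-- The elements of `P_i` are the permutations keeping the order of neighbouring letters. -/
theorem inP_iff {i : Fin n → ℕ} (h : Alternating i) {τ : Equiv.Perm (Fin n)} :
    InP i τ ↔ ∀ a b, a < b → (i a = i b + 1 ∨ i b = i a + 1) → τ a < τ b := by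
  refine ⟨fun hτ a b hab e => (hτ.alternating_and_lt h).2 a b hab (Or.inr e), ?_⟩
  induction τ using desc_induction with
  | one => exact fun _ => InP.one
  | step τ k hk ih =>
    intro H
    -- Since τ keeps the order of neighbouring letters, a descent concerns two letters that are not
    -- neighbours. Hence s_k τ keeps that order too, and the step back to τ is admissible.
    have hd : ¬ (i (τ⁻¹ (lo k)) = i (τ⁻¹ (hi k)) + 1 ∨ i (τ⁻¹ (hi k)) = i (τ⁻¹ (lo k)) + 1) := by
      intro e
      have := H _ _ hk (by omega)
      simp only [perm_apply_inv] at this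
      rw [Fin.lt_def] at this
      simp [lo, hi] at this
    have h1 : InP i (simpleSwap k * τ) := by
      apply ih
      intro a b hab e
      rw [Equiv.Perm.mul_apply, Equiv.Perm.mul_apply]
      apply simpleSwap_lt (H a b hab e)
      rintro ⟨e1, e2⟩
      apply hd
      rw [← e1, ← e2]
      simpa using e
    have := InP.step _ k h1 (by
      rw [Admissible, permWord_mul, permWord_simpleSwap_lo, permWord_simpleSwap_hi]
      simp only [permWord]
      omega)
    rwa [simpleSwap_mul_mul] at this

end Alternating

/-! ### Composites of intertwiners, and the patterns (a, b, a) in weights -/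

section Intertwiners

variable {F : Type*} [Field F] {V : Type*} [AddCommGroup V] [Module F V] {n : ℕ}
  {s : Fin (n - 1) → Module.End F V} {x c : Fin n → Module.End F V}

theorem IsCS.induction {x : Fin n → Module.End F V} (hcs : IsCS x) {P : V → Prop}
    (mem : ∀ j, ∀ m ∈ wt x j, P m) (zero : P 0) (add : ∀ a b, P a → P b → P (a + b)) (m : V) :
    P m :=
  Submodule.iSup_induction (wt x) (motive := P) (hcs.span ▸ Submodule.mem_top) mem zero add

/-- Composites of intertwiners along reduced words. -/
noncomputable def psi (s : Fin (n - 1) → Module.End F V) (x c : Fin n → Module.End F V)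
    (w : Equiv.Perm (Fin n)) : Module.End F V :=
  open Classical in
  if hw : ∃ k, Desc w k then inter s x c hw.choose * psi s x c (simpleSwap hw.choose * w) else 1
termination_by permSize w
decreasing_by exact permSize_lt hw.choose_spec

theorem psi_one : psi s x c 1 = 1 := by
  rw [psi, dif_neg]
  rintro ⟨k, hk⟩
  simp [Desc, lo, hi, Fin.lt_def] at hk

namespace HCRel

variable (h : HCRel s x c)
include h

/-- If two of the three letters coincide, both sides vanish, because a weight with two equal
adjacent letters would occur on the way. -/
theorem inter_braid [CharZero F] (hcs : IsCS x) {k l : Fin (n - 1)} (hkl : k.1 + 1 = l.1) :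
    inter s x c k * (inter s x c l * inter s x c k) =
      inter s x c l * (inter s x c k * inter s x c l) := by
  have el : lo l = hi k := by simp [lo, hi, hkl]
  have n12 : lo k ≠ hi k := lo_ne_hi k
  have n23 : hi k ≠ hi l := el ▸ lo_ne_hi l
  have n13 : lo k ≠ hi l := by simp [lo, hi, Fin.ext_iff]; omega
  ext m
  simp only [Module.End.mul_apply]
  induction m using hcs.induction with
  | zero => simp
  | add a b ha hb => simp only [map_add, ha, hb]
  | mem j m hm =>
    by_cases h12 : j (lo k) = j (hi k)
    · simp [h.eq_zero_of_adjacent_eq hcs hm k h12]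
    by_cases h23 : j (hi k) = j (hi l)
    · simp [h.eq_zero_of_adjacent_eq hcs hm l (el ▸ h23)]
    by_cases h13 : j (lo k) = j (hi l)
    · rw [h.inter_eq_zero hcs hm (k := k) (l := l), h.inter_eq_zero hcs hm (k := l) (l := k)]
      · simp
      · rw [permWord_simpleSwap_far (el ▸ n12) n13, ← el, permWord_simpleSwap_lo, h13]
      · rw [el, permWord_simpleSwap_hi, permWord_simpleSwap_far n13.symm n23.symm, h13]
    exact h.inter_braid_of_ne hm hkl h12 h23 h13

/-- Words `(a, b, a)` occur in weights only as `(0, 1, 0)`. -/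
theorem eq_of_three [CharZero F] (hcs : IsCS x) {j : Fin n → ℕ} {m : V} (hm : m ∈ wt x j)
    (hm0 : m ≠ 0) {k l : Fin (n - 1)} (hkl : k.1 + 1 = l.1) (h13 : j (lo k) = j (hi l)) :
    j (lo k) = 0 ∧ j (hi k) = 1 := by
  have el : lo l = hi k := by simp [lo, hi, hkl]
  have n12 : lo k ≠ hi k := lo_ne_hi k
  have n23 : hi k ≠ hi l := el ▸ lo_ne_hi l
  have n13 : lo k ≠ hi l := by simp [lo, hi, Fin.ext_iff]; omega
  have h12 : j (lo k) ≠ j (hi k) := fun e => hm0 (h.eq_zero_of_adjacent_eq hcs hm k e)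
  -- The images would have the patterns (b, a, a) and (a, a, b). So both intertwiners kill this
  -- weight space, and s_k, s_l act on it as multiples of `uhat`.
  have zk : ∀ m ∈ wt x j, inter s x c k m = 0 := fun m hm => by
    apply h.inter_eq_zero hcs hm (l := l)
    rw [el, permWord_simpleSwap_hi, permWord_simpleSwap_far n13.symm n23.symm, h13]
  have zl : ∀ m ∈ wt x j, inter s x c l m = 0 := fun m hm => by
    apply h.inter_eq_zero hcs hm (l := k)
    rw [permWord_simpleSwap_far (el ▸ n12) n13, ← el, permWord_simpleSwap_lo, h13]
  have mu := fun {m} (hm : m ∈ wt x j) a b => h.map_wt_uhat hm a b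
  have sk := fun {m} (hm : m ∈ wt x j) => smul_s_apply (s := s) (c := c) hm k
  have sl := fun {m} (hm : m ∈ wt x j) => smul_s_apply (s := s) (c := c) hm l
  have br := LinearMap.congr_fun (h.braid k l hkl) m
  simp only [Module.End.mul_apply] at br
  have cu := h.uhat_cubic_apply hm n12 n23 n13
  have sq2 := LinearMap.congr_fun (h.s_sq k) m
  simp only [Module.End.mul_apply, Module.End.one_apply] at sq2
  have na := q_sub_ne_zero (F := F) h12
  have a1 := congrArg (fun z => s k (s l z)) (sk hm)
  have a3 := congrArg (s k) (sl (mu hm (lo k) (hi k)))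
  have a7 := sk (mu (mu hm (lo k) (hi k)) (hi k) (hi l))
  have b1 := congrArg (fun z => s l (s k z)) (sl hm)
  have b3 := congrArg (s l) (sk (mu hm (hi k) (hi l)))
  have b7 := sl (mu (mu hm (hi k) (hi l)) (lo k) (hi k))
  have t1 := congrArg (s k) (sk hm)
  have t2 := sk (mu hm (lo k) (hi k))
  have t3 := h.uhat_uhat_apply hm n12
  simp only [map_smul, el, ← h13, zk _ (mu hm _ _), zl _ (mu hm _ _), zk _ hm, zl _ hm,
    zk _ (mu (mu hm _ _) _ _), zl _ (mu (mu hm _ _) _ _), zero_sub, map_neg]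
    at a1 a3 a7 b1 b3 b7 cu t1 t2 t3
  set A := q F (j (lo k)) with hA
  set B := q F (j (hi k)) with hB
  -- The braid relation is now a relation between the two triple products of `uhat`; subtracting it
  -- from the cubic identity isolates the outer `uhat`.
  have e1 : ((A - B) * (3 * B + A)) • uhat x c (lo k) (hi l) m = 0 := by
    linear_combination (norm := module) (1 / 2 : F) • (cu +
      (A - B) • ((A - B) ^ 3 • br - (A - B) ^ 2 • a1 - (A - B) • a3 + a7
        - (A - B) ^ 2 • b1 + (A - B) • b3 + b7))
  -- The values of q are nonnegative integers, so 3B + A = 0 would make both letters 0.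
  have hne : (A - B) * (3 * B + A) ≠ 0 := by
    refine mul_ne_zero na ?_
    rw [hA, hB, q_eq_cast, q_eq_cast, ← Nat.cast_ofNat, ← Nat.cast_mul, ← Nat.cast_add,
      Nat.cast_ne_zero]
    intro e
    apply h12
    rw [Nat.add_eq_zero_iff] at e
    simp at e
    rw [e.1, e.2]
  rw [smul_eq_zero_iff_right hne] at e1
  have e2 := h.uhat_uhat_apply hm n13
  rw [e1, map_zero, ← h13, ← hA, eq_comm, smul_eq_zero_iff_left hm0] at e2
  have hA0 : A = 0 := by
    rw [← two_mul] at e2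
    simpa using e2
  have hj0 : j (lo k) = 0 := (q_eq_zero_iff _).1 (hA ▸ hA0)
  refine ⟨hj0, ?_⟩
  -- As s_k acts by −uhat/(A − B), the relation s_k² = 1 says 2(A + B) = (A − B)²: the letters
  -- differ by one.
  have e4 : (2 * (A + B) - (A - B) * (A - B)) • m = 0 := by
    linear_combination (norm := module) -t3 + t2 - (A - B) • t1 + (A - B) ^ 2 • sq2
  rw [smul_eq_zero_iff_left hm0, inter_scalar_eq_zero_iff h12] at e4
  omega

end HCRel

end Intertwiners

/-! ### Submodules generated from one weight space -/

section Generation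

variable {F : Type*} [Field F] [CharZero F] {V : Type*} [AddCommGroup V] [Module F V] {n : ℕ}
  {s : Fin (n - 1) → Module.End F V} {x c : Fin n → Module.End F V}

namespace HCRel

variable (h : HCRel s x c)
include h

/-- All weights are alternating words. -/
theorem alternating_of_wt_ne_bot (hcs : IsCS x) {j : Fin n → ℕ} (hj : wt x j ≠ ⊥) :
    Alternating j := by
  refine alternating_of_closed (S := {j | wt x j ≠ ⊥}) ?_ ?_ ?_ j hj
  · intro j hj k hk
    obtain ⟨m, hm, hm0⟩ := Submodule.exists_mem_ne_zero_of_ne_bot hj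
    -- An empty permuted weight would force φ_k m = 0, whereas φ_k² is a nonzero scalar for
    -- admissible s_k.
    intro e
    have h1 : inter s x c k m = 0 := by
      have := h.map_wt_inter hm k
      rwa [e, Submodule.mem_bot] at this
    have h2 := h.inter_inter_apply hm k
    have hne : j (lo k) ≠ j (hi k) := fun e => hm0 (h.eq_zero_of_adjacent_eq hcs hm k e)
    rw [h1, map_zero, eq_comm, smul_eq_zero_iff_left hm0, inter_scalar_eq_zero_iff hne] at h2
    rw [Admissible] at hk
    omega
  · intro j hj k e
    obtain ⟨m, hm, hm0⟩ := Submodule.exists_mem_ne_zero_of_ne_bot hj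
    exact hm0 (h.eq_zero_of_adjacent_eq hcs hm k e)
  · intro j hj k l hkl e
    obtain ⟨m, hm, hm0⟩ := Submodule.exists_mem_ne_zero_of_ne_bot hj
    exact h.eq_of_three hcs hm hm0 hkl e

/-- The definition of ψ_w chooses a descent, and the choice is immaterial. As in Matsumoto's
theorem, two descents k, l of w lead to a common shorter element: for distant k, l through a square
closed by `inter_comm`, for adjacent ones through a hexagon closed by `inter_braid`. -/
theorem psi_eq_of_desc (hcs : IsCS x) (w : Equiv.Perm (Fin n)) :
    ∀ k, Desc w k → psi s x c w = inter s x c k * psi s x c (simpleSwap k * w) := by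
  induction hN : permSize w using Nat.strong_induction_on generalizing w with
  | _ N ih =>
    intro k hk
    have hw : ∃ k, Desc w k := ⟨k, hk⟩
    rw [psi, dif_pos hw]
    obtain ⟨k', hk'⟩ : ∃ k', k' = hw.choose := ⟨_, rfl⟩
    have hd : Desc w k' := hk' ▸ hw.choose_spec
    rw [← hk']
    clear hk' hw
    have far : ∀ k l : Fin (n - 1), Desc w k → Desc w l → k.1 + 1 < l.1 →
        inter s x c k * psi s x c (simpleSwap k * w) =
          inter s x c l * psi s x c (simpleSwap l * w) := by
      intro k l hk hl hkl
      have n1 : lo l ≠ lo k := by simp [lo, Fin.ext_iff]; omega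
      have n2 : lo l ≠ hi k := by simp [lo, hi, Fin.ext_iff]; omega
      have n3 : hi l ≠ lo k := by simp [lo, hi, Fin.ext_iff]; omega
      have n4 : hi l ≠ hi k := by simp [hi, Fin.ext_iff]; omega
      have d1 : Desc (simpleSwap k * w) l := by
        rw [Desc, simpleSwap_mul_inv_apply, simpleSwap_mul_inv_apply, simpleSwap_far n1 n2,
          simpleSwap_far n3 n4]
        exact hl
      have d2 : Desc (simpleSwap l * w) k := by
        rw [Desc, simpleSwap_mul_inv_apply, simpleSwap_mul_inv_apply,
          simpleSwap_far n1.symm n3.symm, simpleSwap_far n2.symm n4.symm]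
        exact hk
      have e : simpleSwap l * (simpleSwap k * w) = simpleSwap k * (simpleSwap l * w) := by
        rw [← mul_assoc, ← simpleSwap_mul_comm hkl, mul_assoc]
      rw [ih _ (hN ▸ permSize_lt hk) _ rfl l d1, ih _ (hN ▸ permSize_lt hl) _ rfl k d2, e,
        ← mul_assoc (inter s x c k), h.inter_comm k l hkl, mul_assoc]
    have near : ∀ k l : Fin (n - 1), Desc w k → Desc w l → k.1 + 1 = l.1 →
        inter s x c k * psi s x c (simpleSwap k * w) =
          inter s x c l * psi s x c (simpleSwap l * w) := by
      intro k l hk hl hkl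
      have el : lo l = hi k := by simp [lo, hi, hkl]
      have n12 : lo k ≠ hi k := lo_ne_hi k
      have n23 : hi k ≠ hi l := el ▸ lo_ne_hi l
      have n13 : lo k ≠ hi l := by simp [lo, hi, Fin.ext_iff]; omega
      have S1 : simpleSwap k (lo k) = hi k := simpleSwap_lo k
      have S2 : simpleSwap k (hi k) = lo k := simpleSwap_hi k
      have S3 : simpleSwap k (hi l) = hi l := simpleSwap_far n13.symm n23.symm
      have R1 : simpleSwap l (lo k) = lo k := simpleSwap_far (el ▸ n12) n13
      have R2 : simpleSwap l (hi k) = hi l := el ▸ simpleSwap_lo l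
      have R3 : simpleSwap l (hi l) = hi k := el ▸ simpleSwap_hi l
      have d0 : w⁻¹ (hi k) < w⁻¹ (lo k) := hk
      have d0' : w⁻¹ (hi l) < w⁻¹ (hi k) := by rw [← el]; exact hl
      have d1 : Desc (simpleSwap k * w) l := by
        rw [Desc]
        simp only [simpleSwap_mul_inv_apply, el, S2, S3]
        exact d0'.trans d0
      have d2 : Desc (simpleSwap l * (simpleSwap k * w)) k := by
        rw [Desc]
        simp only [simpleSwap_mul_inv_apply, R1, R2, S1, S3]
        exact d0'
      have d3 : Desc (simpleSwap l * w) k := by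
        rw [Desc]
        simp only [simpleSwap_mul_inv_apply, R1, R2]
        exact d0'.trans d0
      have d4 : Desc (simpleSwap k * (simpleSwap l * w)) l := by
        rw [Desc]
        simp only [simpleSwap_mul_inv_apply, el, S2, S3, R1, R3]
        exact d0
      have e : simpleSwap k * (simpleSwap l * (simpleSwap k * w)) =
          simpleSwap l * (simpleSwap k * (simpleSwap l * w)) := by
        simp only [← mul_assoc, simpleSwap_braid hkl]
      have l1 := permSize_lt hk
      have l2 := permSize_lt hl
      rw [ih _ (hN ▸ l1) _ rfl l d1, ih _ (hN ▸ (permSize_lt d1).trans l1) _ rfl k d2,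
        ih _ (hN ▸ l2) _ rfl k d3, ih _ (hN ▸ (permSize_lt d3).trans l2) _ rfl l d4, e]
      simp only [← mul_assoc]
      rw [mul_assoc (inter s x c k), mul_assoc (inter s x c l) (inter s x c k),
        h.inter_braid hcs hkl]
    rcases lt_trichotomy k.1 k'.1 with hlt | heq | hlt
    · rcases Nat.lt_or_ge (k.1 + 1) k'.1 with h1 | h1
      · exact (far k k' hk hd h1).symm
      · exact (near k k' hk hd (by omega)).symm
    · rw [Fin.ext heq]
    · rcases Nat.lt_or_ge (k'.1 + 1) k.1 with h1 | h1
      · exact far k' k hd hk h1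
      · exact near k' k hd hk (by omega)

theorem psi_x_apply (hcs : IsCS x) (w : Equiv.Perm (Fin n)) (a : Fin n) (m : V) :
    psi s x c w (x a m) = x (w a) (psi s x c w m) := by
  induction w using desc_induction generalizing a m with
  | one => simp [psi_one]
  | step w k hk ih =>
    rw [h.psi_eq_of_desc hcs w k hk, Module.End.mul_apply, ih, h.inter_x_apply,
      Equiv.Perm.mul_apply, simpleSwap_apply_apply, Module.End.mul_apply]

theorem psi_c_apply (hcs : IsCS x) (w : Equiv.Perm (Fin n)) (a : Fin n) (m : V) :
    psi s x c w (c a m) = c (w a) (psi s x c w m) := by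
  induction w using desc_induction generalizing a m with
  | one => simp [psi_one]
  | step w k hk ih =>
    rw [h.psi_eq_of_desc hcs w k hk, Module.End.mul_apply, ih, h.inter_c_apply,
      Equiv.Perm.mul_apply, simpleSwap_apply_apply, Module.End.mul_apply]

theorem map_wt_psi (hcs : IsCS x) {j : Fin n → ℕ} {m : V} (hm : m ∈ wt x j)
    (w : Equiv.Perm (Fin n)) : psi s x c w m ∈ wt x (permWord w j) := by
  rw [mem_wt] at *
  intro a
  have := h.psi_x_apply hcs w (w⁻¹ a) (x (w⁻¹ a) m)
  rw [hm, h.psi_x_apply hcs, perm_apply_inv, map_smul] at this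
  rw [← this, permWord]

/-- If the order of two equal letters were reversed along a reduced word, they would be adjacent
just before crossing, where the weight space is zero. -/
theorem lt_of_psi_ne_zero (hcs : IsCS x) {j : Fin n → ℕ} {m : V} (hm : m ∈ wt x j)
    (w : Equiv.Perm (Fin n)) (hw : psi s x c w m ≠ 0) : ∀ a b, a < b → j a = j b → w a < w b := by
  induction w using desc_induction with
  | one => intro a b hab _; exact hab
  | step w k hk ih =>
    intro a b hab e
    rw [h.psi_eq_of_desc hcs w k hk, Module.End.mul_apply] at hw
    have h1 : psi s x c (simpleSwap k * w) m ≠ 0 := by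
      intro e
      rw [e, map_zero] at hw
      exact hw rfl
    have h2 := ih h1 a b hab e
    have := simpleSwap_lt (k := k) h2 (by
      rintro ⟨e1, e2⟩
      refine h1 (h.eq_zero_of_adjacent_eq hcs (h.map_wt_psi hcs hm _) k ?_)
      rw [← e1, ← e2]
      simp only [permWord, perm_inv_apply]
      exact e)
    rwa [Equiv.Perm.mul_apply, Equiv.Perm.mul_apply, simpleSwap_apply_apply,
      simpleSwap_apply_apply] at this

theorem inter_psi (hcs : IsCS x) {j : Fin n → ℕ} {m : V} (hm : m ∈ wt x j)
    (w : Equiv.Perm (Fin n)) (k : Fin (n - 1)) :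
    ∃ t : F, inter s x c k (psi s x c w m) = t • psi s x c (simpleSwap k * w) m := by
  by_cases hk : Desc w k
  · rw [h.psi_eq_of_desc hcs w k hk, Module.End.mul_apply]
    exact ⟨_, h.inter_inter_apply (h.map_wt_psi hcs hm _) k⟩
  · rw [not_desc_iff] at hk
    refine ⟨1, ?_⟩
    rw [one_smul, h.psi_eq_of_desc hcs _ k hk, simpleSwap_mul_mul, Module.End.mul_apply]

/-- The submodule generated by a subspace `Y` of a weight space, stable under the `x_k` and `c_k`,
meets this weight space in `Y`. -/
theorem exists_generated (hcs : IsCS x) {j : Fin n → ℕ} {Y : Submodule F V} (hY : Y ≤ wt x j)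
    (hYx : ∀ k, ∀ m ∈ Y, x k m ∈ Y) (hYc : ∀ k, ∀ m ∈ Y, c k m ∈ Y)
    {N : Submodule F V} (hN : N = ⨆ w, Y.map (psi s x c w)) :
    Y ≤ N ∧ (∀ k, ∀ m ∈ N, s k m ∈ N) ∧ (∀ k, ∀ m ∈ N, x k m ∈ N) ∧ (∀ k, ∀ m ∈ N, c k m ∈ N) ∧
      N ⊓ wt x j ≤ Y := by
  have hle : ∀ w, Y.map (psi s x c w) ≤ N := fun w => hN ▸ le_iSup (fun w => Y.map (psi s x c w)) w
  have stab : ∀ g : Module.End F V, (∀ w, ∀ y ∈ Y, g (psi s x c w y) ∈ N) → ∀ m ∈ N, g m ∈ N := by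
    intro g hg m hm
    have : N ≤ N.comap g := by
      conv_lhs => rw [hN]
      refine iSup_le fun w => ?_
      rintro - ⟨y, hy, rfl⟩
      exact hg w y hy
    exact this hm
  have hx : ∀ w k, ∀ y ∈ Y, x k (psi s x c w y) ∈ Y.map (psi s x c w) := by
    intro w k y hy
    refine ⟨_, hYx (w⁻¹ k) y hy, ?_⟩
    rw [h.psi_x_apply hcs, perm_apply_inv]
  have hc : ∀ w k, ∀ y ∈ Y, c k (psi s x c w y) ∈ Y.map (psi s x c w) := by
    intro w k y hy
    refine ⟨_, hYc (w⁻¹ k) y hy, ?_⟩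
    rw [h.psi_c_apply hcs, perm_apply_inv]
  refine ⟨?_, ?_, ?_, ?_, ?_⟩
  · refine le_trans ?_ (hle 1)
    rw [psi_one]
    exact (Submodule.map_id Y).ge
  · intro k
    refine stab _ fun w y hy => ?_
    by_cases h0 : psi s x c w y = 0
    · rw [h0, map_zero]
      exact zero_mem _
    have hm := h.map_wt_psi hcs (hY hy) w
    have hne : permWord w j (lo k) ≠ permWord w j (hi k) := fun e =>
      h0 (h.eq_zero_of_adjacent_eq hcs hm k e)
    -- Stability under s_k: it is a combination of φ_k, which moves ψ_w Y into ψ_{s_k w} Y, and of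
    -- `uhat`, which preserves ψ_w Y.
    have e := smul_s_apply (s := s) (c := c) hm k
    rw [← Submodule.smul_mem_iff _ (q_sub_ne_zero (F := F) hne), e]
    refine sub_mem ?_ (hle w ?_)
    · obtain ⟨t, ht⟩ := h.inter_psi hcs (hY hy) w k
      rw [ht]
      exact Submodule.smul_mem _ _ (hle _ ⟨y, hy, rfl⟩)
    · refine uhat_mem ?_ ?_ _ _ ⟨y, hy, rfl⟩
      · rintro k - ⟨y, hy, rfl⟩
        exact hx w k y hy
      · rintro k - ⟨y, hy, rfl⟩
        exact hc w k y hy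
  · exact fun k => stab _ fun w y hy => hle w (hx w k y hy)
  · exact fun k => stab _ fun w y hy => hle w (hc w k y hy)
  · rintro m ⟨hm, hmj⟩
    -- Pieces ψ_w Y with w·j ≠ j lie in other weight spaces. If w·j = j and ψ_w y ≠ 0, then w keeps
    -- the order of equal letters and hence w = 1.
    have hsup : N ≤ Y ⊔ ⨆ (j') (_ : j' ≠ j), wt x j' := by
      rw [hN]
      refine iSup_le fun w => ?_
      by_cases hw : permWord w j = j
      · refine le_trans ?_ le_sup_left
        rintro - ⟨y, hy, rfl⟩
        by_cases h0 : psi s x c w y = 0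
        · rw [h0]
          exact zero_mem _
        have : w = 1 := perm_eq_of_permWord_eq (hw.trans (permWord_one j).symm)
          (h.lt_of_psi_ne_zero hcs (hY hy) w h0) (fun a b hab _ => hab)
        rw [this, psi_one]
        exact hy
      · refine le_trans ?_ le_sup_right
        rintro - ⟨y, hy, rfl⟩
        exact Submodule.mem_iSup_of_mem _ (Submodule.mem_iSup_of_mem hw (h.map_wt_psi hcs (hY hy) w))
    obtain ⟨a, ha, b, hb, rfl⟩ := Submodule.mem_sup.1 (hsup hm)
    have hbj : b ∈ wt x j := by
      have := sub_mem hmj (hY ha)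
      rwa [add_sub_cancel_left] at this
    have hb0 : b = 0 := Submodule.disjoint_def.1 (iSupIndep_wt h.xx j) b hbj hb
    rw [hb0, add_zero]
    exact ha

end HCRel

end Generation

/-! ## Gradings -/

section Graded

variable {F : Type*} [Field F] {V : Type*} [AddCommGroup V] [Module F V]

/-- A subspace containing the homogeneous components of its elements. -/
def IsGr (p : ZMod 2 → Submodule F V) (N : Submodule F V) : Prop :=
  ∀ m ∈ N, ∃ m₀ ∈ p 0, ∃ m₁ ∈ p 1, m₀ ∈ N ∧ m₁ ∈ N ∧ m = m₀ + m₁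

variable {p : ZMod 2 → Submodule F V}

theorem isGr_iff {N : Submodule F V} : IsGr p N ↔ N ≤ (N ⊓ p 0) ⊔ (N ⊓ p 1) := by
  constructor
  · intro h m hm
    obtain ⟨m₀, h0, m₁, h1, h2, h3, rfl⟩ := h m hm
    exact Submodule.add_mem_sup ⟨h2, h0⟩ ⟨h3, h1⟩
  · intro h m hm
    obtain ⟨m₀, h0, m₁, h1, rfl⟩ := Submodule.mem_sup.1 (h hm)
    exact ⟨m₀, h0.2, m₁, h1.2, h0.1, h1.1, rfl⟩

theorem IsGr.iSup {ι : Sort*} {N : ι → Submodule F V} (h : ∀ i, IsGr p (N i)) :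
    IsGr p (⨆ i, N i) := by
  rw [isGr_iff]
  refine iSup_le fun i => (isGr_iff.1 (h i)).trans (sup_le_sup ?_ ?_)
  · exact inf_le_inf_right _ (le_iSup N i)
  · exact inf_le_inf_right _ (le_iSup N i)

theorem IsGr.sup {M N : Submodule F V} (hM : IsGr p M) (hN : IsGr p N) : IsGr p (M ⊔ N) := by
  rw [isGr_iff] at *
  refine sup_le (hM.trans (sup_le_sup ?_ ?_)) (hN.trans (sup_le_sup ?_ ?_))
  all_goals gcongr
  · exact le_sup_left
  · exact le_sup_left
  · exact le_sup_right
  · exact le_sup_right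

theorem zmod_two_cases (a : ZMod 2) : a = 0 ∨ a = 1 := by
  revert a
  decide

theorem IsGr.map {V' : Type*} [AddCommGroup V'] [Module F V'] {p' : ZMod 2 → Submodule F V'}
    {N : Submodule F V} (hN : IsGr p N) (f : V →ₗ[F] V') (b : ZMod 2)
    (hf : ∀ a, ∀ m ∈ p a, f m ∈ p' (a + b)) : IsGr p' (N.map f) := by
  rintro - ⟨m, hm, rfl⟩
  obtain ⟨m₀, h0, m₁, h1, h2, h3, rfl⟩ := hN m hm
  rcases zmod_two_cases b with rfl | rfl
  · exact ⟨f m₀, hf 0 _ h0, f m₁, hf 1 _ h1, ⟨_, h2, rfl⟩, ⟨_, h3, rfl⟩, map_add _ _ _⟩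
  · exact ⟨f m₁, hf 1 _ h1, f m₀, hf 0 _ h0, ⟨_, h3, rfl⟩, ⟨_, h2, rfl⟩, by
      rw [map_add, add_comm]⟩

theorem isGr_span_singleton {v : V} {a : ZMod 2} (hv : v ∈ p a) : IsGr p (Submodule.span F {v}) := by
  rw [isGr_iff, Submodule.span_singleton_le_iff_mem]
  rcases zmod_two_cases a with rfl | rfl
  · exact Submodule.mem_sup_left ⟨Submodule.mem_span_singleton_self v, hv⟩
  · exact Submodule.mem_sup_right ⟨Submodule.mem_span_singleton_self v, hv⟩

variable {n : ℕ}

/-- The parities of the operators `x_k` (even) and `c_k` (odd). -/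
structure IsXCSuper (p : ZMod 2 → Submodule F V) (x c : Fin n → Module.End F V) : Prop where
  x_mem : ∀ k a, ∀ m ∈ p a, x k m ∈ p a
  c_mem : ∀ k a, ∀ m ∈ p a, c k m ∈ p (a + 1)

/-- The parities of the operators `s_k`, `x_k` (even) and `c_k` (odd). -/
structure IsSuper (p : ZMod 2 → Submodule F V) (s : Fin (n - 1) → Module.End F V)
    (x c : Fin n → Module.End F V) : Prop extends IsXCSuper p x c where
  s_mem : ∀ k a, ∀ m ∈ p a, s k m ∈ p a

variable {s : Fin (n - 1) → Module.End F V} {x c : Fin n → Module.End F V}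

theorem IsXCSuper.cc_mem (hp : IsXCSuper p x c) (k l : Fin n) (a : ZMod 2) (m : V) (hm : m ∈ p a) : c k (c l m) ∈ p a := by
  have := hp.c_mem k _ _ (hp.c_mem l _ _ hm)
  rwa [add_assoc, show (1 : ZMod 2) + 1 = 0 from rfl, add_zero] at this

namespace IsSuper

variable (hp : IsSuper p s x c)
include hp

theorem inter_mem (k : Fin (n - 1)) (a : ZMod 2) (m : V) (hm : m ∈ p a) :
    inter s x c k m ∈ p a := by
  have hx := fun k m => hp.x_mem k a m
  refine add_mem (hp.s_mem _ _ _ (sub_mem (hx _ _ (hx _ _ hm)) (hx _ _ (hx _ _ hm)))) ?_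
  exact add_mem (add_mem (hx _ _ hm) (hx _ _ hm))
    (hp.cc_mem _ _ _ _ (sub_mem (hx _ _ hm) (hx _ _ hm)))

theorem psi_mem [CharZero F] (h : HCRel s x c) (hcs : IsCS x) (w : Equiv.Perm (Fin n)) (a : ZMod 2)
    (m : V) (hm : m ∈ p a) : psi s x c w m ∈ p a := by
  induction w using desc_induction with
  | one => rwa [psi_one]
  | step w k hk ih =>
    rw [h.psi_eq_of_desc hcs w k hk]
    exact hp.inter_mem k a _ ih

theorem isGr_generated [CharZero F] (h : HCRel s x c) (hcs : IsCS x) {Y : Submodule F V}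
    (hY : IsGr p Y) : IsGr p (⨆ w, Y.map (psi s x c w)) :=
  IsGr.iSup fun w => hY.map _ 0 fun a m hm => by
    rw [add_zero]
    exact hp.psi_mem h hcs w a m hm

end IsSuper
end Graded

/-! ## Clifford modules generated by a vacuum space -/

section CliffSpan

variable {F : Type*} [Field F] {V : Type*} [AddCommGroup V] [Module F V] {ι : Type*}

/-- The span of the `c_{t_1} ⋯ c_{t_r} Q` for sublists `t_1, …, t_r` of a list. -/
def cliffSpan (c : ι → Module.End F V) (Q : Submodule F V) : List ι → Submodule F V
  | [] => Q
  | t :: l => cliffSpan c Q l ⊔ (cliffSpan c Q l).map (c t)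

variable {c : ι → Module.End F V} {Q : Submodule F V}

theorem le_cliffSpan (l : List ι) : Q ≤ cliffSpan c Q l := by
  induction l with
  | nil => exact le_rfl
  | cons t l ih => exact ih.trans le_sup_left

theorem cliffSpan_le {N : Submodule F V} (hQ : Q ≤ N) {l : List ι}
    (hN : ∀ t ∈ l, ∀ m ∈ N, c t m ∈ N) : cliffSpan c Q l ≤ N := by
  induction l with
  | nil => exact hQ
  | cons t l ih =>
    have := ih fun t ht => hN t (List.mem_cons_of_mem _ ht)
    refine sup_le this ?_
    rintro - ⟨m, hm, rfl⟩
    exact hN t List.mem_cons_self m (this hm)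

theorem cliffSpan_stable (g : Module.End F V) (hQ : ∀ m ∈ Q, g m ∈ Q) {l : List ι}
    (hg : ∀ t ∈ l, ∃ ε : F, ∀ m, g (c t m) = ε • c t (g m)) :
    ∀ m ∈ cliffSpan c Q l, g m ∈ cliffSpan c Q l := by
  induction l with
  | nil => exact hQ
  | cons t l ih =>
    have := ih fun t ht => hg t (List.mem_cons_of_mem _ ht)
    intro m hm
    obtain ⟨a, ha, -, ⟨b, hb, rfl⟩, rfl⟩ := Submodule.mem_sup.1 hm
    obtain ⟨ε, hε⟩ := hg t List.mem_cons_self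
    rw [map_add, hε, ← map_smul]
    exact Submodule.add_mem_sup (this a ha) ⟨_, Submodule.smul_mem _ _ (this b hb), rfl⟩

theorem cliffSpan_stable_c (hsq : ∀ t m, c t (c t m) = m)
    (hcc : ∀ s t, s ≠ t → ∀ m, c s (c t m) = -c t (c s m)) {l : List ι} :
    ∀ s ∈ l, ∀ m ∈ cliffSpan c Q l, c s m ∈ cliffSpan c Q l := by
  induction l with
  | nil => simp
  | cons t l ih =>
    intro s hs m hm
    obtain ⟨a, ha, -, ⟨b, hb, rfl⟩, rfl⟩ := Submodule.mem_sup.1 hm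
    by_cases e : s = t
    · subst e
      rw [map_add, hsq, add_comm]
      exact Submodule.add_mem_sup hb ⟨_, ha, rfl⟩
    · have hs : s ∈ l := (List.mem_cons.1 hs).resolve_left e
      rw [map_add, hcc s t e, ← map_neg]
      exact Submodule.add_mem_sup (ih s hs a ha) ⟨_, neg_mem (ih s hs b hb), rfl⟩

theorem cliffSpan_isGr {p : ZMod 2 → Submodule F V} (hQ : IsGr p Q)
    (hc : ∀ t a, ∀ m ∈ p a, c t m ∈ p (a + 1)) (l : List ι) : IsGr p (cliffSpan c Q l) := by
  induction l with
  | nil => exact hQ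
  | cons t l ih => exact ih.sup (ih.map _ 1 (hc t))

variable {w : ι → Module.End F V}

theorem cliffSpan_fixed {s : ι} {l : List ι} (hQ : ∀ q ∈ Q, w s q = q)
    (hwc : ∀ t ∈ l, ∀ m, w s (c t m) = c t (w s m)) : ∀ m ∈ cliffSpan c Q l, w s m = m := by
  induction l with
  | nil => exact hQ
  | cons t l ih =>
    intro m hm
    obtain ⟨a, ha, -, ⟨b, hb, rfl⟩, rfl⟩ := Submodule.mem_sup.1 hm
    have := ih fun t ht => hwc t (List.mem_cons_of_mem _ ht)
    rw [map_add, hwc t List.mem_cons_self, this a ha, this b hb]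

variable [CharZero F]

theorem eq_zero_of_eq_neg (F : Type*) [Field F] [CharZero F] {V : Type*} [AddCommGroup V]
    [Module F V] {m : V} (h : m = -m) : m = 0 := by
  have : (2 : F) • m = 0 := by
    rw [two_smul]
    nth_rewrite 1 [h]
    exact neg_add_cancel m
  simpa using this

/-- Write the vector as a + c_t b. The involution w_t fixes a and negates c_t b, so a fixed vector
has no c_t part; removing the t one by one leaves Q. -/
theorem mem_of_mem_cliffSpan {l : List ι} (hl : l.Nodup)
    (hQ : ∀ t ∈ l, ∀ q ∈ Q, w t q = q) (hwt : ∀ t ∈ l, ∀ m, w t (c t m) = - c t (w t m))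
    (hwc : ∀ s ∈ l, ∀ t ∈ l, s ≠ t → ∀ m, w s (c t m) = c t (w s m)) {m : V}
    (hm : m ∈ cliffSpan c Q l) (hwm : ∀ t ∈ l, w t m = m) : m ∈ Q := by
  induction l generalizing m with
  | nil => exact hm
  | cons t l ih =>
    rw [List.nodup_cons] at hl
    have hfix : ∀ m ∈ cliffSpan c Q l, w t m = m := cliffSpan_fixed (hQ t List.mem_cons_self)
      fun s hs => hwc t List.mem_cons_self s (List.mem_cons_of_mem _ hs)
        (fun e => hl.1 (e ▸ hs))
    obtain ⟨a, ha, -, ⟨b, hb, rfl⟩, rfl⟩ := Submodule.mem_sup.1 hm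
    have e := hwm t List.mem_cons_self
    rw [map_add, hwt t List.mem_cons_self, hfix a ha, hfix b hb, add_right_inj] at e
    have e0 : c t b = 0 := eq_zero_of_eq_neg F e.symm
    rw [e0, add_zero] at hwm ⊢
    exact ih hl.2 (fun s hs => hQ s (List.mem_cons_of_mem _ hs))
      (fun s hs => hwt s (List.mem_cons_of_mem _ hs))
      (fun s hs r hr => hwc s (List.mem_cons_of_mem _ hs) r (List.mem_cons_of_mem _ hr)) ha
      (fun s hs => hwm s (List.mem_cons_of_mem _ hs))

/-- The span S built from the rest of the list lies in the +1 eigenspace of w_t and c_t S in the −1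
eigenspace, and c_t is injective: each t doubles the dimension. -/
theorem finrank_cliffSpan [FiniteDimensional F V] (hsq : ∀ t m, c t (c t m) = m) {l : List ι}
    (hl : l.Nodup)
    (hQ : ∀ t ∈ l, ∀ q ∈ Q, w t q = q) (hwt : ∀ t ∈ l, ∀ m, w t (c t m) = - c t (w t m))
    (hwc : ∀ s ∈ l, ∀ t ∈ l, s ≠ t → ∀ m, w s (c t m) = c t (w s m)) :
    Module.finrank F (cliffSpan c Q l) = 2 ^ l.length * Module.finrank F Q := by
  induction l with
  | nil => rw [List.length_nil, pow_zero, one_mul, cliffSpan]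
  | cons t l ih =>
    rw [List.nodup_cons] at hl
    have hfix : ∀ m ∈ cliffSpan c Q l, w t m = m := cliffSpan_fixed (hQ t List.mem_cons_self)
      fun s hs => hwc t List.mem_cons_self s (List.mem_cons_of_mem _ hs)
        (fun e => hl.1 (e ▸ hs))
    have ih := ih hl.2 (fun s hs => hQ s (List.mem_cons_of_mem _ hs))
      (fun s hs => hwt s (List.mem_cons_of_mem _ hs))
      (fun s hs r hr => hwc s (List.mem_cons_of_mem _ hs) r (List.mem_cons_of_mem _ hr))
    have hinj : Function.Injective (c t) := fun a b hab => by rw [← hsq t a, hab, hsq]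
    have h1 : Module.finrank F ((cliffSpan c Q l).map (c t)) =
        Module.finrank F (cliffSpan c Q l) :=
      ((cliffSpan c Q l).equivMapOfInjective _ hinj).finrank_eq.symm
    have h2 : cliffSpan c Q l ⊓ (cliffSpan c Q l).map (c t) = ⊥ := by
      rw [eq_bot_iff]
      rintro - ⟨ha, b, hb, rfl⟩
      have e := hfix _ ha
      rw [hwt t List.mem_cons_self, hfix b hb] at e
      exact (Submodule.mem_bot _).2 (eq_zero_of_eq_neg F e.symm)
    have h3 := Submodule.finrank_sup_add_finrank_inf_eq (cliffSpan c Q l)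
      ((cliffSpan c Q l).map (c t))
    rw [h2, finrank_bot, add_zero, h1, ih] at h3
    rw [cliffSpan, h3, List.length_cons, pow_succ]
    ring

end CliffSpan

/-! ## Vacuum vectors -/

section Vacuum

/-- A finite set `Z`, up to at most one element `r ∈ R`, is split into pairs `{t, π t}`,
`t ∈ A`. -/
structure Pairing {ι : Type*} (Z : Finset ι) where
  A : Finset ι
  R : Finset ι
  π : ι → ι
  A_sub : A ⊆ Z
  R_sub : R ⊆ Z
  disj : ∀ r ∈ R, r ∉ A
  π_mem : ∀ t ∈ A, π t ∈ Z
  π_notA : ∀ t ∈ A, π t ∉ A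
  π_notR : ∀ t ∈ A, π t ∉ R
  π_inj : ∀ s ∈ A, ∀ t ∈ A, π s = π t → s = t
  cover : ∀ z ∈ Z, z ∈ A ∨ z ∈ R ∨ ∃ t ∈ A, π t = z
  card_A : A.card = Z.card / 2
  card_R : R.card = Z.card % 2

/-- Add the elements one at a time: a new one stays unpaired if no other is, and otherwise it is
paired with the unpaired one. -/
theorem nonempty_pairing {ι : Type*} [DecidableEq ι] (Z : Finset ι) : Nonempty (Pairing Z) := by
  induction Z using Finset.induction_on with
  | empty =>
    exact ⟨{ A := ∅, R := ∅, π := id, A_sub := by simp, R_sub := by simp, disj := by simp,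
             π_mem := by simp, π_notA := by simp, π_notR := by simp, π_inj := by simp,
             cover := by simp, card_A := by simp, card_R := by simp }⟩
  | insert z Z hz ih =>
    obtain ⟨P⟩ := ih
    have hzA : z ∉ P.A := fun h => hz (P.A_sub h)
    have hzπ : ∀ t ∈ P.A, P.π t ≠ z := fun t ht e => hz (e ▸ P.π_mem t ht)
    have hcard := P.card_R
    have hA := P.card_A
    rcases P.R.eq_empty_or_nonempty with hR | ⟨r, hr⟩
    · rw [hR, Finset.card_empty] at hcard
      refine ⟨{ A := P.A, R := {z}, π := P.π, A_sub := P.A_sub.trans (Finset.subset_insert _ _),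
                R_sub := by simp, disj := by simpa using hzA,
                π_mem := fun t ht => Finset.mem_insert_of_mem (P.π_mem t ht),
                π_notA := P.π_notA, π_notR := by simpa using hzπ, π_inj := P.π_inj,
                cover := ?_, card_A := ?_, card_R := ?_ }⟩
      · intro y hy
        rcases Finset.mem_insert.1 hy with rfl | hy
        · simp
        · have := P.cover y hy
          rw [hR] at this
          simp only [Finset.notMem_empty, false_or] at this
          exact this.imp_right Or.inr
      · rw [Finset.card_insert_of_notMem hz]; omega
      · rw [Finset.card_insert_of_notMem hz, Finset.card_singleton]; omega
    · have hR1 : P.R.card = 1 := by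
        have : 0 < P.R.card := Finset.card_pos.2 ⟨r, hr⟩
        omega
      have hRr : P.R = {r} := by
        obtain ⟨r', hr'⟩ := Finset.card_eq_one.1 hR1
        rw [hr', Finset.mem_singleton] at hr
        rw [hr', hr]
      have hrZ : r ∈ Z := P.R_sub hr
      have hrz : r ≠ z := fun e => hz (e ▸ hrZ)
      have hup : ∀ t ∈ P.A, Function.update P.π z r t = P.π t := fun t ht =>
        Function.update_of_ne (fun e => hzA (by rwa [← e])) _ _
      refine ⟨{ A := insert z P.A, R := ∅, π := Function.update P.π z r,
                A_sub := Finset.insert_subset_insert _ P.A_sub, R_sub := by simp,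
                disj := by simp, π_mem := ?_, π_notA := ?_, π_notR := by simp, π_inj := ?_,
                cover := ?_, card_A := ?_, card_R := ?_ }⟩
      · intro t ht
        rcases Finset.mem_insert.1 ht with rfl | ht
        · simp [hrZ]
        · rw [hup t ht]
          exact Finset.mem_insert_of_mem (P.π_mem t ht)
      · intro t ht
        rcases Finset.mem_insert.1 ht with rfl | ht
        · simp [hrz, P.disj r hr]
        · rw [hup t ht]
          simp [hzπ t ht, P.π_notA t ht]
      · intro s hs t ht
        rcases Finset.mem_insert.1 hs with hsz | hs <;> rcases Finset.mem_insert.1 ht with htz | ht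
        · exact fun _ => hsz.trans htz.symm
        · rw [hsz, hup t ht, Function.update_self]
          intro e
          exact absurd (e ▸ hr) (P.π_notR t ht)
        · rw [htz, hup s hs, Function.update_self]
          intro e
          exact absurd (e ▸ hr) (P.π_notR s hs)
        · rw [hup s hs, hup t ht]
          exact P.π_inj s hs t ht
      · intro y hy
        rcases Finset.mem_insert.1 hy with rfl | hy
        · simp
        · rcases P.cover y hy with h | h | ⟨t, ht, e⟩
          · simp [h]
          · rw [hRr, Finset.mem_singleton] at h
            exact Or.inr (Or.inr ⟨z, by simp, by simp [h]⟩)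
          · exact Or.inr (Or.inr ⟨t, Finset.mem_insert_of_mem ht, by rw [hup t ht, e]⟩)
      · rw [Finset.card_insert_of_notMem hz, Finset.card_insert_of_notMem hzA]; omega
      · rw [Finset.card_insert_of_notMem hz, Finset.card_empty]; omega

variable {F : Type*} [Field F] [IsAlgClosed F] {V : Type*} [AddCommGroup V] [Module F V] {n : ℕ}

/-- The positions of the letter zero. -/
def zeros (j : Fin n → ℕ) : Finset (Fin n) := Finset.univ.filter fun k => j k = 0

theorem mem_zeros {j : Fin n → ℕ} {k : Fin n} : k ∈ zeros j ↔ j k = 0 := by simp [zeros]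

variable {j : Fin n → ℕ} (P : Pairing (zeros j))

/-- The positions which carry an involution: those of the nonzero letters, and one of each pair. -/
def Pairing.T : Finset (Fin n) := P.A ∪ (zeros j)ᶜ

theorem Pairing.mem_T {t : Fin n} : t ∈ P.T ↔ t ∈ P.A ∨ j t ≠ 0 := by
  simp [Pairing.T, mem_zeros]

theorem Pairing.card_T : P.T.card = n - (zeros j).card + (zeros j).card / 2 := by
  rw [Pairing.T, Finset.card_union_of_disjoint, Finset.card_compl, Fintype.card_fin, P.card_A,
    add_comm]
  exact Finset.disjoint_left.2 fun t ht => by simp [P.A_sub ht]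

theorem Pairing.mem_A {t : Fin n} (ht : t ∈ P.T) (h0 : j t = 0) : t ∈ P.A :=
  (P.mem_T.1 ht).resolve_right (not_not.2 h0)

theorem Pairing.π_notT {t : Fin n} (ht : t ∈ P.A) : P.π t ∉ P.T := by
  rw [P.mem_T, not_or, not_not]
  exact ⟨P.π_notA t ht, mem_zeros.1 (P.π_mem t ht)⟩

theorem Pairing.notT_of_mem_R {r : Fin n} (hr : r ∈ P.R) : r ∉ P.T := by
  rw [P.mem_T, not_or, not_not]
  exact ⟨P.disj r hr, mem_zeros.1 (P.R_sub hr)⟩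

/-- The commuting involutions. -/
noncomputable def Pairing.inv (x c : Fin n → Module.End F V) (t : Fin n) : Module.End F V :=
  if j t = 0 then sqrtF (-1 : F) • (c t * c (P.π t)) else (sqrtF (q F (j t)))⁻¹ • x t

variable {x c : Fin n → Module.End F V} (h : XCRel x c)
include h

omit [IsAlgClosed F] in
theorem XCRel.c_c_apply (t : Fin n) (m : V) : c t (c t m) = m := LinearMap.congr_fun (h.c_sq t) m

omit [IsAlgClosed F] in
theorem XCRel.c_anti_apply (s t : Fin n) (hst : s ≠ t) (m : V) : c s (c t m) = -c t (c s m) :=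
  LinearMap.congr_fun (h.cc s t hst) m

omit [IsAlgClosed F] in
theorem XCRel.x_c_apply (s t : Fin n) (hst : s ≠ t) (m : V) : x s (c t m) = c t (x s m) :=
  LinearMap.congr_fun (h.xc s t hst) m

omit [IsAlgClosed F] in
theorem XCRel.x_c_same_apply (s : Fin n) (m : V) : x s (c s m) = -c s (x s m) :=
  LinearMap.congr_fun (h.xc_same s) m

theorem Pairing.inv_c_same {t : Fin n} (ht : t ∈ P.T) (m : V) :
    P.inv x c t (c t m) = -c t (P.inv x c t m) := by
  rw [Pairing.inv]
  split_ifs with h0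
  · have hA := P.mem_A ht h0
    have hne : P.π t ≠ t := fun e => P.π_notA t hA (e.symm ▸ hA)
    simp only [LinearMap.smul_apply, Module.End.mul_apply]
    rw [h.c_anti_apply _ _ hne, map_neg, map_smul, smul_neg]
  · simp only [LinearMap.smul_apply]
    rw [h.x_c_same_apply, map_smul, smul_neg]

/-- The second members t = π s of pairs have to be excluded, since c_{πs} anticommutes with the
involution c_s c_{πs}. The unpaired generator is allowed, and therefore maps vacuum vectors to
vacuum vectors. -/
theorem Pairing.inv_c {s t : Fin n} (hs : s ∈ P.T) (hst : s ≠ t) (ht : t ∈ P.T ∨ t ∈ P.R) (m : V) :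
    P.inv x c s (c t m) = c t (P.inv x c s m) := by
  rw [Pairing.inv]
  split_ifs with h0
  · have hA := P.mem_A hs h0
    have hne : P.π s ≠ t := by
      rintro rfl
      exact ht.elim (P.π_notT hA) (P.π_notR s hA)
    simp only [LinearMap.smul_apply, Module.End.mul_apply]
    rw [h.c_anti_apply _ _ hne, map_neg, h.c_anti_apply _ _ hst, neg_neg, map_smul]
  · simp only [LinearMap.smul_apply]
    rw [h.x_c_apply _ _ hst, map_smul]

theorem Pairing.inv_inv {s t : Fin n} (hs : s ∈ P.T) (ht : t ∈ P.T) (m : V) :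
    P.inv x c s (P.inv x c t m) = P.inv x c t (P.inv x c s m) := by
  by_cases hst : s = t
  · rw [hst]
  by_cases h0 : j t = 0
  · have hA := P.mem_A ht h0
    have e : ∀ m, P.inv x c t m = sqrtF (-1 : F) • c t (c (P.π t) m) := fun m => by
      rw [Pairing.inv, if_pos h0]; rfl
    rw [e, e, map_smul, P.inv_c h hs hst (Or.inl ht)]
    congr 2
    have hne : s ≠ P.π t := fun e => P.π_notT hA (e ▸ hs)
    rw [Pairing.inv]
    split_ifs with h1
    · have hB := P.mem_A hs h1
      have hne2 : P.π s ≠ P.π t := fun e => hst (P.π_inj s hB t hA e)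
      simp only [LinearMap.smul_apply, Module.End.mul_apply]
      rw [h.c_anti_apply _ _ hne2, map_neg, h.c_anti_apply _ _ hne, neg_neg, map_smul]
    · simp only [LinearMap.smul_apply]
      rw [h.x_c_apply _ _ hne, map_smul]
  · have e : ∀ m, P.inv x c t m = (sqrtF (q F (j t)))⁻¹ • x t m := fun m => by
      rw [Pairing.inv, if_neg h0]; rfl
    rw [e, e, map_smul]
    congr 1
    rw [Pairing.inv]
    split_ifs with h1
    · have hB := P.mem_A hs h1
      have hne : t ≠ P.π s := fun e => P.π_notT hB (e ▸ ht)
      simp only [LinearMap.smul_apply, Module.End.mul_apply]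
      rw [map_smul, h.x_c_apply _ _ (Ne.symm hst), h.x_c_apply _ _ hne]
    · simp only [LinearMap.smul_apply]
      rw [map_smul]
      congr 1
      exact LinearMap.congr_fun (h.xx s t) m

theorem Pairing.inv_sq [CharZero F] {t : Fin n} (ht : t ∈ P.T) {m : V} (hm : m ∈ wt x j) :
    P.inv x c t (P.inv x c t m) = m := by
  rw [Pairing.inv]
  split_ifs with h0
  · have hA := P.mem_A ht h0
    have hne : P.π t ≠ t := fun e => P.π_notA t hA (e.symm ▸ hA)
    simp only [LinearMap.smul_apply, Module.End.mul_apply]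
    rw [map_smul, map_smul, h.c_anti_apply _ _ hne, map_neg, h.c_c_apply, h.c_c_apply, smul_smul,
      ← pow_two, sqrtF_sq, neg_smul, one_smul, neg_neg]
  · simp only [LinearMap.smul_apply]
    rw [map_smul, mem_wt.1 hm, smul_smul, smul_smul, ← mul_inv, ← pow_two, sqrtF_sq,
      inv_mul_cancel₀, one_smul]
    rwa [Ne, q_eq_zero_iff]

omit h in
theorem Pairing.inv_mem {p : ZMod 2 → Submodule F V} (hp : IsXCSuper p x c) (t : Fin n)
    (a : ZMod 2) {m : V} (hm : m ∈ p a) : P.inv x c t m ∈ p a := by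
  rw [Pairing.inv]
  split_ifs with h0
  · exact Submodule.smul_mem _ _ (hp.cc_mem _ _ _ _ hm)
  · exact Submodule.smul_mem _ _ (hp.x_mem _ _ _ hm)

omit h in
theorem Pairing.inv_mem_of_stable {Y : Submodule F V} (hx : ∀ k, ∀ m ∈ Y, x k m ∈ Y)
    (hc : ∀ k, ∀ m ∈ Y, c k m ∈ Y) (t : Fin n) {m : V} (hm : m ∈ Y) : P.inv x c t m ∈ Y := by
  rw [Pairing.inv]
  split_ifs with h0
  · exact Submodule.smul_mem _ _ (hc _ _ (hc _ _ hm))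
  · exact Submodule.smul_mem _ _ (hx _ _ hm)

/-- A vacuum vector: a vector fixed by all the involutions. -/
def Pairing.IsVac (P : Pairing (zeros j)) (x c : Fin n → Module.End F V) (v : V) : Prop :=
  ∀ t ∈ P.T, P.inv x c t v = v

/-- Project onto the +1 eigenspaces one involution at a time: v + w_t v works unless it is zero. In
that case w_t v = −v, and c_t v is fixed by w_t and still fixed by the earlier involutions. Both
moves preserve homogeneity. -/
theorem Pairing.exists_vac [CharZero F] {p : ZMod 2 → Submodule F V} (hp : IsXCSuper p x c)
    {Y : Submodule F V} (hY : Y ≤ wt x j) (hx : ∀ k, ∀ m ∈ Y, x k m ∈ Y)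
    (hc : ∀ k, ∀ m ∈ Y, c k m ∈ Y) (hgr : IsGr p Y) (hne : Y ≠ ⊥) :
    ∃ v ∈ Y, v ≠ 0 ∧ P.IsVac x c v ∧ ∃ a, v ∈ p a := by
  obtain ⟨m, hm, hm0⟩ := Submodule.exists_mem_ne_zero_of_ne_bot hne
  obtain ⟨m₀, h0, m₁, h1, h2, h3, rfl⟩ := hgr m hm
  have start : ∃ v ∈ Y, v ≠ 0 ∧ ∃ a, v ∈ p a := by
    by_cases e : m₀ = 0
    · exact ⟨m₁, h3, by rintro rfl; simp [e] at hm0, 1, h1⟩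
    · exact ⟨m₀, h2, e, 0, h0⟩
  suffices H : ∀ S : Finset (Fin n), S ⊆ P.T →
      ∃ v ∈ Y, v ≠ 0 ∧ (∀ t ∈ S, P.inv x c t v = v) ∧ ∃ a, v ∈ p a from H P.T subset_rfl
  intro S
  induction S using Finset.induction_on with
  | empty =>
    intro _
    obtain ⟨v, h1, h2, h3⟩ := start
    exact ⟨v, h1, h2, by simp, h3⟩
  | insert t S ht ih =>
    intro hS
    obtain ⟨v, hv, hv0, hvS, a, hva⟩ := ih ((Finset.subset_insert _ _).trans hS)
    have htT : t ∈ P.T := hS (Finset.mem_insert_self _ _)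
    by_cases e : v + P.inv x c t v = 0
    · refine ⟨c t v, hc t v hv, ?_, ?_, a + 1, hp.c_mem _ _ _ hva⟩
      · intro e
        apply hv0
        rw [← h.c_c_apply t v, e, map_zero]
      · intro s hs
        rcases Finset.mem_insert.1 hs with rfl | hs
        · rw [P.inv_c_same h htT, eq_neg_of_add_eq_zero_right e, map_neg, neg_neg]
        · have hst : s ≠ t := fun e => ht (e ▸ hs)
          rw [P.inv_c h (hS (Finset.mem_insert_of_mem hs)) hst (Or.inl htT), hvS s hs]
    · refine ⟨_, add_mem hv (P.inv_mem_of_stable hx hc t hv), e, ?_, a,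
        add_mem hva (P.inv_mem hp t a hva)⟩
      intro s hs
      rcases Finset.mem_insert.1 hs with rfl | hs
      · rw [map_add, P.inv_sq h htT (hY hv), add_comm]
      · rw [map_add, P.inv_inv h (hS (Finset.mem_insert_of_mem hs)) htT, hvS s hs]

/-- The vectors obtained from a vacuum vector by the unpaired Clifford generator. -/
def Pairing.vacSpace (P : Pairing (zeros j)) (c : Fin n → Module.End F V) (v : V) :
    Submodule F V :=
  Submodule.span F {v} ⊔ ⨆ r ∈ P.R, Submodule.span F {c r v}

/-- The `x, c`-stable subspace generated by a vacuum vector. -/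
noncomputable def Pairing.gen (P : Pairing (zeros j)) (c : Fin n → Module.End F V) (v : V) :
    Submodule F V :=
  cliffSpan c (P.vacSpace c v) P.T.toList

omit h [IsAlgClosed F] in
theorem Pairing.mem_gen (v : V) : v ∈ P.gen c v :=
  le_cliffSpan _ (Submodule.mem_sup_left (Submodule.mem_span_singleton_self v))

omit h [IsAlgClosed F] in
theorem Pairing.vacSpace_le {N : Submodule F V} {v : V} (hv : v ∈ N)
    (hc : ∀ k, ∀ m ∈ N, c k m ∈ N) : P.vacSpace c v ≤ N := by
  refine sup_le (by simpa using hv) (iSup₂_le fun r _ => ?_)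
  simpa using hc r v hv

omit h [IsAlgClosed F] in
theorem Pairing.gen_le {N : Submodule F V} {v : V} (hv : v ∈ N) (hc : ∀ k, ∀ m ∈ N, c k m ∈ N) :
    P.gen c v ≤ N :=
  cliffSpan_le (P.vacSpace_le hv hc) fun t _ => hc t

theorem Pairing.inv_vacSpace {v : V} (hv : P.IsVac x c v) {t : Fin n} (ht : t ∈ P.T) :
    ∀ m ∈ P.vacSpace c v, P.inv x c t m = m := by
  have : P.vacSpace c v ≤ LinearMap.eqLocus (P.inv x c t) LinearMap.id := by
    refine sup_le ?_ (iSup₂_le fun r hr => ?_)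
    · simpa using hv t ht
    · have hne : t ≠ r := fun e => P.notT_of_mem_R hr (e ▸ ht)
      simp [P.inv_c h ht hne (Or.inr hr), hv t ht]
  exact fun m hm => this hm

theorem Pairing.gen_inv_stable {v : V} (hv : P.IsVac x c v) {t : Fin n} (ht : t ∈ P.T) :
    ∀ m ∈ P.gen c v, P.inv x c t m ∈ P.gen c v := by
  refine cliffSpan_stable _ (fun m hm => ?_) fun s hs => ?_
  · rwa [P.inv_vacSpace h hv ht m hm]
  · by_cases e : t = s
    · subst e
      exact ⟨-1, fun m => by rw [P.inv_c_same h ht, neg_smul, one_smul]⟩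
    · exact ⟨1, fun m => by rw [P.inv_c h ht e (Or.inl (Finset.mem_toList.1 hs)), one_smul]⟩

/-- Three kinds of index: those in T are built into the span; the unpaired one anticommutes with
these and preserves the vacuum space; and for a second member π t, the operator c_{πt} is
proportional to c_t times the involution of t. -/
theorem Pairing.gen_c_stable {v : V} (hv : P.IsVac x c v) (k : Fin n) :
    ∀ m ∈ P.gen c v, c k m ∈ P.gen c v := by
  have hT : ∀ t ∈ P.T, ∀ m ∈ P.gen c v, c t m ∈ P.gen c v := fun t ht =>
    cliffSpan_stable_c h.c_c_apply h.c_anti_apply t (Finset.mem_toList.2 ht)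
  by_cases hk : k ∈ P.T
  · exact hT k hk
  have hk0 : j k = 0 := by
    rw [P.mem_T, not_or, not_not] at hk
    exact hk.2
  rcases P.cover k (mem_zeros.2 hk0) with hA | hR | ⟨t, ht, rfl⟩
  · exact absurd (P.mem_T.2 (Or.inl hA)) hk
  · refine cliffSpan_stable _ (fun m hm => ?_) fun s hs => ⟨-1, fun m => ?_⟩
    · have hRk : ∀ r ∈ P.R, r = k := by
        have : P.R.card ≤ 1 := by
          rw [P.card_R]
          omega
        exact fun r hr => Finset.card_le_one.1 this r hr k hR
      have : P.vacSpace c v ≤ (P.vacSpace c v).comap (c k) := by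
        conv_lhs => rw [Pairing.vacSpace]
        refine sup_le ?_ (iSup₂_le fun r hr => ?_)
        · rw [Submodule.span_singleton_le_iff_mem, Submodule.mem_comap]
          refine Submodule.mem_sup_right (Submodule.mem_iSup_of_mem k
            (Submodule.mem_iSup_of_mem hR (Submodule.mem_span_singleton_self _)))
        · rw [hRk r hr, Submodule.span_singleton_le_iff_mem, Submodule.mem_comap, h.c_c_apply]
          exact Submodule.mem_sup_left (Submodule.mem_span_singleton_self _)
      exact this hm
    · rw [neg_smul, one_smul]
      exact h.c_anti_apply _ _ (fun e => hk (by rw [e]; exact Finset.mem_toList.1 hs)) m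
  · intro m hm
    have htT : t ∈ P.T := P.mem_T.2 (Or.inl ht)
    have h1 := hT t htT _ (P.gen_inv_stable h hv htT m hm)
    have e : c t (P.inv x c t m) = sqrtF (-1 : F) • c (P.π t) m := by
      rw [Pairing.inv, if_pos (mem_zeros.1 (P.A_sub ht))]
      simp only [LinearMap.smul_apply, Module.End.mul_apply]
      rw [map_smul, h.c_c_apply]
    rw [e] at h1
    refine (Submodule.smul_mem_iff _ ?_).1 h1
    intro e0
    have := sqrtF_sq (-1 : F)
    rw [e0] at this
    simp at this

/-- At a letter 0 the operator x_k vanishes, and at any other letter it is a multiple of an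
involution. -/
theorem Pairing.gen_x_stable [CharZero F] {v : V} (hv : P.IsVac x c v) (hvj : v ∈ wt x j)
    (hnil : ∀ k, j k = 0 → ∀ m ∈ wt x j, x k m = 0) (k : Fin n) :
    ∀ m ∈ P.gen c v, x k m ∈ P.gen c v := by
  intro m hm
  by_cases hk0 : j k = 0
  · rw [hnil k hk0 m (P.gen_le hvj (fun k m hm => h.map_wt_c hm k) hm)]
    exact zero_mem _
  · have hk : k ∈ P.T := P.mem_T.2 (Or.inr hk0)
    have h1 := P.gen_inv_stable h hv hk m hm
    rw [Pairing.inv, if_neg hk0, LinearMap.smul_apply] at h1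
    refine (Submodule.smul_mem_iff _ (inv_ne_zero ?_)).1 h1
    intro e0
    have := sqrtF_sq (q F (j k))
    rw [e0, zero_pow two_ne_zero, eq_comm, q_eq_zero_iff] at this
    exact hk0 this

omit h [IsAlgClosed F] in
theorem Pairing.gen_isGr {p : ZMod 2 → Submodule F V} (hp : IsXCSuper p x c) {v : V}
    {a : ZMod 2} (hv : v ∈ p a) : IsGr p (P.gen c v) := by
  refine cliffSpan_isGr ?_ hp.c_mem _
  refine IsGr.sup (isGr_span_singleton hv) (IsGr.iSup fun r => IsGr.iSup fun _ => ?_)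
  exact isGr_span_singleton (hp.c_mem r _ _ hv)

/-- Multiplicity one: up to the unpaired Clifford generator, a vacuum vector is unique in the
x,c-module it generates. The uniqueness and type arguments both rest on this. -/
theorem Pairing.mem_vacSpace [CharZero F] {v m : V} (hv : P.IsVac x c v) (hm : m ∈ P.gen c v)
    (hm' : P.IsVac x c m) : m ∈ P.vacSpace c v :=
  mem_of_mem_cliffSpan P.T.nodup_toList
    (fun _ ht => P.inv_vacSpace h hv (Finset.mem_toList.1 ht))
    (fun _ ht => P.inv_c_same h (Finset.mem_toList.1 ht))
    (fun _ hs _ ht hst => P.inv_c h (Finset.mem_toList.1 hs) hst (Or.inl (Finset.mem_toList.1 ht)))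
    hm (fun t ht => hm' t (Finset.mem_toList.1 ht))

omit [IsAlgClosed F] in
-- The vectors v and c_r v have opposite parities, so they are independent.
theorem Pairing.finrank_vacSpace {p : ZMod 2 → Submodule F V} (hp : IsXCSuper p x c)
    (hdis : Disjoint (p 0) (p 1)) {v : V} {a : ZMod 2} (hva : v ∈ p a) (hv0 : v ≠ 0) :
    Module.finrank F (P.vacSpace c v) = 1 + P.R.card := by
  rcases P.R.eq_empty_or_nonempty with hR | ⟨r, hr⟩
  · have : P.vacSpace c v = Submodule.span F {v} := by
      rw [Pairing.vacSpace, hR]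
      simp
    rw [this, hR, finrank_span_singleton hv0, Finset.card_empty]
  · have hR1 : P.R.card ≤ 1 := by
      rw [P.card_R]
      omega
    have hRr : P.R = {r} :=
      Finset.eq_singleton_iff_unique_mem.2 ⟨hr, fun s hs => Finset.card_le_one.1 hR1 s hs r hr⟩
    have hc0 : c r v ≠ 0 := by
      intro e
      apply hv0
      rw [← h.c_c_apply r v, e, map_zero]
    have hd : Submodule.span F {v} ⊓ Submodule.span F {c r v} = ⊥ := by
      rw [← disjoint_iff]
      have hca := hp.c_mem r a v hva
      rcases zmod_two_cases a with rfl | rfl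
      · exact hdis.mono (by simpa using hva) (by simpa using hca)
      · rw [show (1 : ZMod 2) + 1 = 0 from rfl] at hca
        exact hdis.symm.mono (by simpa using hva) (by simpa using hca)
    have h3 := Submodule.finrank_sup_add_finrank_inf_eq (Submodule.span F {v})
      (Submodule.span F {c r v})
    rw [hd, finrank_bot, add_zero, finrank_span_singleton hv0, finrank_span_singleton hc0] at h3
    have : P.vacSpace c v = Submodule.span F {v} ⊔ Submodule.span F {c r v} := by
      rw [Pairing.vacSpace, hRr]
      simp
    rw [this, h3, hRr, Finset.card_singleton]

theorem Pairing.finrank_gen [CharZero F] [FiniteDimensional F V] {p : ZMod 2 → Submodule F V}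
    (hp : IsXCSuper p x c) (hdis : Disjoint (p 0) (p 1)) {v : V} {a : ZMod 2} (hva : v ∈ p a)
    (hv0 : v ≠ 0) (hv : P.IsVac x c v) :
    Module.finrank F (P.gen c v) = 2 ^ (n - (zeros j).card / 2) := by
  have e := finrank_cliffSpan (Q := P.vacSpace c v) h.c_c_apply P.T.nodup_toList
    (fun _ ht => P.inv_vacSpace h hv (Finset.mem_toList.1 ht))
    (fun _ ht => P.inv_c_same h (Finset.mem_toList.1 ht))
    (fun _ hs _ ht hst => P.inv_c h (Finset.mem_toList.1 hs) hst (Or.inl (Finset.mem_toList.1 ht)))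
  rw [Pairing.gen, e, P.finrank_vacSpace h hp hdis hva hv0, Finset.length_toList, P.card_T,
    P.card_R]
  have hle : (zeros j).card ≤ n := by
    have := Finset.card_le_univ (zeros j)
    rwa [Fintype.card_fin] at this
  -- The set R has 0 or 1 elements, so 1 + |R| = 2^|R|; with γ zeros, |T| + |R| = n − γ + ⌊γ/2⌋ + γ
  -- mod 2 = n − ⌊γ/2⌋.
  have e1 : 1 + (zeros j).card % 2 = 2 ^ ((zeros j).card % 2) := by
    rcases Nat.mod_two_eq_zero_or_one (zeros j).card with e | e <;> simp [e]
  rw [e1, ← pow_add]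
  congr 1
  omega

end Vacuum

/-! ## Modules and operators -/

section Operators

theorem XCRel.map {ι A B : Type*} [Ring A] [Ring B] {x c : ι → A} (h : XCRel x c) (φ : A →+* B) :
    XCRel (fun k => φ (x k)) (fun k => φ (c k)) where
  xx k l := by rw [← map_mul, h.xx, map_mul]
  c_sq k := by rw [← map_mul, h.c_sq, map_one]
  cc k l e := by rw [← map_mul, h.cc k l e, map_neg, map_mul]
  xc_same k := by rw [← map_mul, h.xc_same, map_neg, map_mul]
  xc k l e := by rw [← map_mul, h.xc k l e, map_mul]

theorem HCRel.map {A B : Type*} [Ring A] [Ring B] {n : ℕ} {s : Fin (n - 1) → A} {x c : Fin n → A}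
    (h : HCRel s x c) (φ : A →+* B) :
    HCRel (fun k => φ (s k)) (fun k => φ (x k)) (fun k => φ (c k)) where
  toXCRel := h.toXCRel.map φ
  s_sq k := by rw [← map_mul, h.s_sq, map_one]
  s_comm k l e := by rw [← map_mul, h.s_comm k l e, map_mul]
  braid k l e := by simp only [← map_mul, h.braid k l e]
  s_x k := by rw [← map_mul, h.s_x, map_sub, map_mul, map_add, map_mul, map_one]
  s_x_far k l h₁ h₂ := by rw [← map_mul, h.s_x_far k l h₁ h₂, map_mul]
  s_c_lo k := by rw [← map_mul, h.s_c_lo, map_mul]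
  s_c_hi k := by rw [← map_mul, h.s_c_hi, map_mul]
  s_c_far k l h₁ h₂ := by rw [← map_mul, h.s_c_far k l h₁ h₂, map_mul]

variable (F : Type u) [Field F] (n : ℕ)

theorem hcRel_gen : HCRel (fun k : Fin (n - 1) => gen F (Gen.s k)) (fun k => gen F (Gen.x k))
    (fun k => gen F (Gen.c k)) := by
  have key {a b : FreeAlgebra F (Gen n)} (h : Rel F n a b) :
      RingQuot.mkAlgHom F (Rel F n) a = RingQuot.mkAlgHom F (Rel F n) b :=
    RingQuot.mkAlgHom_rel F h
  refine ⟨⟨fun k l => ?_, fun k => ?_, fun k l e => ?_, fun k => ?_, fun k l e => ?_⟩,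
    fun k => ?_, fun k l e => ?_, fun k l e => ?_, fun k => ?_, fun k l h₁ h₂ => ?_, fun k => ?_,
    fun k => ?_, fun k l h₁ h₂ => ?_⟩
  · simpa only [map_mul, gen] using key (.x_comm k l)
  · simpa only [map_mul, map_one, gen] using key (.c_sq k)
  · simpa only [map_mul, map_neg, gen] using key (.c_anti k l e)
  · simpa only [map_mul, map_neg, gen] using key (.x_c_same k)
  · simpa only [map_mul, gen] using key (.x_c_far k l e)
  · simpa only [map_mul, map_one, gen] using key (.s_sq k)
  · simpa only [map_mul, gen] using key (.s_comm k l e)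
  · simpa only [map_mul, gen] using key (.braid k l e)
  · simpa only [map_mul, map_sub, map_add, map_one, gen] using key (.s_x k)
  · simpa only [map_mul, gen] using key (.s_x_far k l h₁ h₂)
  · simpa only [map_mul, gen] using key (.s_c_lo k)
  · simpa only [map_mul, gen] using key (.s_c_hi k)
  · simpa only [map_mul, gen] using key (.s_c_far k l h₁ h₂)

variable {F n}

theorem alg_induction {P : Alg F n → Prop} (one : P 1) (add : ∀ a b, P a → P b → P (a + b))
    (smul : ∀ (r : F) a, P a → P (r • a)) (mul : ∀ g a, P a → P (gen F g * a)) (a : Alg F n) :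
    P a := by
  obtain ⟨y, rfl⟩ := RingQuot.mkAlgHom_surjective F (Rel F n) a
  -- With a right factor b carried along, a product in the free algebra is handled by applying
  -- generators on the left, one after the other.
  suffices H : ∀ (b : Alg F n), P b → P (RingQuot.mkAlgHom F (Rel F n) y * b) by
    simpa using H 1 one
  induction y using FreeAlgebra.induction with
  | grade0 r =>
    intro b hb
    rw [AlgHom.commutes, ← Algebra.smul_def]
    exact smul r b hb
  | grade1 g => exact fun b hb => mul g b hb
  | mul a b ha hb =>
    intro d hd
    rw [map_mul, mul_assoc]
    exact ha _ (hb _ hd)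
  | add a b ha hb =>
    intro d hd
    rw [map_add, add_mul]
    exact add _ _ (ha _ hd) (hb _ hd)

/-- The operators by which the generators act on a module. -/
noncomputable def sOp (M : Mod.{u, v} F n) (k : Fin (n - 1)) : Module.End F M.carrier :=
  act M (gen F (Gen.s k))

noncomputable def xOp (M : Mod.{u, v} F n) (k : Fin n) : Module.End F M.carrier :=
  act M (gen F (Gen.x k))

noncomputable def cOp (M : Mod.{u, v} F n) (k : Fin n) : Module.End F M.carrier :=
  act M (gen F (Gen.c k))

theorem hcRel_op (M : Mod.{u, v} F n) : HCRel (sOp M) (xOp M) (cOp M) :=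
  (hcRel_gen F n).map (Algebra.lsmul F F M.carrier).toRingHom

theorem gen_mem_algPart (g : Gen n) : gen F g ∈ algPart F n g.parity :=
  Submodule.subset_span ⟨[g], by simp, by simp⟩

theorem isSuper_op (M : Mod.{u, v} F n) : IsSuper M.part (sOp M) (xOp M) (cOp M) where
  x_mem k a m hm := by
    have := M.smul_mem _ a _ m (gen_mem_algPart (Gen.x k)) hm
    rwa [Gen.parity, zero_add] at this
  c_mem k a m hm := by
    have := M.smul_mem _ a _ m (gen_mem_algPart (Gen.c k)) hm
    rwa [Gen.parity, add_comm] at this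
  s_mem k a m hm := by
    have := M.smul_mem _ a _ m (gen_mem_algPart (Gen.s k)) hm
    rwa [Gen.parity, zero_add] at this

theorem smul_mem_of_gen {M : Type*} [AddCommGroup M] [Module F M] [Module (Alg F n) M]
    [IsScalarTower F (Alg F n) M] {N : Submodule F M} (h : ∀ g : Gen n, ∀ m ∈ N, gen F g • m ∈ N)
    (a : Alg F n) : ∀ m ∈ N, a • m ∈ N := by
  induction a using alg_induction with
  | one => simp
  | add a b ha hb =>
    intro m hm
    rw [add_smul]
    exact add_mem (ha m hm) (hb m hm)
  | smul r a ha =>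
    intro m hm
    rw [smul_assoc]
    exact N.smul_mem _ (ha m hm)
  | mul g a ha =>
    intro m hm
    rw [mul_smul]
    exact h g _ (ha m hm)

/-- A subspace stable under the generators is a submodule. -/
def submoduleOfStable (M : Mod.{u, v} F n) (N : Submodule F M.carrier)
    (hs : ∀ k, ∀ m ∈ N, sOp M k m ∈ N) (hx : ∀ k, ∀ m ∈ N, xOp M k m ∈ N)
    (hc : ∀ k, ∀ m ∈ N, cOp M k m ∈ N) : Submodule (Alg F n) M.carrier where
  carrier := N
  add_mem' := N.add_mem
  zero_mem' := N.zero_mem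
  smul_mem' a m hm := smul_mem_of_gen (N := N) (by
    rintro (k | k | k) m hm
    · exact hs k m hm
    · exact hx k m hm
    · exact hc k m hm) a m hm

theorem map_smul_of_gen {M N : Type*} [AddCommGroup M] [Module F M] [Module (Alg F n) M]
    [IsScalarTower F (Alg F n) M] [AddCommGroup N] [Module F N] [Module (Alg F n) N]
    [IsScalarTower F (Alg F n) N] (f : M →ₗ[F] N)
    (h : ∀ (g : Gen n) m, f (gen F g • m) = gen F g • f m) (a : Alg F n) : ∀ m, f (a • m) = a • f m := by
  induction a using alg_induction with
  | one => simp
  | add a b ha hb =>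
    intro m
    rw [add_smul, map_add, ha, hb, add_smul]
  | smul r a ha =>
    intro m
    rw [smul_assoc, map_smul, ha, smul_assoc]
  | mul g a ha =>
    intro m
    rw [mul_smul, h, ha, mul_smul]

end Operators

/-! ## Modules given by operators -/

section OfOperators

variable {F : Type u} [Field F] {n : ℕ} {V : Type w} [AddCommGroup V] [Module F V]
  {s : Fin (n - 1) → Module.End F V} {x c : Fin n → Module.End F V}

/-- The representation given by operators satisfying the defining relations. -/
noncomputable def opHom (h : HCRel s x c) : Alg F n →ₐ[F] Module.End F V :=
  RingQuot.liftAlgHom F ⟨FreeAlgebra.lift F (fun g : Gen n => match g with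
    | .s k => s k
    | .x k => x k
    | .c k => c k), by
    intro a b hab
    cases hab with
    | s_sq k => simpa using h.s_sq k
    | s_comm k l e => simpa using h.s_comm k l e
    | braid k l e => simpa using h.braid k l e
    | x_comm k l => simpa using h.xx k l
    | c_sq k => simpa using h.c_sq k
    | c_anti k l e => simpa using h.cc k l e
    | s_x k => simpa using h.s_x k
    | s_x_far k l h₁ h₂ => simpa using h.s_x_far k l h₁ h₂
    | s_c_lo k => simpa using h.s_c_lo k
    | s_c_hi k => simpa using h.s_c_hi k
    | s_c_far k l h₁ h₂ => simpa using h.s_c_far k l h₁ h₂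
    | x_c_same k => simpa using h.xc_same k
    | x_c_far k l e => simpa using h.xc k l e⟩

theorem opHom_s (h : HCRel s x c) (k : Fin (n - 1)) : opHom h (gen F (Gen.s k)) = s k := by
  simp [opHom, gen]

theorem opHom_x (h : HCRel s x c) (k : Fin n) : opHom h (gen F (Gen.x k)) = x k := by
  simp [opHom, gen]

theorem opHom_c (h : HCRel s x c) (k : Fin n) : opHom h (gen F (Gen.c k)) = c k := by
  simp [opHom, gen]

theorem opHom_mem (h : HCRel s x c) {p : ZMod 2 → Submodule F V} (hp : IsSuper p s x c)
    {a b : ZMod 2} {t : Alg F n} (ht : t ∈ algPart F n a) {m : V} (hm : m ∈ p b) :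
    opHom h t m ∈ p (a + b) := by
  induction ht using Submodule.span_induction with
  | mem t ht =>
    obtain ⟨l, rfl, rfl⟩ := ht
    induction l with
    | nil => simpa using hm
    | cons g l ih =>
      rw [List.map_cons, List.map_cons, List.prod_cons, List.sum_cons, map_mul,
        Module.End.mul_apply, add_assoc]
      rcases g with k | k | k
      · rw [opHom_s, Gen.parity, zero_add]
        exact hp.s_mem _ _ _ ih
      · rw [opHom_x, Gen.parity, zero_add]
        exact hp.x_mem _ _ _ ih
      · rw [opHom_c, Gen.parity, add_comm]
        exact hp.c_mem _ _ _ ih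
  | zero => simp
  | add t t' _ _ h1 h2 =>
    rw [map_add]
    exact add_mem h1 h2
  | smul r t _ h1 =>
    rw [map_smul]
    exact Submodule.smul_mem _ _ h1

/-- The module given by operators satisfying the defining relations. -/
noncomputable def modOfOp (h : HCRel s x c) (p : ZMod 2 → Submodule F V) (hp : IsSuper p s x c)
    (hint : DirectSum.IsInternal p) : Mod.{u, w} F n :=
  letI : Module (Alg F n) V := Module.compHom V (opHom h).toRingHom
  { carrier := V
    part := p
    internal := hint
    tower := ⟨fun r a m => by
      change opHom h (r • a) m = r • opHom h a m
      rw [map_smul]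
      rfl⟩
    smul_mem := fun _ _ _ _ ht hm => opHom_mem h hp ht hm }

variable (h : HCRel s x c) (p : ZMod 2 → Submodule F V) (hp : IsSuper p s x c)
  (hint : DirectSum.IsInternal p)

theorem sOp_modOfOp (k : Fin (n - 1)) : sOp (modOfOp h p hp hint) k = s k := opHom_s h k

theorem xOp_modOfOp (k : Fin n) : xOp (modOfOp h p hp hint) k = x k := opHom_x h k

theorem cOp_modOfOp (k : Fin n) : cOp (modOfOp h p hp hint) k = c k := opHom_c h k

theorem isInternal_iff {p : ZMod 2 → Submodule F V} :
    DirectSum.IsInternal p ↔ IsCompl (p 0) (p 1) :=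
  DirectSum.isInternal_submodule_iff_isCompl p (by decide) (by ext a; simpa using zmod_two_cases a)

end OfOperators

/-! ## Existence of the modules `D^i` -/

section Twist

variable {F : Type*} [Field F] {V : Type*} [AddCommGroup V] [Module F V] {n : ℕ}
  {i : Fin n → ℕ} {X C : Fin n → Module.End F V}

/-- Operators on `V` for which the whole of `V` is the weight space of the word `i`. -/
structure IsWtMod (X C : Fin n → Module.End F V) (i : Fin n → ℕ) : Prop extends XCRel X C where
  sq : ∀ k m, X k (X k m) = q F (i k) • m
  nil : ∀ k, i k = 0 → ∀ m, X k m = 0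

/-- The operators `Ξ`. -/
def xi (X C : Fin n → Module.End F V) (i : Fin n → ℕ) (a b : Fin n) : Module.End F V :=
  -((q F (i a) - q F (i b))⁻¹ • uhat X C a b)

theorem xi_apply (a b : Fin n) (m : V) :
    xi X C i a b m = -((q F (i a) - q F (i b))⁻¹ • uhat X C a b m) := rfl

section Omega

variable [IsAlgClosed F]

theorem omega_mul_self (a b : ℕ) :
    omega F a b * omega F a b = 1 - 2 * (q F a + q F b) / (q F a - q F b) ^ 2 := by
  rw [← pow_two, omega, sqrtF_sq]

theorem omega_comm (a b : ℕ) : omega F a b = omega F b a := by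
  rw [omega, omega, add_comm, sub_sq_comm]

/-- With a, b now the two values of q, Ω² equals −φ²/(a − b)², so it vanishes together with the
scalar of the squared intertwiner, that is at the transpositions that are not admissible. -/
theorem omega_eq_zero_iff [CharZero F] {a b : ℕ} (h : a ≠ b) :
    omega F a b = 0 ↔ a = b + 1 ∨ b = a + 1 := by
  have hq := q_sub_ne_zero (F := F) h
  rw [← inter_scalar_eq_zero_iff (F := F) h, ← mul_self_eq_zero, omega_mul_self, sub_eq_zero,
    sub_eq_zero, eq_div_iff (pow_ne_zero 2 hq), one_mul, ← pow_two, eq_comm]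

end Omega

namespace IsWtMod

variable (h : IsWtMod X C i)
include h

theorem wt_mem (m : V) : m ∈ wt X i := mem_wt.2 fun k => h.sq k m

theorem xi_symm {a b : Fin n} (hab : a ≠ b) (m : V) : xi X C i b a m = -xi X C i a b m := by
  rw [xi_apply, xi_apply, h.uhat_symm a b hab, ← neg_sub (q F (i a)), inv_neg, neg_smul]

theorem xi_x_far {a b d : Fin n} (ha : d ≠ a) (hb : d ≠ b) (m : V) :
    xi X C i a b (X d m) = X d (xi X C i a b m) := by
  have := LinearMap.congr_fun (h.uhat_comm_x a b d ha hb) m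
  simp only [Module.End.mul_apply] at this
  rw [xi_apply, xi_apply, this, map_neg, map_smul]

theorem xi_c_far {a b d : Fin n} (ha : d ≠ a) (hb : d ≠ b) (m : V) :
    xi X C i a b (C d m) = C d (xi X C i a b m) := by
  have := LinearMap.congr_fun (h.uhat_comm_c a b d ha hb) m
  simp only [Module.End.mul_apply] at this
  rw [xi_apply, xi_apply, this, map_neg, map_smul]

theorem xi_xi_far {a b d e : Fin n} (h1 : d ≠ a) (h2 : d ≠ b) (h3 : e ≠ a) (h4 : e ≠ b) (m : V) :
    xi X C i a b (xi X C i d e m) = xi X C i d e (xi X C i a b m) := by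
  have := LinearMap.congr_fun (h.uhat_comm_uhat a b d e h1 h2 h3 h4) m
  simp only [Module.End.mul_apply] at this
  simp only [xi_apply, map_neg, map_smul, this]
  module

theorem xi_c {a b : Fin n} (hab : a ≠ b) (m : V) :
    xi X C i a b (C a m) = C b (xi X C i a b m) := by
  have := LinearMap.congr_fun (h.uhat_mul_c a b hab) m
  simp only [Module.End.mul_apply] at this
  rw [xi_apply, xi_apply, this, map_neg, map_smul]

theorem xi_c' {a b : Fin n} (hab : a ≠ b) (m : V) :
    xi X C i a b (C b m) = C a (xi X C i a b m) := by
  rw [h.xi_symm hab.symm, h.xi_c hab.symm, h.xi_symm hab, map_neg, neg_neg]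

variable [CharZero F]

theorem xi_x {a b : Fin n} (hab : i a ≠ i b) (m : V) :
    xi X C i a b (X a m) = X b (xi X C i a b m) - (m + C a (C b m)) := by
  have e := LinearMap.congr_fun (h.uhat_mul_x a b (fun e => hab (e ▸ rfl))) m
  simp only [Module.End.mul_apply, LinearMap.add_apply, LinearMap.sub_apply, h.sq,
    add_mul, one_mul, map_sub, map_smul] at e
  have hq := q_sub_ne_zero (F := F) hab
  rw [xi_apply, xi_apply, e, map_neg, map_smul]
  match_scalars <;> field_simp

variable [IsAlgClosed F]

/-- Put as Ξ² + Ω² = 1, which is the diagonal part of s_k² = 1. -/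
theorem xi_xi {a b : Fin n} (hab : i a ≠ i b) (m : V) :
    xi X C i a b (xi X C i a b m) = (1 - omega F (i a) (i b) * omega F (i a) (i b)) • m := by
  have e := h.uhat_uhat_apply (h.wt_mem m) (a := a) (b := b) (fun e => hab (e ▸ rfl))
  have hq := q_sub_ne_zero (F := F) hab
  simp only [xi_apply, map_neg, map_smul, e, omega_mul_self]
  match_scalars
  field_simp
  ring

omit [IsAlgClosed F] in
theorem xi_yangBaxter {a b d : Fin n} (hab : i a ≠ i b) (hbd : i b ≠ i d) (had : i a ≠ i d)
    (m : V) : xi X C i a b (xi X C i b d m) =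
      xi X C i b d (xi X C i a d m) + xi X C i a d (xi X C i a b m) := by
  have e := h.uhat_yangBaxter_apply (h.wt_mem m) (a := a) (b := b) (d := d)
    (fun e => hab (e ▸ rfl)) (fun e => hbd (e ▸ rfl)) (fun e => had (e ▸ rfl))
  have h1 := q_sub_ne_zero (F := F) hab
  have h2 := q_sub_ne_zero (F := F) hbd
  have h3 := q_sub_ne_zero (F := F) had
  simp only [xi_apply, map_neg, map_smul]
  linear_combination (norm := skip) ((q F (i a) - q F (i b))⁻¹ * (q F (i b) - q F (i d))⁻¹ *
    (q F (i a) - q F (i d))⁻¹) • e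
  match_scalars <;> field_simp <;> ring

omit [IsAlgClosed F] in
-- Since x_a = x_d = 0, the outer `uhat` vanishes and the cubic identity becomes a true braid
-- relation.
theorem xi_braid_of_eq {a b d : Fin n} (hab : a ≠ b) (hbd : b ≠ d) (had : a ≠ d)
    (ha : i a = 0) (hb : i b ≠ 0) (hd : i d = 0) (m : V) :
    xi X C i a b (xi X C i b d (xi X C i a b m)) =
      xi X C i b d (xi X C i a b (xi X C i b d m)) := by
  have e := h.uhat_cubic_apply (h.wt_mem m) hab hbd had
  have e0 : uhat X C a d m = 0 := by
    simp [uhat, h.nil a ha, h.nil d hd]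
  have hq : q F (i b) ≠ 0 := by rwa [Ne, q_eq_zero_iff]
  simp only [xi_apply, map_neg, map_smul]
  rw [e0, smul_zero, ha, hd, q_zero] at e
  rw [ha, hd, q_zero]
  linear_combination (norm := skip) (-((q F (i b))⁻¹ ^ 4)) • e
  match_scalars <;> field_simp <;> ring

/-- The part of the braid relation that returns to the same component: the triple products of Ξ, and
the detours through a neighbouring component with coefficient Ω². For i a ≠ i d the Yang-Baxter
equation is applied on both sides; in the pattern (0, 1, 0) both Ω vanish. -/
theorem xi_braid {a b d : Fin n} (hab : i a ≠ i b) (hbd : i b ≠ i d) (had : a ≠ d)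
    (hs : i a = i d → i a = 0 ∧ i b = 1) (m : V) :
    xi X C i a b (xi X C i b d (xi X C i a b m)) +
        (omega F (i a) (i b) * omega F (i a) (i b)) • xi X C i a d m =
      xi X C i b d (xi X C i a b (xi X C i b d m)) +
        (omega F (i b) (i d) * omega F (i b) (i d)) • xi X C i a d m := by
  by_cases e : i a = i d
  · obtain ⟨e1, e2⟩ := hs e
    have n1 : a ≠ b := by
      rintro rfl
      exact hab rfl
    have n2 : b ≠ d := by
      rintro rfl
      exact hbd rfl
    rw [(omega_eq_zero_iff hab).2 (by omega), (omega_eq_zero_iff hbd).2 (by omega),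
      h.xi_braid_of_eq n1 n2 had e1 (by omega) (by omega)]
  · rw [h.xi_yangBaxter hab hbd e, h.xi_yangBaxter hab hbd e, map_add, h.xi_xi hab, h.xi_xi hbd,
      map_smul]
    module

/-- The part of the braid relation between neighbouring components. The Yang-Baxter equation fails
to be available only if i a = i d, and then the factor Ω is zero. -/
theorem omega_smul_yangBaxter {a b d : Fin n} (hab : i a ≠ i b) (hbd : i b ≠ i d)
    (hs : i a = i d → i a = 0 ∧ i b = 1) (m : V) :
    omega F (i a) (i b) • xi X C i a b (xi X C i b d m) =
      omega F (i a) (i b) • (xi X C i b d (xi X C i a d m) + xi X C i a d (xi X C i a b m)) := by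
  by_cases e : i a = i d
  · obtain ⟨e1, e2⟩ := hs e
    rw [(omega_eq_zero_iff hab).2 (by omega), zero_smul, zero_smul]
  · rw [h.xi_yangBaxter hab hbd e]

end IsWtMod

section Functions

variable [IsAlgClosed F]

/-- The formulas defining `D^i`, on the functions on all permutations. -/
noncomputable def twS (X C : Fin n → Module.End F V) (i : Fin n → ℕ) (k : Fin (n - 1)) :
    Module.End F (Equiv.Perm (Fin n) → V) where
  toFun f τ := xi X C i (τ⁻¹ (lo k)) (τ⁻¹ (hi k)) (f τ) +
    omega F (i (τ⁻¹ (lo k))) (i (τ⁻¹ (hi k))) • f (simpleSwap k * τ)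
  map_add' f g := by
    funext τ
    simp only [Pi.add_apply, map_add, smul_add]
    abel
  map_smul' r f := by
    funext τ
    simp only [Pi.smul_apply, map_smul, smul_add, RingHom.id_apply]
    rw [smul_comm]

/-- Operators acting on the component `τ` by `X (τ⁻¹ k)`. -/
def twDiag (X : Fin n → Module.End F V) (k : Fin n) : Module.End F (Equiv.Perm (Fin n) → V) where
  toFun f τ := X (τ⁻¹ k) (f τ)
  map_add' f g := by
    funext τ
    simp
  map_smul' r f := by
    funext τ
    simp

/-- The functions supported in `P_i`. -/
def twSpace (F V : Type*) [Field F] [AddCommGroup V] [Module F V] (i : Fin n → ℕ) :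
    Submodule F (Equiv.Perm (Fin n) → V) where
  carrier := {f | ∀ τ, ¬ InP i τ → f τ = 0}
  add_mem' hf hg τ hτ := by rw [Pi.add_apply, hf τ hτ, hg τ hτ, add_zero]
  zero_mem' _ _ := rfl
  smul_mem' r f hf τ hτ := by rw [Pi.smul_apply, hf τ hτ, smul_zero]

omit [IsAlgClosed F] in
theorem twDiag_mem (X : Fin n → Module.End F V) (k : Fin n) :
    ∀ f ∈ twSpace F V i, twDiag X k f ∈ twSpace F V i := by
  intro f hf τ hτ
  change X (τ⁻¹ k) (f τ) = 0
  rw [hf τ hτ, map_zero]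

theorem Alternating.inv_ne {i : Fin n → ℕ} (hi : Alternating i) {τ : Equiv.Perm (Fin n)}
    (hτ : InP i τ) (k : Fin (n - 1)) : i (τ⁻¹ (lo k)) ≠ i (τ⁻¹ (HeckeClifford.hi k)) :=
  (hτ.alternating_and_lt hi).1.adj_ne k

/-- If s_k τ lies in P_i but τ does not, then s_k is not admissible at s_k τ and Ω vanishes. One
formula on all permutations thus covers both cases in the definition of D^i. -/
theorem twS_mem [CharZero F] (hi : Alternating i) (k : Fin (n - 1)) :
    ∀ f ∈ twSpace F V i, twS X C i k f ∈ twSpace F V i := by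
  intro f hf τ hτ
  change xi X C i (τ⁻¹ (lo k)) (τ⁻¹ (HeckeClifford.hi k)) (f τ) + omega F (i (τ⁻¹ (lo k)))
    (i (τ⁻¹ (HeckeClifford.hi k))) • f (simpleSwap k * τ) = 0
  rw [hf τ hτ, map_zero, zero_add]
  by_cases hk : InP i (simpleSwap k * τ)
  · have h1 := hi.inv_ne hk k
    have h2 : ¬ Admissible (permWord (simpleSwap k * τ) i) k := by
      intro had
      have := hk.step _ _ had
      rw [simpleSwap_mul_mul] at this
      exact hτ this
    rw [Admissible, permWord, permWord] at h2
    rw [simpleSwap_mul_inv_apply, simpleSwap_mul_inv_apply, simpleSwap_lo, simpleSwap_hi] at h1 h2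
    rw [(omega_eq_zero_iff h1.symm).2 (by omega), zero_smul]
  · rw [hf _ hk, smul_zero]

variable (X C) in
/-- The operators of the generators `s_k` on `D^i`. -/
noncomputable def twOpS [CharZero F] (hi : Alternating i) (k : Fin (n - 1)) :
    Module.End F (twSpace F V i) :=
  (twS X C i k).restrict (twS_mem hi k)

variable (i) in
/-- The operators of the generators `x_k` and `c_k` on `D^i`. -/
def twOp (X : Fin n → Module.End F V) (k : Fin n) : Module.End F (twSpace F V i) :=
  (twDiag X k).restrict (twDiag_mem X k)

theorem twOpS_apply [CharZero F] (hi : Alternating i) (k : Fin (n - 1)) (f : twSpace F V i)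
    (τ : Equiv.Perm (Fin n)) : (twOpS X C hi k f).1 τ =
      xi X C i (τ⁻¹ (lo k)) (τ⁻¹ (HeckeClifford.hi k)) (f.1 τ) +
        omega F (i (τ⁻¹ (lo k))) (i (τ⁻¹ (HeckeClifford.hi k))) • f.1 (simpleSwap k * τ) := rfl

omit [IsAlgClosed F] in
theorem twOp_apply (k : Fin n) (f : twSpace F V i) (τ : Equiv.Perm (Fin n)) :
    (twOp i X k f).1 τ = X (τ⁻¹ k) (f.1 τ) := rfl

omit [IsAlgClosed F] in
theorem twSpace_ext {A B : Module.End F (twSpace F V i)}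
    (h : ∀ f τ, InP i τ → (A f).1 τ = (B f).1 τ) : A = B := by
  refine LinearMap.ext fun f => Subtype.ext (funext fun τ => ?_)
  by_cases hτ : InP i τ
  · exact h f τ hτ
  · rw [(A f).2 τ hτ, (B f).2 τ hτ]

omit [IsAlgClosed F] in
theorem xcRel_twOp (h : XCRel X C) : XCRel (twOp i X) (twOp i C) where
  xx k l := twSpace_ext fun f τ _ => LinearMap.congr_fun (h.xx (τ⁻¹ k) (τ⁻¹ l)) (f.1 τ)
  c_sq k := twSpace_ext fun f τ _ => LinearMap.congr_fun (h.c_sq (τ⁻¹ k)) (f.1 τ)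
  cc k l e := twSpace_ext fun f τ _ => LinearMap.congr_fun
    (h.cc (τ⁻¹ k) (τ⁻¹ l) (fun e' => e (τ⁻¹.injective e'))) (f.1 τ)
  xc_same k := twSpace_ext fun f τ _ => LinearMap.congr_fun (h.xc_same (τ⁻¹ k)) (f.1 τ)
  xc k l e := twSpace_ext fun f τ _ => LinearMap.congr_fun
    (h.xc (τ⁻¹ k) (τ⁻¹ l) (fun e' => e (τ⁻¹.injective e'))) (f.1 τ)

/-- The relations are compared component by component. Ω is symmetric in its letters and Ξ changes
sign when its positions are exchanged, so the cross terms of s_k² cancel. The braid relation reduces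
to `xi_braid` at τ and to `omega_smul_yangBaxter` for the components at s_k τ and s_l τ. -/
theorem hcRel_twOp [CharZero F] (h : IsWtMod X C i) (hi : Alternating i) :
    HCRel (twOpS X C hi) (twOp i X) (twOp i C) := by
  have inj {τ : Equiv.Perm (Fin n)} {a b : Fin n} (e : a ≠ b) : τ⁻¹ a ≠ τ⁻¹ b :=
    fun e' => e (τ⁻¹.injective e')
  refine ⟨xcRel_twOp h.toXCRel, fun k => ?_, fun k l e => ?_, fun k l e => ?_, fun k => ?_,
    fun k l h₁ h₂ => ?_, fun k => ?_, fun k => ?_, fun k l h₁ h₂ => ?_⟩ <;>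
    refine twSpace_ext fun f τ hτ => ?_
  · have hne := hi.inv_ne hτ k
    simp only [Module.End.mul_apply, twOpS_apply, simpleSwap_mul_inv_apply, simpleSwap_lo,
      simpleSwap_hi, simpleSwap_mul_mul, map_add, map_smul, h.xi_xi hne,
      h.xi_symm (inj (lo_ne_hi k)), Module.End.one_apply]
    rw [omega_comm (i (τ⁻¹ (HeckeClifford.hi k)))]
    module
  · have n1 : lo k ≠ lo l := by simp [lo, Fin.ext_iff]; omega
    have n2 : lo k ≠ HeckeClifford.hi l := by simp [lo, HeckeClifford.hi, Fin.ext_iff]; omega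
    have n3 : HeckeClifford.hi k ≠ lo l := by simp [lo, HeckeClifford.hi, Fin.ext_iff]; omega
    have n4 : HeckeClifford.hi k ≠ HeckeClifford.hi l := by
      simp [HeckeClifford.hi, Fin.ext_iff]; omega
    simp only [Module.End.mul_apply, twOpS_apply, simpleSwap_mul_inv_apply,
      simpleSwap_far n1 n2, simpleSwap_far n3 n4, simpleSwap_far n1.symm n3.symm,
      simpleSwap_far n2.symm n4.symm, map_add, map_smul, ← mul_assoc, simpleSwap_mul_comm e,
      h.xi_xi_far (inj n1.symm) (inj n3.symm) (inj n2.symm) (inj n4.symm)]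
    module
  · have el : lo l = HeckeClifford.hi k := by simp [lo, HeckeClifford.hi, e]
    have n12 : lo k ≠ HeckeClifford.hi k := lo_ne_hi k
    have n23 : HeckeClifford.hi k ≠ HeckeClifford.hi l := el ▸ lo_ne_hi l
    have n13 : lo k ≠ HeckeClifford.hi l := by
      simp [lo, HeckeClifford.hi, Fin.ext_iff]; omega
    have S3 : simpleSwap k (HeckeClifford.hi l) = HeckeClifford.hi l :=
      simpleSwap_far n13.symm n23.symm
    have R1 : simpleSwap l (lo k) = lo k := simpleSwap_far (el ▸ n12) n13
    have R2 : simpleSwap l (HeckeClifford.hi k) = HeckeClifford.hi l := el ▸ simpleSwap_lo l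
    have R3 : simpleSwap l (HeckeClifford.hi l) = HeckeClifford.hi k := el ▸ simpleSwap_hi l
    have a1 := hi.inv_ne hτ k
    have a2 := hi.inv_ne hτ l
    rw [el] at a2
    have a3 : i (τ⁻¹ (lo k)) = i (τ⁻¹ (HeckeClifford.hi l)) → i (τ⁻¹ (lo k)) = 0 ∧
        i (τ⁻¹ (HeckeClifford.hi k)) = 1 := (hτ.alternating_and_lt hi).1.three e
    simp only [Module.End.mul_apply, twOpS_apply, simpleSwap_mul_inv_apply, el, simpleSwap_lo,
      simpleSwap_hi, S3, R1, R2, R3, map_add, map_smul, simpleSwap_mul_mul]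
    simp only [← mul_assoc, simpleSwap_braid e]
    set A := τ⁻¹ (lo k)
    set B := τ⁻¹ (HeckeClifford.hi k)
    set D := τ⁻¹ (HeckeClifford.hi l)
    have e1 := h.xi_braid a1 a2 (inj n13) a3 (f.1 τ)
    have e2 := h.omega_smul_yangBaxter a1 a2 a3 (f.1 (simpleSwap k * τ))
    have e3 := h.omega_smul_yangBaxter a2.symm a1.symm (fun e => ⟨by have := a3 e.symm; omega,
      by have := a3 e.symm; omega⟩) (f.1 (simpleSwap l * τ))
    have sAB : ∀ m, xi X C i B A m = -xi X C i A B m := h.xi_symm (inj n12)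
    have sBD : ∀ m, xi X C i D B m = -xi X C i B D m := h.xi_symm (inj n23)
    have sAD : ∀ m, xi X C i D A m = -xi X C i A D m := h.xi_symm (inj n13)
    simp only [sAB, sBD, sAD, map_neg, neg_neg, omega_comm (i D) (i B), omega_comm (i B) (i A)]
      at e3 ⊢
    linear_combination (norm := module) e1 + e2 - e3
  · have hne := hi.inv_ne hτ k
    simp only [Module.End.mul_apply, twOpS_apply, twOp_apply, simpleSwap_mul_inv_apply,
      simpleSwap_lo, LinearMap.sub_apply, LinearMap.add_apply, Module.End.one_apply,
      Submodule.coe_sub, Submodule.coe_add, Pi.sub_apply, Pi.add_apply, h.xi_x hne, map_add,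
      map_smul]
    abel
  · simp only [Module.End.mul_apply, twOpS_apply, twOp_apply, simpleSwap_mul_inv_apply,
      simpleSwap_far h₁ h₂, h.xi_x_far (inj h₁) (inj h₂), map_add, map_smul]
  · simp only [Module.End.mul_apply, twOpS_apply, twOp_apply, simpleSwap_mul_inv_apply,
      simpleSwap_lo, h.xi_c (inj (lo_ne_hi k)), map_add, map_smul]
  · simp only [Module.End.mul_apply, twOpS_apply, twOp_apply, simpleSwap_mul_inv_apply,
      simpleSwap_hi, h.xi_c' (inj (lo_ne_hi k)), map_add, map_smul]
  · simp only [Module.End.mul_apply, twOpS_apply, twOp_apply, simpleSwap_mul_inv_apply,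
      simpleSwap_far h₁ h₂, h.xi_c_far (inj h₁) (inj h₂), map_add, map_smul]

end Functions

end Twist

/-! ### The grading of D^i and the action on the vectors z^τ -/

section TwistParts

variable {F : Type*} [Field F] {V : Type*} [AddCommGroup V] [Module F V] {n : ℕ}
  {i : Fin n → ℕ} {X C : Fin n → Module.End F V}

/-- The homogeneous parts of `D^i`. -/
def twPart (i : Fin n → ℕ) (p : ZMod 2 → Submodule F V) (a : ZMod 2) :
    Submodule F (twSpace F V i) where
  carrier := {f | ∀ τ, f.1 τ ∈ p a}
  add_mem' hf hg τ := add_mem (hf τ) (hg τ)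
  zero_mem' _ := zero_mem _
  smul_mem' r _ hf τ := Submodule.smul_mem _ r (hf τ)

variable {p : ZMod 2 → Submodule F V}

theorem IsXCSuper.uhat_mem (hp : IsXCSuper p X C) (a b : Fin n) (t : ZMod 2) {m : V}
    (hm : m ∈ p t) : uhat X C a b m ∈ p t := by
  have e : uhat X C a b m = X a m + X b m + C a (C b (X a m - X b m)) := rfl
  rw [e]
  exact add_mem (add_mem (hp.x_mem _ _ _ hm) (hp.x_mem _ _ _ hm))
    (hp.cc_mem _ _ _ _ (sub_mem (hp.x_mem _ _ _ hm) (hp.x_mem _ _ _ hm)))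

theorem isXCSuper_twOp (hp : IsXCSuper p X C) :
    IsXCSuper (twPart i p) (twOp i X) (twOp i C) where
  x_mem _ _ _ hf _ := hp.x_mem _ _ _ (hf _)
  c_mem _ _ _ hf _ := hp.c_mem _ _ _ (hf _)

theorem isSuper_twOp [IsAlgClosed F] [CharZero F] (hp : IsXCSuper p X C) (hi : Alternating i) :
    IsSuper (twPart i p) (twOpS X C hi) (twOp i X) (twOp i C) where
  toIsXCSuper := isXCSuper_twOp hp
  s_mem _ _ _ hf _ := add_mem (neg_mem (Submodule.smul_mem _ _ (hp.uhat_mem _ _ _ (hf _))))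
    (Submodule.smul_mem _ _ (hf _))

theorem isCompl_twPart (hp : IsCompl (p 0) (p 1)) : IsCompl (twPart i p 0) (twPart i p 1) := by
  constructor
  · rw [Submodule.disjoint_def]
    exact fun f h0 h1 => Subtype.ext (funext fun τ =>
      Submodule.disjoint_def.1 hp.disjoint _ (h0 τ) (h1 τ))
  · rw [codisjoint_iff, eq_top_iff]
    rintro f -
    have H : ∀ m : V, ∃ m₀ ∈ p 0, ∃ m₁ ∈ p 1, m₀ + m₁ = m := fun m =>
      Submodule.mem_sup.1 (hp.sup_eq_top ▸ Submodule.mem_top)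
    choose g₀ h0 g₁ h1 e using H
    -- The chosen decomposition of 0 is 0 + 0, so the homogeneous components still vanish outside
    -- P_i.
    have z : g₀ 0 = 0 ∧ g₁ 0 = 0 := by
      have : g₀ 0 = -g₁ 0 := eq_neg_of_add_eq_zero_left (e 0)
      have h2 := Submodule.disjoint_def.1 hp.disjoint _ (h0 0) (this ▸ neg_mem (h1 0))
      exact ⟨h2, by rwa [h2, zero_eq_neg] at this⟩
    refine Submodule.mem_sup.2 ⟨⟨fun τ => g₀ (f.1 τ), fun τ hτ =>
        (congrArg g₀ (f.2 τ hτ)).trans z.1⟩,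
      fun τ => h0 _, ⟨fun τ => g₁ (f.1 τ), fun τ hτ =>
        (congrArg g₁ (f.2 τ hτ)).trans z.2⟩,
      fun τ => h1 _, Subtype.ext (funext fun τ => e _)⟩

theorem isInternal_twPart (hp : IsCompl (p 0) (p 1)) : DirectSum.IsInternal (twPart i p) :=
  isInternal_iff.2 (isCompl_twPart hp)

open Classical in
/-- Functions on `P_i` as functions on all permutations. -/
noncomputable def twEquiv (F V : Type*) [Field F] [AddCommGroup V] [Module F V] (i : Fin n → ℕ) :
    ({τ // InP i τ} → V) ≃ₗ[F] twSpace F V i where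
  toFun f := ⟨fun τ => if h : InP i τ then f ⟨τ, h⟩ else 0, fun τ hτ => dif_neg hτ⟩
  invFun g τ := g.1 τ.1
  map_add' f g := by
    refine Subtype.ext (funext fun τ => ?_)
    by_cases h : InP i τ <;> simp [h]
  map_smul' r f := by
    refine Subtype.ext (funext fun τ => ?_)
    by_cases h : InP i τ <;> simp [h]
  left_inv f := by
    funext τ
    simp [τ.2]
  right_inv g := by
    refine Subtype.ext (funext fun τ => ?_)
    by_cases h : InP i τ
    · simp [h]
    · simp [h, g.2 τ h]

open Classical in
/-- The element `z^τ`. -/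
noncomputable def twSingle (τ : {τ // InP i τ}) (z : V) : twSpace F V i :=
  ⟨fun σ => if σ = τ.1 then z else 0, fun σ hσ => if_neg (by rintro rfl; exact hσ τ.2)⟩

open Classical in
theorem twSingle_apply (τ : {τ // InP i τ}) (z : V) (σ : Equiv.Perm (Fin n)) :
    (twSingle (F := F) τ z).1 σ = if σ = τ.1 then z else 0 := rfl

open Classical in
theorem twEquiv_single (τ : {τ // InP i τ}) (z : V) :
    twEquiv F V i (Pi.single τ z) = twSingle τ z := by
  refine Subtype.ext (funext fun σ => ?_)
  change (if h : InP i σ then (Pi.single τ z : {τ // InP i τ} → V) ⟨σ, h⟩ else 0) =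
    if σ = τ.1 then z else 0
  by_cases e : σ = τ.1
  · subst e
    simp [τ.2]
  · rw [if_neg e]
    split_ifs with h
    · have ne : (⟨σ, h⟩ : {τ // InP i τ}) ≠ τ := by
        rintro rfl
        exact e rfl
      exact Pi.single_eq_of_ne (M := fun _ => V) ne z
    · rfl

theorem twSpace_hom_ext {W : Type*} [AddCommGroup W] [Module F W] {A B : twSpace F V i →ₗ[F] W}
    (h : ∀ τ z, A (twSingle τ z) = B (twSingle τ z)) : A = B := by
  classical
  have : A ∘ₗ (twEquiv F V i).toLinearMap = B ∘ₗ (twEquiv F V i).toLinearMap := by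
    refine LinearMap.pi_ext fun τ z => ?_
    have := h τ z
    rw [← twEquiv_single] at this
    exact this
  refine LinearMap.ext fun f => ?_
  have := LinearMap.congr_fun this ((twEquiv F V i).symm f)
  simpa using this

theorem twOp_single (k : Fin n) (τ : {τ // InP i τ}) (z : V) :
    twOp i X k (twSingle τ z) = twSingle τ (X (τ.1⁻¹ k) z) := by
  refine Subtype.ext (funext fun σ => ?_)
  rw [twOp_apply, twSingle_apply, twSingle_apply]
  split_ifs with e
  · rw [e]
  · exact map_zero _

variable [IsAlgClosed F] [CharZero F]

theorem twOpS_single_of_admissible (hi : Alternating i) (k : Fin (n - 1)) (τ : {τ // InP i τ})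
    (z : V) (hk : Admissible (permWord τ.1 i) k) : twOpS X C hi k (twSingle τ z) =
      twSingle τ (xi X C i (τ.1⁻¹ (lo k)) (τ.1⁻¹ (HeckeClifford.hi k)) z) +
        omega F (permWord τ.1 i (lo k)) (permWord τ.1 i (HeckeClifford.hi k)) •
          twSingle ⟨simpleSwap k * τ.1, InP.step τ.1 k τ.2 hk⟩ z := by
  refine Subtype.ext (funext fun σ => ?_)
  rw [twOpS_apply, twSingle_apply, twSingle_apply, Submodule.coe_add, Pi.add_apply,
    Submodule.coe_smul, Pi.smul_apply, twSingle_apply, twSingle_apply]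
  have ne : simpleSwap k * τ.1 ≠ τ.1 := by
    rw [Ne, mul_eq_right]
    intro e
    have := congrArg (fun σ => σ (lo k)) e
    simp only [simpleSwap_lo, Equiv.Perm.one_apply] at this
    exact lo_ne_hi k this.symm
  by_cases e : σ = τ.1
  · subst e
    rw [if_pos rfl, if_neg ne, if_pos rfl, if_neg ne.symm]
    rfl
  · rw [if_neg e, map_zero, zero_add, if_neg e, zero_add]
    by_cases e' : σ = simpleSwap k * τ.1
    · subst e'
      rw [simpleSwap_mul_mul, if_pos rfl, if_pos rfl, simpleSwap_mul_inv_apply,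
        simpleSwap_mul_inv_apply, simpleSwap_lo, simpleSwap_hi, omega_comm]
      rfl
    · rw [if_neg e', if_neg, smul_zero, smul_zero]
      intro e2
      rw [← e2, simpleSwap_mul_mul] at e'
      exact e' rfl

theorem twOpS_single_of_not_admissible (hi : Alternating i) (k : Fin (n - 1))
    (τ : {τ // InP i τ}) (z : V) (hk : ¬ Admissible (permWord τ.1 i) k) :
    twOpS X C hi k (twSingle τ z) =
      twSingle τ (xi X C i (τ.1⁻¹ (lo k)) (τ.1⁻¹ (HeckeClifford.hi k)) z) := by
  have h0 : omega F (i (τ.1⁻¹ (lo k))) (i (τ.1⁻¹ (HeckeClifford.hi k))) = 0 := by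
    rw [omega_eq_zero_iff (hi.inv_ne τ.2 k)]
    rw [Admissible, permWord, permWord] at hk
    omega
  refine Subtype.ext (funext fun σ => ?_)
  rw [twOpS_apply, twSingle_apply, twSingle_apply, twSingle_apply]
  have ne : simpleSwap k * τ.1 ≠ τ.1 := by
    rw [Ne, mul_eq_right]
    intro e
    have := congrArg (fun σ => σ (lo k)) e
    simp only [simpleSwap_lo, Equiv.Perm.one_apply] at this
    exact lo_ne_hi k this.symm
  by_cases e : σ = τ.1
  · subst e
    rw [if_pos rfl, if_neg ne, if_pos rfl, smul_zero, add_zero]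
  · rw [if_neg e, map_zero, zero_add, if_neg e]
    split_ifs with e'
    · have : σ = simpleSwap k * τ.1 := by rw [← e', simpleSwap_mul_mul]
      rw [this, simpleSwap_mul_inv_apply, simpleSwap_mul_inv_apply, simpleSwap_lo, simpleSwap_hi,
        omega_comm, h0, zero_smul]
    · rw [smul_zero]

end TwistParts

/-! ## The modules `L(i)` -/

section Box

variable {F : Type u} [Field F] [IsAlgClosed F] {n : ℕ} {i : Fin n → ℕ}

theorem boxX_apply (k : Fin n) (f : Box F n) (S : Finset (Fin n)) : boxX i k f S =
    (if k ∈ S then -sqrtF (q F (i k)) else sqrtF (q F (i k))) * f S := rfl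

omit [IsAlgClosed F] in
theorem boxC_apply (k : Fin n) (f : Box F n) (S : Finset (Fin n)) :
    boxC k f S = (-1 : F) ^ (S.filter (fun l => l < k)).card * f (symmDiff S {k}) := rfl

omit [IsAlgClosed F] in
-- Toggling k changes the parity of the count exactly when P k holds. For two different indices,
-- toggling the smaller flips the sign attached to the larger and not conversely; hence the c_k
-- anticommute.
theorem card_symmDiff_singleton (S : Finset (Fin n)) (k : Fin n) (P : Fin n → Prop)
    [DecidablePred P] : (-1 : F) ^ ((symmDiff S {k}).filter P).card =
      (if P k then -1 else 1) * (-1 : F) ^ (S.filter P).card := by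
  by_cases h : k ∈ S
  · have e : symmDiff S {k} = S.erase k := by
      ext a
      simp only [Finset.mem_symmDiff, Finset.mem_singleton, Finset.mem_erase]
      by_cases e : a = k <;> simp [e, h]
    rw [e, Finset.filter_erase]
    split_ifs with hP
    · have hk : k ∈ S.filter P := Finset.mem_filter.2 ⟨h, hP⟩
      rw [← Finset.card_erase_add_one hk, pow_succ]
      ring
    · rw [Finset.erase_eq_of_notMem (by simp [hP]), one_mul]
  · have e : symmDiff S {k} = insert k S := by
      ext a
      simp only [Finset.mem_symmDiff, Finset.mem_singleton, Finset.mem_insert]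
      by_cases e : a = k <;> simp [e, h]
    rw [e, Finset.filter_insert]
    split_ifs with hP
    · rw [Finset.card_insert_of_notMem (by simp [h]), pow_succ]
      ring
    · rw [one_mul]

omit [IsAlgClosed F] in
theorem symmDiff_singleton_card (S : Finset (Fin n)) (k : Fin n) :
    ((symmDiff S {k}).card : ZMod 2) = S.card + 1 := by
  by_cases h : k ∈ S
  · have e : symmDiff S {k} = S.erase k := by
      ext a
      simp only [Finset.mem_symmDiff, Finset.mem_singleton, Finset.mem_erase]
      by_cases e : a = k <;> simp [e, h]
    rw [e, ← Finset.card_erase_add_one h, Nat.cast_add, Nat.cast_one, add_assoc,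
      show (1 : ZMod 2) + 1 = 0 from rfl, add_zero]
  · have e : symmDiff S {k} = insert k S := by
      ext a
      simp only [Finset.mem_symmDiff, Finset.mem_singleton, Finset.mem_insert]
      by_cases e : a = k <;> simp [e, h]
    rw [e, Finset.card_insert_of_notMem h, Nat.cast_add, Nat.cast_one]

theorem xcRel_box : XCRel (boxX (F := F) i) boxC where
  xx k l := by
    refine LinearMap.ext fun f => funext fun S => ?_
    simp only [Module.End.mul_apply, boxX_apply]
    ring
  c_sq k := by
    refine LinearMap.ext fun f => funext fun S => ?_
    simp only [Module.End.mul_apply, boxC_apply, card_symmDiff_singleton, lt_irrefl, if_false,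
      symmDiff_symmDiff_cancel_right, Module.End.one_apply]
    rw [one_mul, ← mul_assoc, ← mul_pow, neg_mul_neg, one_mul, one_pow, one_mul]
  cc k l e := by
    refine LinearMap.ext fun f => funext fun S => ?_
    simp only [Module.End.mul_apply, LinearMap.neg_apply, Pi.neg_apply, boxC_apply,
      card_symmDiff_singleton]
    rw [symmDiff_right_comm S {l} {k}]
    rcases lt_or_gt_of_ne e with h | h
    · rw [if_pos h, if_neg (not_lt_of_gt h)]
      ring
    · rw [if_pos h, if_neg (not_lt_of_gt h)]
      ring
  xc_same k := by
    refine LinearMap.ext fun f => funext fun S => ?_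
    simp only [Module.End.mul_apply, LinearMap.neg_apply, Pi.neg_apply, boxC_apply, boxX_apply,
      Finset.mem_symmDiff, Finset.mem_singleton]
    by_cases h : k ∈ S <;> simp [h] <;> ring
  xc k l e := by
    refine LinearMap.ext fun f => funext fun S => ?_
    simp only [Module.End.mul_apply, boxC_apply, boxX_apply, Finset.mem_symmDiff,
      Finset.mem_singleton]
    by_cases h : k ∈ S <;> simp [h, e] <;> ring

omit [IsAlgClosed F] in
theorem isCompl_boxPart : IsCompl (boxPart F n 0) (boxPart F n 1) := by
  constructor
  · rw [Submodule.disjoint_def]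
    intro f h0 h1
    funext S
    rcases zmod_two_cases (S.card : ZMod 2) with e | e
    · exact h1 S (by rw [e]; decide)
    · exact h0 S (by rw [e]; decide)
  · rw [codisjoint_iff, eq_top_iff]
    rintro f -
    refine Submodule.mem_sup.2 ⟨fun S => if (S.card : ZMod 2) = 0 then f S else 0,
      fun S hS => if_neg hS, fun S => if (S.card : ZMod 2) = 0 then 0 else f S, fun S hS => ?_, ?_⟩
    · rcases zmod_two_cases (S.card : ZMod 2) with e | e
      · exact if_pos e
      · exact absurd e hS
    · funext S
      by_cases e : (S.card : ZMod 2) = 0 <;> simp [e]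

theorem isXCSuper_box : IsXCSuper (boxPart F n) (boxX i) boxC where
  x_mem k a f hf S hS := by rw [boxX_apply, hf S hS, mul_zero]
  c_mem k a f hf S hS := by
    rw [boxC_apply, hf _ ?_, mul_zero]
    rw [symmDiff_singleton_card]
    intro e
    apply hS
    rw [← e, add_assoc, show (1 : ZMod 2) + 1 = 0 from rfl, add_zero]

namespace Component

variable (L : Component F i)

/-- The homogeneous parts of `L(i)`. -/
def part (a : ZMod 2) : Submodule F L.space := (boxPart F n a).comap L.space.subtype

theorem isCompl_part : IsCompl (L.part 0) (L.part 1) := by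
  constructor
  · rw [Submodule.disjoint_def]
    exact fun z h0 h1 => Subtype.ext (Submodule.disjoint_def.1 isCompl_boxPart.disjoint z.1 h0 h1)
  · rw [codisjoint_iff, eq_top_iff]
    rintro z -
    obtain ⟨f₀, h0, f₁, h1, m0, m1, e⟩ := L.isSub.graded z.1 z.2
    exact Submodule.mem_sup.2 ⟨⟨f₀, m0⟩, h0, ⟨f₁, m1⟩, h1, Subtype.ext e.symm⟩

theorem isXCSuper : IsXCSuper L.part L.X L.C where
  x_mem k a z hz := isXCSuper_box.x_mem k a z.1 hz
  c_mem k a z hz := (isXCSuper_box (i := i)).c_mem k a z.1 hz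

theorem isWtMod : IsWtMod L.X L.C i where
  xx k l := LinearMap.ext fun z => Subtype.ext (LinearMap.congr_fun (xcRel_box.xx k l) z.1)
  c_sq k := LinearMap.ext fun z =>
    Subtype.ext (LinearMap.congr_fun ((xcRel_box (i := i)).c_sq k) z.1)
  cc k l e := LinearMap.ext fun z =>
    Subtype.ext (LinearMap.congr_fun ((xcRel_box (i := i)).cc k l e) z.1)
  xc_same k := LinearMap.ext fun z => Subtype.ext (LinearMap.congr_fun (xcRel_box.xc_same k) z.1)
  xc k l e := LinearMap.ext fun z => Subtype.ext (LinearMap.congr_fun (xcRel_box.xc k l e) z.1)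
  sq k z := by
    refine Subtype.ext (funext fun S => ?_)
    change boxX i k (boxX i k z.1) S = q F (i k) * z.1 S
    rw [boxX_apply, boxX_apply, ← mul_assoc]
    congr 1
    rw [← sqrtF_sq (q F (i k))]
    split_ifs <;> ring_nf <;> rw [sqrtF_sq]
  nil k hk z := by
    have e : sqrtF (q F (i k)) = 0 := by
      have := sqrtF_sq (q F (i k))
      rw [hk, q_zero] at *
      exact pow_eq_zero_iff two_ne_zero |>.1 this
    refine Subtype.ext (funext fun S => ?_)
    change boxX i k z.1 S = 0
    rw [boxX_apply, e, neg_zero, ite_self, zero_mul]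

end Component

/-- The outer tensor product is finite dimensional, and a nonzero graded submodule of least
dimension is irreducible. -/
theorem nonempty_component (F : Type u) [Field F] [IsAlgClosed F] (i : Fin n → ℕ) :
    Nonempty (Component F i) := by
  have hex : ∃ d : ℕ, ∃ N : Submodule F (Box F n), IsBoxSubmodule i N ∧ N ≠ ⊥ ∧
      Module.finrank F N = d := by
    refine ⟨_, ⊤, ⟨fun _ _ _ => trivial, fun _ _ _ => trivial, fun f _ => ?_⟩, top_ne_bot, rfl⟩
    obtain ⟨f₀, h0, f₁, h1, e⟩ := Submodule.mem_sup.1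
      ((isCompl_boxPart (F := F) (n := n)).sup_eq_top ▸ Submodule.mem_top (x := f))
    exact ⟨f₀, h0, f₁, h1, trivial, trivial, e.symm⟩
  classical
  obtain ⟨N, hN, hne, hd⟩ := Nat.find_spec hex
  refine ⟨⟨N, hN, hne, fun N' hN' hle => ?_⟩⟩
  by_cases h0 : N' = ⊥
  · exact Or.inl h0
  · refine Or.inr (Submodule.eq_of_le_of_finrank_le hle ?_)
    rw [hd]
    exact Nat.find_min' hex ⟨N', hN', h0, rfl⟩

end Box

/-! ### The defining formulas of D^i in terms of operators, and its existence -/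

section Affords

variable {F : Type u} [Field F] [IsAlgClosed F] [CharZero F] {n : ℕ} {i : Fin n → ℕ}

/-- A linear bijection carrying the operators of `D^i` to those of `D`. -/
structure IsModel (hi : Alternating i) (L : Component F i) (D : Mod.{u, v} F n)
    (e : twSpace F L.space i ≃ₗ[F] D.carrier) : Prop where
  part : ∀ a, ∀ f ∈ twPart i L.part a, e f ∈ D.part a
  x : ∀ k f, xOp D k (e f) = e (twOp i L.X k f)
  c : ∀ k f, cOp D k (e f) = e (twOp i L.C k f)
  s : ∀ k f, sOp D k (e f) = e (twOpS L.X L.C hi k f)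

/-- The vectors z^τ span, so the formulas for them, with their case distinction, are equivalent to
identities between operators on functions. -/
theorem affords_iff (hi : Alternating i) (L : Component F i) (D : Mod.{u, v} F n) :
    Affords L D ↔ ∃ e, IsModel hi L D e := by
  classical
  constructor
  · rintro ⟨e, hpart, hx, hc, hs1, hs2⟩
    have tw : ∀ τ z, e (twisted L τ z) = ((twEquiv F L.space i).symm.trans e) (twSingle τ z) := by
      intro τ z
      rw [← twEquiv_single, LinearEquiv.trans_apply, LinearEquiv.symm_apply_apply, twisted]
    set e' := (twEquiv F L.space i).symm.trans e with he'
    refine ⟨e', fun a f hf => ?_, fun k f => ?_, fun k f => ?_, fun k f => ?_⟩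
    · have : e' f = e ((twEquiv F L.space i).symm f) := rfl
      rw [this, ← Finset.univ_sum_single ((twEquiv F L.space i).symm f), map_sum]
      exact Submodule.sum_mem _ fun τ _ => hpart a τ _ (hf τ.1)
    · refine LinearMap.congr_fun (f := xOp D k ∘ₗ e'.toLinearMap)
        (g := e'.toLinearMap ∘ₗ twOp i L.X k) (twSpace_hom_ext fun τ z => ?_) f
      have := hx k τ z
      rw [tw, tw] at this
      rw [LinearMap.comp_apply, LinearMap.comp_apply, twOp_single]
      exact this
    · refine LinearMap.congr_fun (f := cOp D k ∘ₗ e'.toLinearMap)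
        (g := e'.toLinearMap ∘ₗ twOp i L.C k) (twSpace_hom_ext fun τ z => ?_) f
      have := hc k τ z
      rw [tw, tw] at this
      rw [LinearMap.comp_apply, LinearMap.comp_apply, twOp_single]
      exact this
    · refine LinearMap.congr_fun (f := sOp D k ∘ₗ e'.toLinearMap)
        (g := e'.toLinearMap ∘ₗ twOpS L.X L.C hi k) (twSpace_hom_ext fun τ z => ?_) f
      rw [LinearMap.comp_apply, LinearMap.comp_apply]
      by_cases hk : Admissible (permWord τ.1 i) k
      · have := hs1 k τ z hk
        rw [tw, tw, tw] at this
        rw [twOpS_single_of_admissible hi k τ z hk, map_add, map_smul]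
        exact this
      · have := hs2 k τ z hk
        rw [tw, tw] at this
        rw [twOpS_single_of_not_admissible hi k τ z hk]
        exact this
  · rintro ⟨e, he⟩
    have tw : ∀ τ z, ((twEquiv F L.space i).trans e) (twisted L τ z) = e (twSingle τ z) := by
      intro τ z
      rw [← twEquiv_single, LinearEquiv.trans_apply, twisted]
    refine ⟨(twEquiv F L.space i).trans e, fun a τ z hz => ?_, fun k τ z => ?_, fun k τ z => ?_,
      fun k τ z hk => ?_, fun k τ z hk => ?_⟩
    · rw [tw]
      refine he.part a _ fun σ => ?_
      rw [twSingle_apply]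
      split_ifs
      · exact hz
      · exact zero_mem _
    · rw [tw, tw, ← twOp_single]
      exact he.x k _
    · rw [tw, tw, ← twOp_single]
      exact he.c k _
    · rw [tw, tw, tw, ← LinearEquiv.map_smul, ← LinearEquiv.map_add]
      exact (he.s k _).trans (congrArg e (twOpS_single_of_admissible hi k τ z hk))
    · rw [tw, tw]
      exact (he.s k _).trans (congrArg e (twOpS_single_of_not_admissible hi k τ z hk))

/-- The module `D^i`. -/
noncomputable def twMod (hi : Alternating i) (L : Component F i) : Mod.{u, u} F n :=
  modOfOp (hcRel_twOp L.isWtMod hi) _ (isSuper_twOp L.isXCSuper hi)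
    (isInternal_twPart L.isCompl_part)

theorem exists_affords (hi : Alternating i) (L : Component F i) :
    ∃ D : Mod.{u, u} F n, Affords L D := by
  refine ⟨twMod hi L, (affords_iff hi L _).2 ⟨LinearEquiv.refl F (twSpace F L.space i), ?_⟩⟩
  exact ⟨fun a f hf => hf, fun k f => LinearMap.congr_fun (xOp_modOfOp ..) f,
    fun k f => LinearMap.congr_fun (cOp_modOfOp ..) f,
    fun k f => LinearMap.congr_fun (sOp_modOfOp ..) f⟩

end Affords

/-! ## Completely splittable modules with a common weight -/

section Irreducible

variable {F : Type*} [Field F] {V : Type*} [AddCommGroup V] [Module F V]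
  {V' : Type*} [AddCommGroup V'] [Module F V'] {n : ℕ}

/-- Subspaces stable under operators `s_k`, `x_k`, `c_k`. -/
structure Stable (s : Fin (n - 1) → Module.End F V) (x c : Fin n → Module.End F V)
    (N : Submodule F V) : Prop where
  s_mem : ∀ k, ∀ m ∈ N, s k m ∈ N
  x_mem : ∀ k, ∀ m ∈ N, x k m ∈ N
  c_mem : ∀ k, ∀ m ∈ N, c k m ∈ N

/-- Completely splittable graded modules, in terms of operators. -/
structure IsCSMod (p : ZMod 2 → Submodule F V) (s : Fin (n - 1) → Module.End F V)
    (x c : Fin n → Module.End F V) : Prop where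
  rel : HCRel s x c
  parity : IsSuper p s x c
  compl : IsCompl (p 0) (p 1)
  cs : IsCS x

/-- Irreducibility, in terms of operators. -/
structure IsIrr (p : ZMod 2 → Submodule F V) (s : Fin (n - 1) → Module.End F V)
    (x c : Fin n → Module.End F V) : Prop where
  nontrivial : Nontrivial V
  eq_bot_or_eq_top : ∀ N : Submodule F V, IsGr p N → Stable s x c N → N = ⊥ ∨ N = ⊤

/-- Linear maps commuting with the operators. -/
structure Intertwines (s : Fin (n - 1) → Module.End F V) (x c : Fin n → Module.End F V)
    (s' : Fin (n - 1) → Module.End F V') (x' c' : Fin n → Module.End F V') (f : V →ₗ[F] V') :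
    Prop where
  map_s : ∀ k m, f (s k m) = s' k (f m)
  map_x : ∀ k m, f (x k m) = x' k (f m)
  map_c : ∀ k m, f (c k m) = c' k (f m)

/-- Linear maps of parity `a`. -/
def Shifts (p : ZMod 2 → Submodule F V) (p' : ZMod 2 → Submodule F V') (a : ZMod 2)
    (f : V →ₗ[F] V') : Prop :=
  ∀ b, ∀ m ∈ p b, f m ∈ p' (b + a)

variable {p : ZMod 2 → Submodule F V} {s : Fin (n - 1) → Module.End F V}
  {x c : Fin n → Module.End F V} {p' : ZMod 2 → Submodule F V'}
  {s' : Fin (n - 1) → Module.End F V'} {x' c' : Fin n → Module.End F V'}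

theorem zmod_two_add_self (a : ZMod 2) : a + a = 0 := by
  revert a
  decide

theorem disjoint_part (hp : Disjoint (p 0) (p 1)) (a : ZMod 2) : Disjoint (p a) (p (a + 1)) := by
  rcases zmod_two_cases a with rfl | rfl
  · exact hp
  · exact hp.symm

theorem exists_decomposition (hp : IsCompl (p 0) (p 1)) (m : V) :
    ∃ m₀ ∈ p 0, ∃ m₁ ∈ p 1, m = m₀ + m₁ := by
  obtain ⟨m₀, h0, m₁, h1, e⟩ := Submodule.mem_sup.1 (hp.sup_eq_top ▸ Submodule.mem_top (x := m))
  exact ⟨m₀, h0, m₁, h1, e.symm⟩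

theorem Shifts.eq_zero {a : ZMod 2} {f : V →ₗ[F] V'} (hf : Shifts p p' a f)
    (hp' : Disjoint (p' 0) (p' 1)) {m₀ m₁ : V} (h0 : m₀ ∈ p 0) (h1 : m₁ ∈ p 1)
    (e : f (m₀ + m₁) = 0) : f m₀ = 0 ∧ f m₁ = 0 := by
  rw [map_add] at e
  have e1 : f m₀ = 0 := by
    refine Submodule.disjoint_def.1 (disjoint_part hp' a) _ ?_ ?_
    · simpa using hf 0 _ h0
    · rw [eq_neg_of_add_eq_zero_left e, add_comm]
      exact neg_mem (hf 1 _ h1)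
  exact ⟨e1, by rwa [e1, zero_add] at e⟩

theorem Shifts.isGr_ker {a : ZMod 2} {f : V →ₗ[F] V'} (hf : Shifts p p' a f)
    (hp : IsCompl (p 0) (p 1)) (hp' : Disjoint (p' 0) (p' 1)) : IsGr p (LinearMap.ker f) := by
  intro m hm
  obtain ⟨m₀, h0, m₁, h1, rfl⟩ := exists_decomposition hp m
  obtain ⟨e0, e1⟩ := hf.eq_zero hp' h0 h1 hm
  exact ⟨m₀, h0, m₁, h1, e0, e1, rfl⟩

theorem Intertwines.stable_ker {f : V →ₗ[F] V'} (hf : Intertwines s x c s' x' c' f) :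
    Stable s x c (LinearMap.ker f) where
  s_mem k m hm := by rw [LinearMap.mem_ker] at *; rw [hf.map_s, hm, map_zero]
  x_mem k m hm := by rw [LinearMap.mem_ker] at *; rw [hf.map_x, hm, map_zero]
  c_mem k m hm := by rw [LinearMap.mem_ker] at *; rw [hf.map_c, hm, map_zero]

theorem Intertwines.stable_map {f : V →ₗ[F] V'} (hf : Intertwines s x c s' x' c' f)
    {N : Submodule F V} (hN : Stable s x c N) : Stable s' x' c' (N.map f) where
  s_mem k m hm := by
    obtain ⟨m, hm, rfl⟩ := hm
    exact ⟨_, hN.s_mem k m hm, hf.map_s k m⟩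
  x_mem k m hm := by
    obtain ⟨m, hm, rfl⟩ := hm
    exact ⟨_, hN.x_mem k m hm, hf.map_x k m⟩
  c_mem k m hm := by
    obtain ⟨m, hm, rfl⟩ := hm
    exact ⟨_, hN.c_mem k m hm, hf.map_c k m⟩

theorem Intertwines.stable_comap {f : V →ₗ[F] V'} (hf : Intertwines s x c s' x' c' f)
    {N : Submodule F V'} (hN : Stable s' x' c' N) : Stable s x c (N.comap f) where
  s_mem k m hm := by rw [Submodule.mem_comap, hf.map_s]; exact hN.s_mem k _ hm
  x_mem k m hm := by rw [Submodule.mem_comap, hf.map_x]; exact hN.x_mem k _ hm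
  c_mem k m hm := by rw [Submodule.mem_comap, hf.map_c]; exact hN.c_mem k _ hm

theorem Intertwines.map_wt {f : V →ₗ[F] V'} (hf : Intertwines s x c s' x' c' f) {j : Fin n → ℕ}
    {m : V} (hm : m ∈ wt x j) : f m ∈ wt x' j := by
  rw [mem_wt] at *
  intro k
  rw [← hf.map_x, ← hf.map_x, hm, map_smul]

/-- The operators x_k² − q(j_k) are even, so their common kernel is graded. -/
theorem isGr_wt (hp : IsXCSuper p x c) (hc : IsCompl (p 0) (p 1)) (j : Fin n → ℕ) :
    IsGr p (wt x j) := by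
  intro m hm
  obtain ⟨m₀, h0, m₁, h1, rfl⟩ := exists_decomposition hc m
  rw [mem_wt] at hm
  have key : ∀ k, (x k * x k - q F (j k) • 1 : Module.End F V) m₀ = 0 ∧
      (x k * x k - q F (j k) • 1 : Module.End F V) m₁ = 0 := by
    intro k
    have hs : Shifts p p 0 (x k * x k - q F (j k) • 1 : Module.End F V) := by
      intro b m hm
      rw [add_zero]
      exact sub_mem (hp.x_mem _ _ _ (hp.x_mem _ _ _ hm)) (Submodule.smul_mem _ _ hm)
    refine hs.eq_zero hc.disjoint h0 h1 ?_
    simp [hm k, -map_add]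
  simp only [LinearMap.sub_apply, Module.End.mul_apply, LinearMap.smul_apply,
    Module.End.one_apply, sub_eq_zero] at key
  exact ⟨m₀, h0, m₁, h1, mem_wt.2 fun k => (key k).1, mem_wt.2 fun k => (key k).2, rfl⟩

theorem IsCSMod.nil_of_wt (M : IsCSMod p s x c) {j : Fin n → ℕ} {k : Fin n} (hk : j k = 0) {m : V}
    (hm : m ∈ wt x j) : x k m = 0 := by
  apply M.cs.nil
  rw [mem_wt.1 hm, hk, q_zero, zero_smul]

theorem IsIrr.eq_top (h : IsIrr p s x c) {N : Submodule F V} (hg : IsGr p N)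
    (hN : Stable s x c N) {v : V} (hv : v ∈ N) (hv0 : v ≠ 0) : N = ⊤ := by
  refine (h.eq_bot_or_eq_top N hg hN).resolve_left ?_
  rintro rfl
  exact hv0 ((Submodule.mem_bot F).1 hv)

section Product

/-- The product of two families of submodules. -/
def prodPart (p : ZMod 2 → Submodule F V) (p' : ZMod 2 → Submodule F V') (a : ZMod 2) :
    Submodule F (V × V') :=
  (p a).prod (p' a)

theorem HCRel.prodMap (h : HCRel s x c) (h' : HCRel s' x' c') :
    HCRel (fun k => (s k).prodMap (s' k)) (fun k => (x k).prodMap (x' k))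
      (fun k => (c k).prodMap (c' k)) where
  xx k l := LinearMap.ext fun m =>
    Prod.ext (LinearMap.congr_fun (h.xx k l) m.1) (LinearMap.congr_fun (h'.xx k l) m.2)
  c_sq k := LinearMap.ext fun m =>
    Prod.ext (LinearMap.congr_fun (h.c_sq k) m.1) (LinearMap.congr_fun (h'.c_sq k) m.2)
  cc k l e := LinearMap.ext fun m =>
    Prod.ext (LinearMap.congr_fun (h.cc k l e) m.1) (LinearMap.congr_fun (h'.cc k l e) m.2)
  xc_same k := LinearMap.ext fun m =>
    Prod.ext (LinearMap.congr_fun (h.xc_same k) m.1) (LinearMap.congr_fun (h'.xc_same k) m.2)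
  xc k l e := LinearMap.ext fun m =>
    Prod.ext (LinearMap.congr_fun (h.xc k l e) m.1) (LinearMap.congr_fun (h'.xc k l e) m.2)
  s_sq k := LinearMap.ext fun m =>
    Prod.ext (LinearMap.congr_fun (h.s_sq k) m.1) (LinearMap.congr_fun (h'.s_sq k) m.2)
  s_comm k l e := LinearMap.ext fun m =>
    Prod.ext (LinearMap.congr_fun (h.s_comm k l e) m.1) (LinearMap.congr_fun (h'.s_comm k l e) m.2)
  braid k l e := LinearMap.ext fun m =>
    Prod.ext (LinearMap.congr_fun (h.braid k l e) m.1) (LinearMap.congr_fun (h'.braid k l e) m.2)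
  s_x k := LinearMap.ext fun m =>
    Prod.ext (LinearMap.congr_fun (h.s_x k) m.1) (LinearMap.congr_fun (h'.s_x k) m.2)
  s_x_far k l h₁ h₂ := LinearMap.ext fun m => Prod.ext
    (LinearMap.congr_fun (h.s_x_far k l h₁ h₂) m.1) (LinearMap.congr_fun (h'.s_x_far k l h₁ h₂) m.2)
  s_c_lo k := LinearMap.ext fun m =>
    Prod.ext (LinearMap.congr_fun (h.s_c_lo k) m.1) (LinearMap.congr_fun (h'.s_c_lo k) m.2)
  s_c_hi k := LinearMap.ext fun m =>
    Prod.ext (LinearMap.congr_fun (h.s_c_hi k) m.1) (LinearMap.congr_fun (h'.s_c_hi k) m.2)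
  s_c_far k l h₁ h₂ := LinearMap.ext fun m => Prod.ext
    (LinearMap.congr_fun (h.s_c_far k l h₁ h₂) m.1) (LinearMap.congr_fun (h'.s_c_far k l h₁ h₂) m.2)

theorem mem_wt_prodMap {j : Fin n → ℕ} {m : V × V'} :
    m ∈ wt (fun k => (x k).prodMap (x' k)) j ↔ m.1 ∈ wt x j ∧ m.2 ∈ wt x' j := by
  simp only [mem_wt, LinearMap.prodMap_apply, Prod.ext_iff, Prod.smul_fst, Prod.smul_snd,
    forall_and]

theorem IsCS.prodMap (h : IsCS x) (h' : IsCS x') : IsCS (fun k => (x k).prodMap (x' k)) where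
  span := by
    rw [eq_top_iff]
    rintro ⟨m, m'⟩ -
    have e : (m, m') = (m, 0) + (0, m') := by simp
    rw [e]
    refine add_mem ?_ ?_
    · induction m using h.induction with
      | mem j m hm =>
        exact Submodule.mem_iSup_of_mem j (mem_wt_prodMap.2 ⟨hm, zero_mem _⟩)
      | zero => exact zero_mem _
      | add a b ha hb =>
        have e : (a + b, (0 : V')) = (a, 0) + (b, 0) := by simp
        rw [e]
        exact add_mem (ha (by simp)) (hb (by simp))
    · induction m' using h'.induction with
      | mem j m hm =>
        exact Submodule.mem_iSup_of_mem j (mem_wt_prodMap.2 ⟨zero_mem _, hm⟩)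
      | zero => exact zero_mem _
      | add a b ha hb =>
        have e : ((0 : V), a + b) = (0, a) + (0, b) := by simp
        rw [e]
        exact add_mem (ha (by simp)) (hb (by simp))
  nil k m hm := Prod.ext (h.nil k m.1 (congrArg Prod.fst hm)) (h'.nil k m.2 (congrArg Prod.snd hm))

theorem IsCSMod.prodMap (M : IsCSMod p s x c) (M' : IsCSMod p' s' x' c') :
    IsCSMod (prodPart p p') (fun k => (s k).prodMap (s' k)) (fun k => (x k).prodMap (x' k))
      (fun k => (c k).prodMap (c' k)) where
  rel := M.rel.prodMap M'.rel
  cs := M.cs.prodMap M'.cs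
  parity :=
    { s_mem := fun k a m hm => ⟨M.parity.s_mem k a _ hm.1, M'.parity.s_mem k a _ hm.2⟩
      x_mem := fun k a m hm => ⟨M.parity.x_mem k a _ hm.1, M'.parity.x_mem k a _ hm.2⟩
      c_mem := fun k a m hm => ⟨M.parity.c_mem k a _ hm.1, M'.parity.c_mem k a _ hm.2⟩ }
  compl := by
    constructor
    · rw [Submodule.disjoint_def]
      exact fun m h0 h1 => Prod.ext (Submodule.disjoint_def.1 M.compl.disjoint _ h0.1 h1.1)
        (Submodule.disjoint_def.1 M'.compl.disjoint _ h0.2 h1.2)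
    · rw [codisjoint_iff, eq_top_iff]
      rintro ⟨m, m'⟩ -
      obtain ⟨m₀, h0, m₁, h1, rfl⟩ := exists_decomposition M.compl m
      obtain ⟨m₀', h0', m₁', h1', rfl⟩ := exists_decomposition M'.compl m'
      exact Submodule.mem_sup.2 ⟨(m₀, m₀'), ⟨h0, h0'⟩, (m₁, m₁'), ⟨h1, h1'⟩, rfl⟩

theorem intertwines_inl : Intertwines s x c (fun k => (s k).prodMap (s' k))
    (fun k => (x k).prodMap (x' k)) (fun k => (c k).prodMap (c' k)) (LinearMap.inl F V V') := by
  constructor <;> simp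

theorem intertwines_inr : Intertwines s' x' c' (fun k => (s k).prodMap (s' k))
    (fun k => (x k).prodMap (x' k)) (fun k => (c k).prodMap (c' k)) (LinearMap.inr F V V') := by
  constructor <;> simp

theorem intertwines_fst : Intertwines (fun k => (s k).prodMap (s' k))
    (fun k => (x k).prodMap (x' k)) (fun k => (c k).prodMap (c' k)) s x c (LinearMap.fst F V V') := by
  constructor <;> simp

theorem intertwines_snd : Intertwines (fun k => (s k).prodMap (s' k))
    (fun k => (x k).prodMap (x' k)) (fun k => (c k).prodMap (c' k)) s' x' c'
    (LinearMap.snd F V V') := by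
  constructor <;> simp

theorem isGr_comap_inl {N : Submodule F (V × V')} (hN : IsGr (prodPart p p') N)
    (hp' : Disjoint (p' 0) (p' 1)) : IsGr p (N.comap (LinearMap.inl F V V')) := by
  intro m hm
  obtain ⟨m₀, h0, m₁, h1, n0, n1, e⟩ := hN _ hm
  have e1 : m = m₀.1 + m₁.1 := congrArg Prod.fst e
  have e2 : 0 = m₀.2 + m₁.2 := congrArg Prod.snd e
  have z0 : m₀.2 = 0 := Submodule.disjoint_def.1 hp' _ h0.2 (by
    rw [eq_neg_of_add_eq_zero_left e2.symm]
    exact neg_mem h1.2)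
  have z1 : m₁.2 = 0 := by rw [z0, zero_add] at e2; exact e2.symm
  refine ⟨m₀.1, h0.1, m₁.1, h1.1, ?_, ?_, e1⟩
  · have : LinearMap.inl F V V' m₀.1 = m₀ := Prod.ext rfl z0.symm
    rwa [Submodule.mem_comap, this]
  · have : LinearMap.inl F V V' m₁.1 = m₁ := Prod.ext rfl z1.symm
    rwa [Submodule.mem_comap, this]

theorem isGr_comap_inr {N : Submodule F (V × V')} (hN : IsGr (prodPart p p') N)
    (hp : Disjoint (p 0) (p 1)) : IsGr p' (N.comap (LinearMap.inr F V V')) := by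
  intro m hm
  obtain ⟨m₀, h0, m₁, h1, n0, n1, e⟩ := hN _ hm
  have e1 : m = m₀.2 + m₁.2 := congrArg Prod.snd e
  have e2 : 0 = m₀.1 + m₁.1 := congrArg Prod.fst e
  have z0 : m₀.1 = 0 := Submodule.disjoint_def.1 hp _ h0.1 (by
    rw [eq_neg_of_add_eq_zero_left e2.symm]
    exact neg_mem h1.1)
  have z1 : m₁.1 = 0 := by rw [z0, zero_add] at e2; exact e2.symm
  refine ⟨m₀.2, h0.2, m₁.2, h1.2, ?_, ?_, e1⟩
  · have : LinearMap.inr F V V' m₀.2 = m₀ := Prod.ext z0.symm rfl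
    rwa [Submodule.mem_comap, this]
  · have : LinearMap.inr F V V' m₁.2 = m₁ := Prod.ext z1.symm rfl
    rwa [Submodule.mem_comap, this]

/-- A graded stable subspace of the product of two irreducible modules meeting both factors
trivially is the graph of an isomorphism. -/
theorem exists_equiv_of_graph (hc : IsCompl (p 0) (p 1)) (hi : IsIrr p s x c)
    (hi' : IsIrr p' s' x' c') {N : Submodule F (V × V')} (hN : IsGr (prodPart p p') N)
    (hs : Stable (fun k => (s k).prodMap (s' k)) (fun k => (x k).prodMap (x' k))
      (fun k => (c k).prodMap (c' k)) N)
    (h1 : N.comap (LinearMap.inl F V V') = ⊥) (h2 : N.comap (LinearMap.inr F V V') = ⊥)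
    {v : V} {v' : V'} (hv : (v, v') ∈ N) (hv0 : v ≠ 0) (hv0' : v' ≠ 0) :
    ∃ f : V ≃ₗ[F] V', Intertwines s x c s' x' c' f.toLinearMap ∧
      Shifts p p' 0 f.toLinearMap := by
  have inj1 : ∀ m ∈ N, m.1 = 0 → m = 0 := by
    intro m hm e
    have : m.2 ∈ N.comap (LinearMap.inr F V V') := by
      have : LinearMap.inr F V V' m.2 = m := Prod.ext e.symm rfl
      rwa [Submodule.mem_comap, this]
    rw [h2] at this
    exact Prod.ext e this
  have inj2 : ∀ m ∈ N, m.2 = 0 → m = 0 := by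
    intro m hm e
    have : m.1 ∈ N.comap (LinearMap.inl F V V') := by
      have : LinearMap.inl F V V' m.1 = m := Prod.ext rfl e.symm
      rwa [Submodule.mem_comap, this]
    rw [h1] at this
    exact Prod.ext this e
  have top1 : N.map (LinearMap.fst F V V') = ⊤ :=
    hi.eq_top (hN.map _ 0 fun a m hm => by rw [add_zero]; exact hm.1)
      (intertwines_fst.stable_map hs) ⟨_, hv, rfl⟩ hv0
  have top2 : N.map (LinearMap.snd F V V') = ⊤ :=
    hi'.eq_top (hN.map _ 0 fun a m hm => by rw [add_zero]; exact hm.2)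
      (intertwines_snd.stable_map hs) ⟨_, hv, rfl⟩ hv0'
  let e1 : N ≃ₗ[F] V := LinearEquiv.ofBijective (LinearMap.fst F V V' ∘ₗ N.subtype) ⟨by
    rw [injective_iff_map_eq_zero]
    exact fun m e => Subtype.ext (inj1 m.1 m.2 e), fun m => by
    obtain ⟨y, hy, e⟩ := (top1 ▸ Submodule.mem_top : m ∈ N.map (LinearMap.fst F V V'))
    exact ⟨⟨y, hy⟩, e⟩⟩
  let e2 : N ≃ₗ[F] V' := LinearEquiv.ofBijective (LinearMap.snd F V V' ∘ₗ N.subtype) ⟨by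
    rw [injective_iff_map_eq_zero]
    exact fun m e => Subtype.ext (inj2 m.1 m.2 e), fun m => by
    obtain ⟨y, hy, e⟩ := (top2 ▸ Submodule.mem_top : m ∈ N.map (LinearMap.snd F V V'))
    exact ⟨⟨y, hy⟩, e⟩⟩
  have he : ∀ y : N, (e1.symm.trans e2) y.1.1 = y.1.2 := by
    intro y
    have : e1 y = y.1.1 := rfl
    rw [← this, LinearEquiv.trans_apply, LinearEquiv.symm_apply_apply]
    rfl
  have hmem : ∀ m : V, (m, (e1.symm.trans e2) m) ∈ N := by
    intro m
    have h : e1 (e1.symm m) = m := e1.apply_symm_apply m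
    have : (m, (e1.symm.trans e2) m) = (e1.symm m).1 := Prod.ext h.symm rfl
    rw [this]
    exact (e1.symm m).2
  refine ⟨e1.symm.trans e2, ⟨fun k m => ?_, fun k m => ?_, fun k m => ?_⟩, fun b m hm => ?_⟩
  · exact he ⟨_, hs.s_mem k _ (hmem m)⟩
  · exact he ⟨_, hs.x_mem k _ (hmem m)⟩
  · exact he ⟨_, hs.c_mem k _ (hmem m)⟩
  · obtain ⟨m₀, h0, m₁, h1, n0, n1, e⟩ := hN _ (hmem m)
    have e1 : m = m₀.1 + m₁.1 := congrArg Prod.fst e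
    have e2 := congrArg Prod.snd e
    change _ = m₀.2 + m₁.2 at e2
    rw [add_zero, LinearEquiv.coe_coe]
    simp only at e2
    rw [e2]
    -- For m of parity b, the part of (m, f m) of the other parity has first component 0, hence
    -- vanishes by injectivity of the first projection; so f m has parity b.
    rcases zmod_two_cases b with rfl | rfl
    · have : m₁ = 0 := inj1 m₁ n1 (Submodule.disjoint_def.1 hc.disjoint _
        (by rw [← sub_eq_iff_eq_add'.2 e1]; exact sub_mem hm h0.1) h1.1)
      rw [this, Prod.snd_zero, add_zero]
      exact h0.2
    · have : m₀ = 0 := inj1 m₀ n0 (Submodule.disjoint_def.1 hc.disjoint _ h0.1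
        (by rw [← sub_eq_iff_eq_add.2 e1]; exact sub_mem hm h1.1))
      rw [this, Prod.snd_zero, zero_add]
      exact h1.2

end Product

end Irreducible

/-! ### Uniqueness of the irreducible module with a given weight; Schur's lemma -/

section CommonWeight

variable {F : Type*} [Field F] [IsAlgClosed F] [CharZero F] {V : Type*} [AddCommGroup V]
  [Module F V] {V' : Type*} [AddCommGroup V'] [Module F V'] {n : ℕ}
  {p : ZMod 2 → Submodule F V} {s : Fin (n - 1) → Module.End F V}
  {x c : Fin n → Module.End F V} {p' : ZMod 2 → Submodule F V'}
  {s' : Fin (n - 1) → Module.End F V'} {x' c' : Fin n → Module.End F V'}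

/-- A nonzero homogeneous vacuum vector of weight `i`. -/
structure IsVacuum (p : ZMod 2 → Submodule F V) (x c : Fin n → Module.End F V) {i : Fin n → ℕ}
    (P : Pairing (zeros i)) (b : ZMod 2) (v : V) : Prop where
  wt : v ∈ wt x i
  ne_zero : v ≠ 0
  vac : P.IsVac x c v
  parity : v ∈ p b

variable {i : Fin n → ℕ} {P : Pairing (zeros i)}

theorem IsCSMod.exists_vacuum (M : IsCSMod p s x c) (P : Pairing (zeros i)) (hi : wt x i ≠ ⊥) :
    ∃ b v, IsVacuum p x c P b v := by
  obtain ⟨v, h1, h2, h3, b, h4⟩ := P.exists_vac M.rel.toXCRel M.parity.toIsXCSuper le_rfl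
    (fun k m hm => M.rel.map_wt_x hm k) (fun k m hm => M.rel.map_wt_c hm k)
    (isGr_wt M.parity.toIsXCSuper M.compl i) hi
  exact ⟨b, v, h1, h2, h3, h4⟩

omit [IsAlgClosed F] [CharZero F] in
theorem Pairing.exists_smul_of_mem_vacSpace (hp : IsXCSuper p x c) (hc : Disjoint (p 0) (p 1))
    (P : Pairing (zeros i)) {b : ZMod 2} {v m : V} (hv : v ∈ p b) (hm : m ∈ P.vacSpace c v)
    (hmb : m ∈ p b) : ∃ α : F, m = α • v := by
  obtain ⟨y, hy, z, hz, rfl⟩ := Submodule.mem_sup.1 hm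
  obtain ⟨α, rfl⟩ := Submodule.mem_span_singleton.1 hy
  have hz' : z ∈ p (b + 1) := by
    have : ⨆ r ∈ P.R, Submodule.span F {c r v} ≤ p (b + 1) :=
      iSup₂_le fun r _ => by simpa using hp.c_mem r b v hv
    exact this hz
  have : z = 0 := Submodule.disjoint_def.1 (disjoint_part hc b) z
    ((Submodule.add_mem_iff_right _ (Submodule.smul_mem _ α hv)).1 hmb) hz'
  exact ⟨α, by rw [this, add_zero]⟩

/-- The stable subspace generated by a vacuum vector. -/
theorem IsCSMod.exists_submodule (M : IsCSMod p s x c) {b : ZMod 2} {v : V} (hv : v ∈ wt x i)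
    (hvac : P.IsVac x c v) (hb : v ∈ p b) : ∃ N : Submodule F V, IsGr p N ∧ Stable s x c N ∧
      P.gen c v ≤ N ∧ N ⊓ wt x i ≤ P.gen c v := by
  have h := M.rel.toXCRel
  have hle : P.gen c v ≤ wt x i := P.gen_le hv fun k m hm => M.rel.map_wt_c hm k
  obtain ⟨h1, h2, h3, h4, h5⟩ := M.rel.exists_generated M.cs hle
    (P.gen_x_stable h hvac hv fun k hk m hm => M.nil_of_wt hk hm) (P.gen_c_stable h hvac) rfl
  exact ⟨_, M.parity.isGr_generated M.rel M.cs (P.gen_isGr M.parity.toIsXCSuper hb),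
    ⟨h2, h3, h4⟩, h1, h5⟩

/-- The submodule generated by v is the whole module, and it meets the weight space only in the
x,c-module generated by v. -/
theorem IsIrr.wt_eq_gen (hi : IsIrr p s x c) (M : IsCSMod p s x c) {b : ZMod 2} {v : V}
    (hv : IsVacuum p x c P b v) : wt x i = P.gen c v := by
  obtain ⟨N, hg, hs, hle, hN⟩ := M.exists_submodule hv.wt hv.vac hv.parity
  have : N = ⊤ := hi.eq_top hg hs (hle (P.mem_gen v)) hv.ne_zero
  rw [this, top_inf_eq] at hN
  exact le_antisymm hN (P.gen_le hv.wt fun k m hm => M.rel.map_wt_c hm k)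

/-- Let N be the submodule of the product generated by (v, v'). By multiplicity one its vacuum
vectors of this weight and parity are the multiples of (v, v'). So N contains neither (v, 0) nor (0,
v'), and by irreducibility it meets both factors in zero. -/
theorem exists_equiv_of_vacuum_even (M : IsCSMod p s x c) (M' : IsCSMod p' s' x' c')
    (hi : IsIrr p s x c) (hi' : IsIrr p' s' x' c') {b : ZMod 2} {v : V} {v' : V'}
    (hv : IsVacuum p x c P b v) (hv' : IsVacuum p' x' c' P b v') :
    ∃ f : V ≃ₗ[F] V', Intertwines s x c s' x' c' f.toLinearMap ∧
      Shifts p p' 0 f.toLinearMap := by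
  set W := M.prodMap M' with hW
  have hinv : ∀ t m, P.inv (fun k => (x k).prodMap (x' k)) (fun k => (c k).prodMap (c' k)) t m =
      (P.inv x c t m.1, P.inv x' c' t m.2) := by
    intro t m
    simp only [Pairing.inv]
    split_ifs <;> rfl
  have vacW : ∀ m : V × V', P.IsVac x c m.1 → P.IsVac x' c' m.2 →
      P.IsVac (fun k => (x k).prodMap (x' k)) (fun k => (c k).prodMap (c' k)) m := by
    intro m h1 h2 t ht
    rw [hinv, h1 t ht, h2 t ht]
  have vac0 : P.IsVac x c 0 := fun t _ => map_zero _
  have vac0' : P.IsVac x' c' 0 := fun t _ => map_zero _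
  have hvv := vacW (v, v') hv.vac hv'.vac
  obtain ⟨N, hg, hs, hle, hN⟩ := W.exists_submodule (P := P) (v := (v, v'))
    (mem_wt_prodMap.2 ⟨hv.wt, hv'.wt⟩) hvv (b := b) ⟨hv.parity, hv'.parity⟩
  have key : ∀ m ∈ N, m ∈ prodPart p p' b → m.1 ∈ wt x i → m.2 ∈ wt x' i → P.IsVac x c m.1 →
      P.IsVac x' c' m.2 → ∃ α : F, m = α • (v, v') := by
    intro m hm hb h1 h2 h3 h4
    exact P.exists_smul_of_mem_vacSpace W.parity.toIsXCSuper W.compl.disjoint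
      (show (v, v') ∈ prodPart p p' b from ⟨hv.parity, hv'.parity⟩)
      (P.mem_vacSpace W.rel.toXCRel hvv (hN ⟨hm, mem_wt_prodMap.2 ⟨h1, h2⟩⟩) (vacW m h3 h4)) hb
  refine exists_equiv_of_graph M.compl hi hi' hg hs ?_ ?_ (hle (P.mem_gen _)) hv.ne_zero
    hv'.ne_zero
  · refine (hi.eq_bot_or_eq_top _ (isGr_comap_inl hg M'.compl.disjoint)
      (intertwines_inl.stable_comap hs)).resolve_right fun e => ?_
    have hm : (v, (0 : V')) ∈ N := (e ▸ Submodule.mem_top : v ∈ N.comap (LinearMap.inl F V V'))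
    obtain ⟨α, hα⟩ := key _ hm ⟨hv.parity, zero_mem _⟩ hv.wt (zero_mem _) hv.vac vac0'
    rw [Prod.smul_mk, Prod.mk.injEq] at hα
    rcases smul_eq_zero.1 hα.2.symm with h | h
    · exact hv.ne_zero (by rw [hα.1, h, zero_smul])
    · exact hv'.ne_zero h
  · refine (hi'.eq_bot_or_eq_top _ (isGr_comap_inr hg M.compl.disjoint)
      (intertwines_inr.stable_comap hs)).resolve_right fun e => ?_
    have hm : ((0 : V), v') ∈ N := (e ▸ Submodule.mem_top : v' ∈ N.comap (LinearMap.inr F V V'))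
    obtain ⟨α, hα⟩ := key _ hm ⟨zero_mem _, hv'.parity⟩ (zero_mem _) hv'.wt vac0 hv'.vac
    rw [Prod.smul_mk, Prod.mk.injEq] at hα
    rcases smul_eq_zero.1 hα.1.symm with h | h
    · exact hv'.ne_zero (by rw [hα.2, h, zero_smul])
    · exact hv.ne_zero h

section Shift

omit [IsAlgClosed F] [CharZero F]

theorem isGr_shift_iff (a : ZMod 2) {N : Submodule F V} :
    IsGr (fun b => p (b + a)) N ↔ IsGr p N := by
  rcases zmod_two_cases a with rfl | rfl
  · simp
  · rw [isGr_iff, isGr_iff, sup_comm]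
    rfl

theorem IsCSMod.shift (M : IsCSMod p s x c) (a : ZMod 2) : IsCSMod (fun b => p (b + a)) s x c where
  rel := M.rel
  cs := M.cs
  parity :=
    { s_mem := fun k b m hm => M.parity.s_mem k _ m hm
      x_mem := fun k b m hm => M.parity.x_mem k _ m hm
      c_mem := fun k b m hm => by
        rw [add_right_comm]
        exact M.parity.c_mem k _ m hm }
  compl := by
    rcases zmod_two_cases a with rfl | rfl
    · exact M.compl
    · exact M.compl.symm

theorem IsIrr.shift (h : IsIrr p s x c) (a : ZMod 2) : IsIrr (fun b => p (b + a)) s x c where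
  nontrivial := h.nontrivial
  eq_bot_or_eq_top N hg hN := h.eq_bot_or_eq_top N ((isGr_shift_iff a).1 hg) hN

end Shift

theorem exists_equiv_of_vacuum (M : IsCSMod p s x c) (M' : IsCSMod p' s' x' c')
    (hi : IsIrr p s x c) (hi' : IsIrr p' s' x' c') {a b : ZMod 2} {v : V} {v' : V'}
    (hv : IsVacuum p x c P b v) (hv' : IsVacuum p' x' c' P (b + a) v') :
    ∃ f : V ≃ₗ[F] V', Intertwines s x c s' x' c' f.toLinearMap ∧
      Shifts p p' a f.toLinearMap := by
  obtain ⟨f, h1, h2⟩ := exists_equiv_of_vacuum_even M (M'.shift a) hi (hi'.shift a) hv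
    (⟨hv'.wt, hv'.ne_zero, hv'.vac, hv'.parity⟩ :
      IsVacuum (fun b => p' (b + a)) x' c' P b v')
  exact ⟨f, h1, fun b m hm => by simpa using h2 b m hm⟩

/-- Irreducible completely splittable modules with a common weight are isomorphic. -/
theorem exists_equiv_of_common_wt (M : IsCSMod p s x c) (M' : IsCSMod p' s' x' c')
    (hi : IsIrr p s x c) (hi' : IsIrr p' s' x' c') (hw : wt x i ≠ ⊥) (hw' : wt x' i ≠ ⊥) :
    ∃ (a : ZMod 2) (f : V ≃ₗ[F] V'), Intertwines s x c s' x' c' f.toLinearMap ∧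
      Shifts p p' a f.toLinearMap := by
  obtain ⟨P⟩ := nonempty_pairing (zeros i)
  obtain ⟨b, v, hv⟩ := M.exists_vacuum P hw
  obtain ⟨b', v', hv'⟩ := M'.exists_vacuum P hw'
  refine ⟨b + b', exists_equiv_of_vacuum M M' hi hi' hv (v' := v') ?_⟩
  rwa [← add_assoc, zmod_two_add_self, zero_add]

/-- If the weight has an odd number of letters zero, there is an odd automorphism. -/
theorem exists_odd_equiv (M : IsCSMod p s x c) (hi : IsIrr p s x c) (hw : wt x i ≠ ⊥)
    (hodd : Odd (zeros i).card) : ∃ f : V ≃ₗ[F] V, Intertwines s x c s x c f.toLinearMap ∧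
      Shifts p p 1 f.toLinearMap := by
  obtain ⟨P⟩ := nonempty_pairing (zeros i)
  obtain ⟨b, v, hv⟩ := M.exists_vacuum P hw
  obtain ⟨r, hr⟩ : P.R.Nonempty := by
    rw [← Finset.card_pos, P.card_R, Nat.odd_iff.1 hodd]
    exact one_pos
  -- The involutions commute with the unpaired generator, so c_r v is a vacuum vector of the
  -- opposite parity.
  refine exists_equiv_of_vacuum M M hi hi hv (v' := c r v) ⟨M.rel.map_wt_c hv.wt r, ?_, ?_,
    M.parity.c_mem r b v hv.parity⟩
  · intro e
    apply hv.ne_zero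
    rw [← M.rel.c_c_apply r v, e, map_zero]
  · intro t ht
    have hne : t ≠ r := fun e => P.notT_of_mem_R hr (e ▸ ht)
    rw [P.inv_c M.rel.toXCRel ht hne (Or.inr hr), hv.vac t ht]

/-- If the weight has an even number of letters zero, there is no nonzero odd endomorphism. -/
theorem eq_zero_of_odd_of_even (M : IsCSMod p s x c) (hi : IsIrr p s x c) (hw : wt x i ≠ ⊥)
    (heven : Even (zeros i).card) {f : V →ₗ[F] V} (hf : Intertwines s x c s x c f)
    (hf1 : Shifts p p 1 f) : f = 0 := by
  obtain ⟨P⟩ := nonempty_pairing (zeros i)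
  obtain ⟨b, v, hv⟩ := M.exists_vacuum P hw
  have hR : P.R = ∅ := by rw [← Finset.card_eq_zero, P.card_R, Nat.even_iff.1 heven]
  have hmem : f v ∈ P.gen c v := hi.wt_eq_gen M hv ▸ hf.map_wt hv.wt
  have hinv : ∀ t m, f (P.inv x c t m) = P.inv x c t (f m) := by
    intro t m
    simp only [Pairing.inv]
    split_ifs
    · simp only [LinearMap.smul_apply, Module.End.mul_apply, map_smul, hf.map_c]
    · simp only [LinearMap.smul_apply, map_smul, hf.map_x]
  have hvac : P.IsVac x c (f v) := fun t ht => by rw [← hinv, hv.vac t ht]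
  have hm := P.mem_vacSpace M.rel.toXCRel hv.vac hmem hvac
  -- There is no unpaired zero, so f v is a multiple of v; but it has the opposite parity.
  have hv0 : f v = 0 := by
    have e : P.vacSpace c v = Submodule.span F {v} := by
      rw [Pairing.vacSpace, hR]
      simp
    rw [e] at hm
    obtain ⟨α, hα⟩ := Submodule.mem_span_singleton.1 hm
    exact Submodule.disjoint_def.1 (disjoint_part M.compl.disjoint b) _
      (hα ▸ Submodule.smul_mem _ α hv.parity) (hf1 b v hv.parity)
  exact LinearMap.ker_eq_top.1 (hi.eq_top (hf1.isGr_ker M.compl M.compl.disjoint) hf.stable_ker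
    (LinearMap.mem_ker.2 hv0) hv.ne_zero)

omit [CharZero F] in
/-- Schur's lemma for even endomorphisms. -/
theorem exists_smul_of_even [FiniteDimensional F V] (hc : IsCompl (p 0) (p 1))
    (hi : IsIrr p s x c) {f : V →ₗ[F] V} (hf : Intertwines s x c s x c f)
    (hf0 : Shifts p p 0 f) : ∃ α : F, f = α • LinearMap.id := by
  have := hi.nontrivial
  obtain ⟨α, hα⟩ := Module.End.exists_eigenvalue (f : Module.End F V)
  obtain ⟨v, hv⟩ := hα.exists_hasEigenvector
  have h1 : Intertwines s x c s x c (f - α • LinearMap.id) := by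
    constructor <;> intro k m <;> simp [hf.map_s, hf.map_x, hf.map_c]
  have h2 : Shifts p p 0 (f - α • LinearMap.id) := fun b m hm =>
    sub_mem (hf0 b m hm) (Submodule.smul_mem _ _ (by rwa [add_zero]))
  have : LinearMap.ker (f - α • LinearMap.id) = ⊤ :=
    hi.eq_top (h2.isGr_ker hc hc.disjoint) h1.stable_ker (v := v)
      (by simp [hv.apply_eq_smul]) hv.2
  exact ⟨α, sub_eq_zero.1 (LinearMap.ker_eq_top.1 this)⟩

end CommonWeight

/-! ## Semisimplicity and weights -/

section Semisimple

/-- The product of X − μ over the finitely many eigenvalues is separable and annihilates f. -/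
theorem _root_.Module.End.isSemisimple_of_iSup_eigenspace_eq_top {K V : Type*} [Field K]
    [AddCommGroup V] [Module K V] [FiniteDimensional K V] {f : Module.End K V}
    (h : ⨆ μ, f.eigenspace μ = ⊤) : f.IsSemisimple := by
  classical
  set S : Finset K := (Module.End.finite_hasEigenvalue f).toFinset
  have hsq : Squarefree (∏ μ ∈ S, (Polynomial.X - Polynomial.C μ)) :=
    (Polynomial.separable_prod_X_sub_C_iff'.2 fun _ _ _ _ e => e).squarefree
  refine Module.End.isSemisimple_of_squarefree_aeval_eq_zero hsq ?_
  rw [← LinearMap.ker_eq_top, eq_top_iff, ← h]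
  refine iSup_le fun μ m hm => ?_
  rw [LinearMap.mem_ker]
  by_cases hμ : μ ∈ S
  · rw [← Finset.prod_erase_mul _ _ hμ, map_mul, Module.End.mul_apply]
    have : Polynomial.aeval f (Polynomial.X - Polynomial.C μ) m = 0 := by
      rw [Module.End.mem_eigenspace_iff] at hm
      simp [hm, Algebra.algebraMap_eq_smul_one]
    rw [this, map_zero]
  · have : f.eigenspace μ = ⊥ := by
      by_contra hne
      exact hμ ((Set.Finite.mem_toFinset _).2 hne)
    rw [this, Submodule.mem_bot] at hm
    rw [hm, map_zero]

variable {F : Type*} [Field F] [CharZero F] [IsAlgClosed F] {V : Type*} [AddCommGroup V]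
  [Module F V] [FiniteDimensional F V] {n : ℕ} {x : Fin n → Module.End F V}

omit [CharZero F] in
-- Squares of semisimple operators are semisimple here, so the commuting x_k² are simultaneously
-- diagonalizable, and integrality turns every nonzero joint eigenspace into a weight space. The
-- condition `nil` says that 0 has no proper generalized eigenvectors.
theorem isCS_of_isSemisimple (hx : ∀ k l, x k * x l = x l * x k) (hs : ∀ k, (x k).IsSemisimple)
    (hq : ∀ k t, (x k * x k).HasEigenvalue t → ∃ i : ℕ, t = q F i) : IsCS x where
  span := by
    have hss : ∀ k, (x k * x k).IsSemisimple := fun k => by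
      rw [← pow_two]
      exact (hs k).pow 2
    have hcomm : Pairwise fun k l => Commute (x k * x k) (x l * x l) := fun k l _ =>
      ((Commute.mul_left (hx k l) (hx k l)).mul_right (Commute.mul_left (hx k l) (hx k l)))
    have h := Module.End.iSup_iInf_maxGenEigenspace_eq_top_of_iSup_maxGenEigenspace_eq_top_of_commute
      (fun k => x k * x k) hcomm fun k => Module.End.iSup_maxGenEigenspace_eq_top _
    rw [eq_top_iff, ← h]
    refine iSup_le fun χ => ?_
    simp only [(hss _).isFinitelySemisimple.maxGenEigenspace_eq_eigenspace]
    by_cases hχ : (⨅ k, (x k * x k).eigenspace (χ k)) = ⊥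
    · rw [hχ]
      exact bot_le
    · have : ∀ k, ∃ i : ℕ, χ k = q F i := fun k => hq k (χ k) fun e =>
        hχ (eq_bot_iff.2 ((iInf_le _ k).trans e.le))
      choose j hj using this
      refine le_trans (le_of_eq ?_) (le_iSup (wt x) j)
      simp only [wt, hj]
  nil k m hm := by
    have h := (hs k).isFinitelySemisimple.genEigenspace_eq_eigenspace 0 (k := 2) (by simp)
    have : m ∈ (x k).genEigenspace 0 2 := by
      rw [← Nat.cast_two, Module.End.mem_genEigenspace_nat]
      simpa [pow_two] using hm
    rw [h, Module.End.mem_eigenspace_iff, zero_smul] at this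
    exact this

theorem IsCS.isSemisimple (h : IsCS x) (k : Fin n) : (x k).IsSemisimple := by
  refine Module.End.isSemisimple_of_iSup_eigenspace_eq_top ?_
  rw [eq_top_iff, ← h.span]
  refine iSup_le fun j m hm => ?_
  rw [mem_wt] at hm
  by_cases h0 : j k = 0
  · refine Submodule.mem_iSup_of_mem 0 ?_
    rw [Module.End.mem_eigenspace_iff, zero_smul]
    apply h.nil
    rw [hm, h0, q_zero, zero_smul]
  · set r := sqrtF (q F (j k)) with hr
    have hrr : r * r = q F (j k) := by rw [← pow_two, hr, sqrtF_sq]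
    have r0 : r ≠ 0 := by
      rintro e
      rw [e, zero_mul, eq_comm, q_eq_zero_iff] at hrr
      exact h0 hrr
    -- For a nonzero letter, (1 ± r⁻¹ x_k)/2 project onto the eigenspaces of ±r, where r² = q(j_k).
    have e : m = (2 : F)⁻¹ • (m + r⁻¹ • x k m) + (2 : F)⁻¹ • (m - r⁻¹ • x k m) := by
      match_scalars <;> field_simp <;> ring
    rw [e]
    refine add_mem (Submodule.mem_iSup_of_mem r ?_) (Submodule.mem_iSup_of_mem (-r) ?_)
    · rw [Module.End.mem_eigenspace_iff]
      simp only [map_smul, map_add, hm, ← hrr]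
      match_scalars <;> field_simp
    · rw [Module.End.mem_eigenspace_iff]
      simp only [map_smul, map_sub, hm, ← hrr]
      match_scalars <;> field_simp

omit [IsAlgClosed F] [CharZero F] [FiniteDimensional F V] in
theorem IsCS.exists_of_hasEigenvalue (h : IsCS x) {k : Fin n} {t : F}
    (ht : (x k * x k).HasEigenvalue t) : ∃ i : ℕ, t = q F i := by
  by_contra! hne
  apply ht
  have hind := Module.End.eigenspaces_iSupIndep (x k * x k) t
  have htop : ⨆ (μ : F) (_ : μ ≠ t), (x k * x k).eigenspace μ = ⊤ := by
    rw [eq_top_iff, ← h.span]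
    refine iSup_le fun j => le_trans (iInf_le _ k) ?_
    exact le_iSup₂_of_le (q F (j k)) (hne (j k)).symm le_rfl
  rw [htop] at hind
  exact disjoint_top.1 hind

end Semisimple

/-! ## Translation between modules and operators -/

section Translation

variable {F : Type u} [Field F] {n : ℕ}

theorem stable_restrictScalars (M : Mod.{u, v} F n) (N : Submodule (Alg F n) M.carrier) :
    Stable (sOp M) (xOp M) (cOp M) (N.restrictScalars F) :=
  ⟨fun _ _ hm => N.smul_mem _ hm, fun _ _ hm => N.smul_mem _ hm, fun _ _ hm => N.smul_mem _ hm⟩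

theorem isIrreducible_iff (M : Mod.{u, v} F n) :
    Super.IsIrreducible M ↔ IsIrr M.part (sOp M) (xOp M) (cOp M) := by
  constructor
  · rintro ⟨h1, h2⟩
    refine ⟨h1, fun N hg hN => ?_⟩
    refine (h2 (submoduleOfStable M N hN.s_mem hN.x_mem hN.c_mem) hg).imp (fun e => ?_) fun e => ?_
    · rw [eq_bot_iff]
      intro m hm
      have : m ∈ submoduleOfStable M N hN.s_mem hN.x_mem hN.c_mem := hm
      rwa [e] at this
    · rw [eq_top_iff]
      rintro m -
      have : m ∈ submoduleOfStable M N hN.s_mem hN.x_mem hN.c_mem := e ▸ Submodule.mem_top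
      exact this
  · rintro ⟨h1, h2⟩
    refine ⟨h1, fun N hN => ?_⟩
    exact (h2 (N.restrictScalars F) hN (stable_restrictScalars M N)).imp
      (Submodule.restrictScalars_eq_bot_iff _ _ _).1 (Submodule.restrictScalars_eq_top_iff _ _ _).1

theorem isCSMod_op [IsAlgClosed F] [CharZero F] (M : Mod.{u, v} F n)
    (hcs : IsCompletelySplittable M) (hint : IsIntegral M) :
    IsCSMod M.part (sOp M) (xOp M) (cOp M) where
  rel := hcRel_op M
  parity := isSuper_op M
  compl := isInternal_iff.1 M.internal
  cs := by
    have := hint.1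
    refine isCS_of_isSemisimple (hcRel_op M).xx hcs fun k t ht => hint.2 k t ?_
    rwa [pow_two, act, map_mul]

/-- The parity involution. -/
noncomputable def parityMap (M : Mod.{u, v} F n) : M.carrier →ₗ[F] M.carrier :=
  (M.part 0).projection (M.part 1) (isInternal_iff.1 M.internal) -
    (M.part 1).projection (M.part 0) (isInternal_iff.1 M.internal).symm

theorem parityMap_apply_of_mem (M : Mod.{u, v} F n) {a : ZMod 2} {m : M.carrier}
    (hm : m ∈ M.part a) : parityMap M m = (-1 : F) ^ a.val • m := by
  have h := isInternal_iff.1 M.internal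
  rcases zmod_two_cases a with rfl | rfl
  · rw [parityMap, LinearMap.sub_apply, Submodule.projection_apply_of_mem_left h hm,
      Submodule.projection_apply_of_mem_right h.symm hm]
    simp
  · rw [parityMap, LinearMap.sub_apply, Submodule.projection_apply_of_mem_left h.symm hm,
      Submodule.projection_apply_of_mem_right h hm, ZMod.val_one]
    simp

theorem homogeneous_induction (M : Mod.{u, v} F n) {P : M.carrier → Prop}
    (mem : ∀ a, ∀ m ∈ M.part a, P m) (add : ∀ m m', P m → P m' → P (m + m')) (m : M.carrier) :
    P m := by
  obtain ⟨m₀, h0, m₁, h1, rfl⟩ := exists_decomposition (isInternal_iff.1 M.internal) m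
  exact add _ _ (mem 0 _ h0) (mem 1 _ h1)

theorem parityMap_parityMap (M : Mod.{u, v} F n) (m : M.carrier) :
    parityMap M (parityMap M m) = m := by
  induction m using homogeneous_induction with
  | mem a m hm =>
    rw [parityMap_apply_of_mem M hm, map_smul, parityMap_apply_of_mem M hm, smul_smul, ← mul_pow,
      neg_mul_neg, one_mul, one_pow, one_smul]
  | add m m' h h' => rw [map_add, map_add, h, h']

theorem neg_one_pow_val_add (a b : ZMod 2) :
    (-1 : F) ^ (a + b).val = (-1 : F) ^ a.val * (-1 : F) ^ b.val := by
  rcases zmod_two_cases a with rfl | rfl <;> rcases zmod_two_cases b with rfl | rfl <;>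
    simp [ZMod.val_one, show (1 : ZMod 2) + 1 = 0 from rfl]

theorem parityMap_smul (M : Mod.{u, v} F n) {a : ZMod 2} {h : Alg F n} (hh : h ∈ algPart F n a)
    (m : M.carrier) : parityMap M (h • m) = (-1 : F) ^ a.val • h • parityMap M m := by
  induction m using homogeneous_induction with
  | mem b m hm =>
    rw [parityMap_apply_of_mem M hm, parityMap_apply_of_mem M (M.smul_mem a b h m hh hm),
      neg_one_pow_val_add, mul_smul,
      smul_algebra_smul_comm ((-1 : F) ^ b.val) h m, smul_comm]
  | add m m' h h' => rw [smul_add, map_add, map_add, h, h', smul_add, smul_add]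

theorem parityMap_mem (M : Mod.{u, v} F n) {a : ZMod 2} {m : M.carrier} (hm : m ∈ M.part a) :
    parityMap M m ∈ M.part a := by
  rw [parityMap_apply_of_mem M hm]
  exact Submodule.smul_mem _ _ hm

variable {M : Mod.{u, v} F n} {N : Mod.{u, w} F n}

theorem intertwines_iff {f : M.carrier →ₗ[F] N.carrier} :
    Intertwines (sOp M) (xOp M) (cOp M) (sOp N) (xOp N) (cOp N) f ↔
      ∀ (h : Alg F n) m, f (h • m) = h • f m := by
  constructor
  · intro hf
    refine map_smul_of_gen f ?_
    rintro (k | k | k) m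
    · exact hf.map_s k m
    · exact hf.map_x k m
    · exact hf.map_c k m
  · exact fun hf => ⟨fun k m => hf _ m, fun k m => hf _ m, fun k m => hf _ m⟩

theorem mem_homPart_zero_iff {f : M.carrier →ₗ[F] N.carrier} : f ∈ Super.homPart 0 M N ↔
    Intertwines (sOp M) (xOp M) (cOp M) (sOp N) (xOp N) (cOp N) f ∧ Shifts M.part N.part 0 f := by
  rw [intertwines_iff]
  constructor
  · intro hf
    refine ⟨map_smul_of_gen f fun g m => ?_, hf.1⟩
    have := hf.2 _ _ (gen_mem_algPart g) m
    rwa [ZMod.val_zero, mul_zero, pow_zero, one_smul] at this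
  · rintro ⟨h1, h2⟩
    refine ⟨h2, fun a h _ m => ?_⟩
    rw [ZMod.val_zero, mul_zero, pow_zero, one_smul, h1]

/-- Precomposition with the parity involution absorbs the sign of an odd homomorphism. This is why
the arguments about operators use maps that commute with the action without signs. -/
theorem mem_homPart_one_iff {f : M.carrier →ₗ[F] N.carrier} : f ∈ Super.homPart 1 M N ↔
    Intertwines (sOp M) (xOp M) (cOp M) (sOp N) (xOp N) (cOp N) (f ∘ₗ parityMap M) ∧
      Shifts M.part N.part 1 (f ∘ₗ parityMap M) := by
  rw [intertwines_iff]
  constructor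
  · intro hf
    refine ⟨map_smul_of_gen _ fun g m => ?_, fun b m hm => hf.1 b _ (parityMap_mem M hm)⟩
    rw [LinearMap.comp_apply, parityMap_smul M (gen_mem_algPart g), map_smul,
      hf.2 _ _ (gen_mem_algPart g), ZMod.val_one, mul_one, smul_smul, ← mul_pow, neg_mul_neg,
      one_mul, one_pow, one_smul]
    rfl
  · rintro ⟨h1, h2⟩
    have e : ∀ m, f m = (f ∘ₗ parityMap M) (parityMap M m) := fun m => by
      rw [LinearMap.comp_apply, parityMap_parityMap]
    refine ⟨fun a m hm => ?_, fun a h hh m => ?_⟩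
    · rw [e]
      exact h2 a _ (parityMap_mem M hm)
    · rw [e, parityMap_smul M hh, map_smul, h1, ← e, ZMod.val_one, mul_one]

theorem isomorphic_of_equiv {a : ZMod 2} (f : M.carrier ≃ₗ[F] N.carrier)
    (h1 : Intertwines (sOp M) (xOp M) (cOp M) (sOp N) (xOp N) (cOp N) f.toLinearMap)
    (h2 : Shifts M.part N.part a f.toLinearMap) : Super.Isomorphic M N := by
  rcases zmod_two_cases a with rfl | rfl
  · exact ⟨f.toLinearMap, Submodule.mem_sup_left (mem_homPart_zero_iff.2 ⟨h1, h2⟩), f.bijective⟩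
  · have e : (f.toLinearMap ∘ₗ parityMap M) ∘ₗ parityMap M = f.toLinearMap :=
      LinearMap.ext fun m => congrArg f (parityMap_parityMap M m)
    refine ⟨f.toLinearMap ∘ₗ parityMap M, Submodule.mem_sup_right
      (mem_homPart_one_iff.2 (by rw [e]; exact ⟨h1, h2⟩)), f.bijective.comp ?_⟩
    exact (Function.Involutive.bijective (parityMap_parityMap M))

/-- An isomorphism need not be homogeneous. But the x_k are even, so they commute with the parity
involution, and both homogeneous parts of the map send weight vectors to weight vectors. -/
theorem wt_ne_bot_of_isomorphic (h : Super.Isomorphic M N) {j : Fin n → ℕ}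
    (hj : wt (xOp M) j ≠ ⊥) : wt (xOp N) j ≠ ⊥ := by
  obtain ⟨f, hf, hbij⟩ := h
  obtain ⟨f₀, h0, f₁, h1, rfl⟩ := Submodule.mem_sup.1 hf
  obtain ⟨m, hm, hm0⟩ := Submodule.exists_mem_ne_zero_of_ne_bot hj
  rw [mem_homPart_zero_iff] at h0
  rw [mem_homPart_one_iff] at h1
  have hδ : parityMap M m ∈ wt (xOp M) j := by
    have hc : ∀ k m, parityMap M (xOp M k m) = xOp M k (parityMap M m) := fun k m => by
      have := parityMap_smul M (gen_mem_algPart (F := F) (Gen.x k)) m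
      rwa [Gen.parity, ZMod.val_zero, pow_zero, one_smul] at this
    rw [mem_wt] at *
    intro k
    rw [← hc, ← hc, hm, map_smul]
  have hw : (f₀ + f₁) m ∈ wt (xOp N) j := by
    have h2 := h1.1.map_wt hδ
    rw [LinearMap.comp_apply, parityMap_parityMap] at h2
    exact add_mem (h0.1.map_wt hm) h2
  intro e
  rw [e, Submodule.mem_bot] at hw
  exact hm0 (hbij.1 (hw.trans (map_zero _).symm))

/-! ### Endomorphism algebras and types -/

section Types

variable [IsAlgClosed F] [CharZero F] {i : Fin n → ℕ}

omit [CharZero F] in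
theorem homPart_zero_eq [FiniteDimensional F M.carrier]
    (hi : IsIrr M.part (sOp M) (xOp M) (cOp M)) :
    Super.homPart 0 M M = Submodule.span F {LinearMap.id} := by
  refine le_antisymm (fun f hf => ?_) ?_
  · rw [mem_homPart_zero_iff] at hf
    obtain ⟨α, rfl⟩ := exists_smul_of_even (isInternal_iff.1 M.internal) hi hf.1 hf.2
    exact Submodule.smul_mem _ _ (Submodule.mem_span_singleton_self _)
  · rw [Submodule.span_singleton_le_iff_mem, mem_homPart_zero_iff]
    exact ⟨⟨fun _ _ => rfl, fun _ _ => rfl, fun _ _ => rfl⟩, fun b m hm => by rwa [add_zero]⟩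

omit [IsAlgClosed F] [CharZero F] in
theorem id_ne_zero_of_isIrr (hi : IsIrr M.part (sOp M) (xOp M) (cOp M)) :
    (LinearMap.id : M.carrier →ₗ[F] M.carrier) ≠ 0 := by
  have := hi.nontrivial
  obtain ⟨m, hm⟩ := exists_ne (0 : M.carrier)
  exact fun e => hm (LinearMap.congr_fun e m)

theorem finrank_hom_of_even [FiniteDimensional F M.carrier]
    (hM : IsCSMod M.part (sOp M) (xOp M) (cOp M)) (hi : IsIrr M.part (sOp M) (xOp M) (cOp M))
    (hw : wt (xOp M) i ≠ ⊥) (h : Even (zeros i).card) :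
    Module.finrank F (Super.hom M M) = 1 := by
  have h1 : Super.homPart 1 M M = ⊥ := by
    rw [eq_bot_iff]
    intro f hf
    rw [mem_homPart_one_iff] at hf
    have e := eq_zero_of_odd_of_even hM hi hw h hf.1 hf.2
    rw [Submodule.mem_bot]
    ext m
    rw [← parityMap_parityMap M m]
    exact LinearMap.congr_fun e _
  rw [Super.hom, h1, sup_bot_eq, homPart_zero_eq hi, finrank_span_singleton (id_ne_zero_of_isIrr hi)]

/-- Let g be the odd automorphism. For any odd f, after the sign twist, g f and g² are even, hence
scalars by Schur's lemma, and g² ≠ 0. So f is a multiple of g, and the odd part is one dimensional.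
-/
theorem finrank_hom_of_odd [FiniteDimensional F M.carrier]
    (hM : IsCSMod M.part (sOp M) (xOp M) (cOp M)) (hi : IsIrr M.part (sOp M) (xOp M) (cOp M))
    (hw : wt (xOp M) i ≠ ⊥) (h : Odd (zeros i).card) :
    Module.finrank F (Super.hom M M) = 2 := by
  obtain ⟨g, hg, hg1⟩ := exists_odd_equiv hM hi hw h
  have hdis := (isInternal_iff.1 M.internal).disjoint
  have e : (g.toLinearMap ∘ₗ parityMap M) ∘ₗ parityMap M = g.toLinearMap :=
    LinearMap.ext fun m => congrArg g (parityMap_parityMap M m)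
  have hgmem : g.toLinearMap ∘ₗ parityMap M ∈ Super.homPart 1 M M :=
    mem_homPart_one_iff.2 (by rw [e]; exact ⟨hg, hg1⟩)
  have h1 : Super.homPart 1 M M = Submodule.span F {g.toLinearMap ∘ₗ parityMap M} := by
    refine le_antisymm (fun f hf => ?_) (by rwa [Submodule.span_singleton_le_iff_mem])
    rw [mem_homPart_one_iff] at hf
    obtain ⟨α, hα⟩ := exists_smul_of_even (isInternal_iff.1 M.internal) hi
      (f := g.toLinearMap ∘ₗ (f ∘ₗ parityMap M))
      ⟨fun k m => by
          rw [LinearMap.comp_apply, hf.1.map_s, hg.map_s]; rfl,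
        fun k m => by
          rw [LinearMap.comp_apply, hf.1.map_x, hg.map_x]; rfl,
        fun k m => by
          rw [LinearMap.comp_apply, hf.1.map_c, hg.map_c]; rfl⟩
      fun b m hm => by
        have := hg1 _ _ (hf.2 b m hm)
        rwa [add_assoc, zmod_two_add_self] at this
    obtain ⟨β, hβ⟩ := exists_smul_of_even (isInternal_iff.1 M.internal) hi
      (f := g.toLinearMap ∘ₗ g.toLinearMap)
      ⟨fun k m => by
          rw [LinearMap.comp_apply, hg.map_s, hg.map_s]; rfl,
        fun k m => by
          rw [LinearMap.comp_apply, hg.map_x, hg.map_x]; rfl,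
        fun k m => by
          rw [LinearMap.comp_apply, hg.map_c, hg.map_c]; rfl⟩
      fun b m hm => by
        have := hg1 _ _ (hg1 b m hm)
        rwa [add_assoc, zmod_two_add_self] at this
    have β0 : β ≠ 0 := by
      rintro rfl
      have := hi.nontrivial
      obtain ⟨m, hm⟩ := exists_ne (0 : M.carrier)
      have h2 := LinearMap.congr_fun hβ m
      simp at h2
      exact hm h2
    refine Submodule.mem_span_singleton.2 ⟨β⁻¹ * α, LinearMap.ext fun m => g.injective ?_⟩
    have h2 := LinearMap.congr_fun hα (parityMap M m)
    have h3 := LinearMap.congr_fun hβ (parityMap M m)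
    simp only [LinearMap.comp_apply, parityMap_parityMap, LinearMap.smul_apply, LinearMap.id_apply,
      LinearEquiv.coe_coe] at h2 h3 ⊢
    rw [map_smul, h3, h2, smul_smul, mul_right_comm, inv_mul_cancel₀ β0, one_mul]
  have g0 : g.toLinearMap ∘ₗ parityMap M ≠ 0 := by
    intro e0
    have := hi.nontrivial
    obtain ⟨m, hm⟩ := exists_ne (0 : M.carrier)
    have h2 := LinearMap.congr_fun e0 (parityMap M m)
    rw [LinearMap.comp_apply, parityMap_parityMap] at h2
    exact hm (g.injective (h2.trans (map_zero g).symm))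
  have hd : Super.homPart 0 M M ⊓ Super.homPart 1 M M = ⊥ := by
    rw [eq_bot_iff]
    rintro f ⟨hf0, hf1⟩
    rw [Submodule.mem_bot]
    ext m
    induction m using homogeneous_induction with
    | mem a m hm =>
      have h2 := hf0.1 a m hm
      rw [add_zero] at h2
      exact Submodule.disjoint_def.1 (disjoint_part hdis a) _ h2 (hf1.1 a m hm)
    | add m m' h h' => rw [map_add, h, h', map_add]
  have h3 := Submodule.finrank_sup_add_finrank_inf_eq (Super.homPart 0 M M) (Super.homPart 1 M M)
  rw [hd, finrank_bot, add_zero, homPart_zero_eq hi, h1,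
    finrank_span_singleton (id_ne_zero_of_isIrr hi), finrank_span_singleton g0] at h3
  rw [Super.hom, homPart_zero_eq hi, h1, h3]

end Types

end Translation

/-! ## Properties of the modules `D^i` -/

section Transport

variable {F : Type*} [Field F] {V : Type*} [AddCommGroup V] [Module F V]
  {V' : Type*} [AddCommGroup V'] [Module F V'] {n : ℕ}
  {p : ZMod 2 → Submodule F V} {s : Fin (n - 1) → Module.End F V}
  {x c : Fin n → Module.End F V} {p' : ZMod 2 → Submodule F V'}
  {s' : Fin (n - 1) → Module.End F V'} {x' c' : Fin n → Module.End F V'}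

theorem Intertwines.symm {f : V ≃ₗ[F] V'} (hf : Intertwines s x c s' x' c' f.toLinearMap) :
    Intertwines s' x' c' s x c f.symm.toLinearMap where
  map_s k m := f.injective (by
    have := hf.map_s k (f.symm m)
    simp only [LinearEquiv.coe_coe, LinearEquiv.apply_symm_apply] at this ⊢
    exact this.symm)
  map_x k m := f.injective (by
    have := hf.map_x k (f.symm m)
    simp only [LinearEquiv.coe_coe, LinearEquiv.apply_symm_apply] at this ⊢
    exact this.symm)
  map_c k m := f.injective (by
    have := hf.map_c k (f.symm m)
    simp only [LinearEquiv.coe_coe, LinearEquiv.apply_symm_apply] at this ⊢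
    exact this.symm)

theorem Shifts.symm {f : V ≃ₗ[F] V'} (hf : Shifts p p' 0 f.toLinearMap)
    (hc : IsCompl (p 0) (p 1)) (hc' : Disjoint (p' 0) (p' 1)) :
    Shifts p' p 0 f.symm.toLinearMap := by
  intro b m hm
  rw [add_zero]
  obtain ⟨m₀, h0, m₁, h1, e⟩ := exists_decomposition hc (f.symm m)
  have e2 : m = f m₀ + f m₁ := by rw [← map_add, ← e, LinearEquiv.apply_symm_apply]
  have g0 : f m₀ ∈ p' 0 := hf 0 _ h0
  have g1 : f m₁ ∈ p' 1 := hf 1 _ h1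
  rw [LinearEquiv.coe_coe, e]
  rcases zmod_two_cases b with rfl | rfl
  · have : f m₁ = 0 := Submodule.disjoint_def.1 hc' _
      (by rw [← sub_eq_iff_eq_add'.2 e2]; exact sub_mem hm g0) g1
    rwa [(map_eq_zero_iff f f.injective).1 this, add_zero]
  · have : f m₀ = 0 := Submodule.disjoint_def.1 hc' _ g0
      (by rw [← sub_eq_iff_eq_add.2 e2]; exact sub_mem hm g1)
    rwa [(map_eq_zero_iff f f.injective).1 this, zero_add]

theorem IsIrr.of_equiv (h : IsIrr p s x c) {f : V ≃ₗ[F] V'}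
    (hf : Intertwines s x c s' x' c' f.toLinearMap) (hf0 : Shifts p p' 0 f.toLinearMap)
    (hc : IsCompl (p 0) (p 1)) (hc' : Disjoint (p' 0) (p' 1)) : IsIrr p' s' x' c' where
  nontrivial := by
    have := h.nontrivial
    exact f.symm.toEquiv.nontrivial
  eq_bot_or_eq_top N hg hN := by
    have h1 := h.eq_bot_or_eq_top (N.map f.symm.toLinearMap)
      (hg.map _ 0 (hf0.symm hc hc')) (hf.symm.stable_map hN)
    have hinj : Function.Injective (f.symm.toLinearMap : V' →ₗ[F] V) := f.symm.injective
    refine h1.imp (fun e => ?_) fun e => ?_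
    · exact Submodule.map_injective_of_injective hinj (e.trans (Submodule.map_bot _).symm)
    · rw [eq_top_iff]
      rintro m -
      obtain ⟨y, hy, e2⟩ := (e ▸ Submodule.mem_top : f.symm m ∈ N.map f.symm.toLinearMap)
      rwa [← hinj e2]

theorem IsCS.of_equiv (h : IsCS x) {f : V ≃ₗ[F] V'}
    (hf : Intertwines s x c s' x' c' f.toLinearMap) : IsCS x' where
  span := by
    rw [eq_top_iff]
    rintro m -
    have : ∀ y : V, f y ∈ ⨆ j, wt x' j := by
      intro y
      induction y using h.induction with
      | mem j m hm => exact Submodule.mem_iSup_of_mem j (hf.map_wt hm)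
      | zero => rw [map_zero]; exact zero_mem _
      | add a b ha hb => rw [map_add]; exact add_mem ha hb
    simpa using this (f.symm m)
  nil k m hm := by
    have h1 := hf.symm.map_x k
    simp only [LinearEquiv.coe_coe] at h1
    have := h.nil k (f.symm m) (by rw [← h1, ← h1, hm, map_zero])
    rw [← h1] at this
    exact (map_eq_zero_iff _ f.symm.injective).1 this

theorem wt_ne_bot_iff_of_equiv {f : V ≃ₗ[F] V'}
    (hf : Intertwines s x c s' x' c' f.toLinearMap) (j : Fin n → ℕ) :
    wt x j ≠ ⊥ ↔ wt x' j ≠ ⊥ := by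
  rw [Submodule.ne_bot_iff, Submodule.ne_bot_iff]
  exact ⟨fun ⟨m, hm, h0⟩ => ⟨f m, hf.map_wt hm, (map_ne_zero_iff f f.injective).2 h0⟩,
    fun ⟨m, hm, h0⟩ => ⟨f.symm m, hf.symm.map_wt hm, (map_ne_zero_iff _ f.symm.injective).2 h0⟩⟩

end Transport

/-! ### Irreducibility and dimension of L(i) -/

section Component

variable {F : Type u} [Field F] [IsAlgClosed F] {n : ℕ} {i : Fin n → ℕ} (L : Component F i)

theorem Component.eq_top {N : Submodule F L.space} (hg : IsGr L.part N)
    (hx : ∀ k, ∀ z ∈ N, L.X k z ∈ N) (hc : ∀ k, ∀ z ∈ N, L.C k z ∈ N) (hN : N ≠ ⊥) : N = ⊤ := by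
  have hbox : IsBoxSubmodule i (N.map L.space.subtype) := by
    refine ⟨?_, ?_, ?_⟩
    · rintro k - ⟨z, hz, rfl⟩
      exact ⟨_, hx k z hz, rfl⟩
    · rintro k - ⟨z, hz, rfl⟩
      exact ⟨_, hc k z hz, rfl⟩
    · rintro - ⟨z, hz, rfl⟩
      obtain ⟨z₀, h0, z₁, h1, m0, m1, rfl⟩ := hg z hz
      exact ⟨_, h0, _, h1, ⟨_, m0, rfl⟩, ⟨_, m1, rfl⟩, rfl⟩
  rcases L.minimal _ hbox (Submodule.map_subtype_le _ _) with e | e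
  · exact absurd (Submodule.map_injective_of_injective L.space.injective_subtype
      (e.trans (Submodule.map_bot _).symm)) hN
  · rw [eq_top_iff]
    rintro z -
    obtain ⟨y, hy, e2⟩ : z.1 ∈ N.map L.space.subtype := by
      rw [e]
      exact z.2
    rwa [← Subtype.ext e2]

instance Component.nontrivial : Nontrivial L.space :=
  Submodule.nontrivial_iff_ne_bot.2 L.ne_bot

/-- The whole of L(i) is a single weight space; it contains a vacuum vector, which generates
everything by irreducibility. -/
theorem Component.finrank_space [CharZero F] :
    Module.finrank F L.space = 2 ^ (n - (zeros i).card / 2) := by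
  obtain ⟨P⟩ := nonempty_pairing (zeros i)
  have h := L.isWtMod
  have hwt : (⊤ : Submodule F L.space) ≤ wt L.X i := fun z _ => h.wt_mem z
  have hgr : IsGr L.part ⊤ := fun z _ => by
    obtain ⟨z₀, h0, z₁, h1, e⟩ := exists_decomposition L.isCompl_part z
    exact ⟨z₀, h0, z₁, h1, trivial, trivial, e⟩
  obtain ⟨v, -, hv0, hv, a, hva⟩ := P.exists_vac h.toXCRel L.isXCSuper hwt (fun _ _ _ => trivial)
    (fun _ _ _ => trivial) hgr top_ne_bot
  have htop : P.gen L.C v = ⊤ := by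
    refine L.eq_top (P.gen_isGr L.isXCSuper hva)
      (P.gen_x_stable h.toXCRel hv (h.wt_mem v) fun k hk m _ => h.nil k hk m)
      (P.gen_c_stable h.toXCRel hv) fun e => hv0 ?_
    have := P.mem_gen (c := L.C) v
    rwa [e] at this
  rw [← finrank_top, ← htop]
  exact P.finrank_gen h.toXCRel L.isXCSuper L.isCompl_part.disjoint hva hv0 hv

end Component

/-! ### Weights and submodules of D^i -/

section TwistModule

variable {F : Type*} [Field F] {V : Type*} [AddCommGroup V] [Module F V] {n : ℕ}
  {i : Fin n → ℕ} {X C : Fin n → Module.End F V}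

/-- Elements of P_i keep the order of equal letters. Consequently the summands L(i)^τ belong to
pairwise different weights. -/
theorem InP.eq_of_permWord_eq (hi : Alternating i) {σ τ : Equiv.Perm (Fin n)} (hσ : InP i σ)
    (hτ : InP i τ) (e : permWord σ i = permWord τ i) : σ = τ :=
  perm_eq_of_permWord_eq e (fun a b hab h => (hσ.alternating_and_lt hi).2 a b hab (Or.inl h))
    fun a b hab h => (hτ.alternating_and_lt hi).2 a b hab (Or.inl h)

theorem twOp_twOp_apply (h : IsWtMod X C i) (k : Fin n) (f : twSpace F V i)
    (τ : Equiv.Perm (Fin n)) :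
    (twOp i X k (twOp i X k f)).1 τ = q F (permWord τ i k) • f.1 τ := by
  rw [twOp_apply, twOp_apply, h.sq]
  rfl

theorem twSingle_mem_wt (h : IsWtMod X C i) (τ : {τ // InP i τ}) (z : V) :
    twSingle (F := F) τ z ∈ wt (twOp i X) (permWord τ.1 i) := by
  rw [mem_wt]
  refine fun k => Subtype.ext (funext fun σ => ?_)
  rw [twOp_twOp_apply h, Submodule.coe_smul, Pi.smul_apply, twSingle_apply]
  split_ifs with e
  · rw [e]
  · rw [smul_zero, smul_zero]

theorem twSpace_induction {P : twSpace F V i → Prop} (single : ∀ τ z, P (twSingle τ z))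
    (zero : P 0) (add : ∀ f g, P f → P g → P (f + g)) (f : twSpace F V i) : P f := by
  classical
  have e : f = ∑ τ : {τ // InP i τ}, twSingle τ (f.1 τ.1) := by
    have := Finset.univ_sum_single ((twEquiv F V i).symm f)
    have := congrArg (twEquiv F V i) this
    rw [LinearEquiv.apply_symm_apply, map_sum] at this
    exact this.symm.trans (Finset.sum_congr rfl fun τ _ => twEquiv_single τ _)
  rw [e]
  exact Finset.sum_induction _ P add zero fun τ _ => single τ _

theorem isCS_twOp (h : IsWtMod X C i) [CharZero F] : IsCS (twOp i X) where
  span := by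
    rw [eq_top_iff]
    rintro f -
    induction f using twSpace_induction with
    | single τ z => exact Submodule.mem_iSup_of_mem _ (twSingle_mem_wt h τ z)
    | zero => exact zero_mem _
    | add f g hf hg => exact add_mem hf hg
  nil k f hf := by
    refine Subtype.ext (funext fun τ => ?_)
    have := congrArg (fun g => g.1 τ) hf
    simp only [twOp_twOp_apply h] at this
    rw [twOp_apply]
    rcases smul_eq_zero.1 this with e | e
    · exact h.nil _ ((q_eq_zero_iff _).1 e) _
    · rw [e, map_zero]
      rfl

theorem wt_twOp_ne_bot_iff [CharZero F] [Nontrivial V] (h : IsWtMod X C i) (j : Fin n → ℕ) :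
    wt (twOp i X) j ≠ ⊥ ↔ ∃ τ, InP i τ ∧ permWord τ i = j := by
  rw [Submodule.ne_bot_iff]
  constructor
  · rintro ⟨f, hf, hf0⟩
    obtain ⟨τ, hτ⟩ : ∃ τ, f.1 τ ≠ 0 := by
      by_contra! e
      exact hf0 (Subtype.ext (funext e))
    refine ⟨τ, by_contra fun e => hτ (f.2 τ e), funext fun k => ?_⟩
    have := congrArg (fun g => g.1 τ) (mem_wt.1 hf k)
    simp only [twOp_twOp_apply h, Submodule.coe_smul, Pi.smul_apply] at this
    exact q_injective (smul_left_injective F hτ this)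
  · rintro ⟨τ, hτ, rfl⟩
    obtain ⟨z, hz⟩ := exists_ne (0 : V)
    refine ⟨_, twSingle_mem_wt h ⟨τ, hτ⟩ z, fun e => hz ?_⟩
    have := congrArg (fun g => g.1 τ) e
    simpa [twSingle_apply] using this

/-- A nonzero subspace stable under the `x_k` contains some nonzero `z^τ`. -/
theorem exists_twSingle_mem [CharZero F] (h : IsWtMod X C i) (hi : Alternating i)
    {N : Submodule F (twSpace F V i)} (hx : ∀ k, ∀ f ∈ N, twOp i X k f ∈ N) (hN : N ≠ ⊥) :
    ∃ τ z, z ≠ 0 ∧ twSingle τ z ∈ N := by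
  classical
  -- An element of smallest nonempty support is supported at a single τ.
  have hex : ∃ d : ℕ, ∃ f ∈ N, f ≠ 0 ∧ (Finset.univ.filter fun τ => f.1 τ ≠ 0).card = d := by
    obtain ⟨f, hf, hf0⟩ := Submodule.exists_mem_ne_zero_of_ne_bot hN
    exact ⟨_, f, hf, hf0, rfl⟩
  obtain ⟨f, hf, hf0, hd⟩ := Nat.find_spec hex
  obtain ⟨τ, hτ⟩ : ∃ τ, f.1 τ ≠ 0 := by
    by_contra! e
    exact hf0 (Subtype.ext (funext e))
  have hτP : InP i τ := by_contra fun e => hτ (f.2 τ e)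
  refine ⟨⟨τ, hτP⟩, f.1 τ, hτ, ?_⟩
  have : twSingle ⟨τ, hτP⟩ (f.1 τ) = f := by
    refine Subtype.ext (funext fun σ => ?_)
    rw [twSingle_apply]
    split_ifs with e
    · rw [e]
    · by_contra! hσ
      have hσP : InP i σ := by_contra fun e => hσ (f.2 σ e).symm
      obtain ⟨k, hk⟩ : ∃ k, permWord σ i k ≠ permWord τ i k := by
        by_contra! e'
        exact e (hσP.eq_of_permWord_eq hi hτP (funext e'))
      -- At a position k where the words of σ and τ differ, x_k² − q((τ·i)_k) kills the component at
      -- τ and keeps the one at σ, so the support shrinks.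
      set g := twOp i X k (twOp i X k f) - q F (permWord τ i k) • f with hg
      have hgv : ∀ ρ, g.1 ρ = (q F (permWord ρ i k) - q F (permWord τ i k)) • f.1 ρ := by
        intro ρ
        rw [hg, Submodule.coe_sub, Pi.sub_apply, twOp_twOp_apply h, Submodule.coe_smul,
          Pi.smul_apply, sub_smul]
      have hgσ : g.1 σ ≠ 0 := by
        rw [hgv]
        exact smul_ne_zero (q_sub_ne_zero hk) hσ.symm
      have hlt : (Finset.univ.filter fun ρ => g.1 ρ ≠ 0).card <
          (Finset.univ.filter fun ρ => f.1 ρ ≠ 0).card := by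
        refine Finset.card_lt_card (Finset.ssubset_iff_subset_ne.2 ⟨fun ρ hρ => ?_, fun e' => ?_⟩)
        · rw [Finset.mem_filter] at *
          refine ⟨hρ.1, fun e0 => hρ.2 ?_⟩
          rw [hgv, e0, smul_zero]
        · have : τ ∈ Finset.univ.filter fun ρ => g.1 ρ ≠ 0 := by
            rw [e']
            simpa using hτ
          rw [Finset.mem_filter, hgv, sub_self, zero_smul] at this
          exact this.2 rfl
      rw [hd] at hlt
      refine Nat.find_min hex hlt ⟨g, sub_mem (hx k _ (hx k _ hf)) (N.smul_mem _ hf), ?_, rfl⟩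
      intro e0
      rw [e0] at hgσ
      exact hgσ rfl
  rwa [this]

/-- The vectors `z` with `z^τ` in a given subspace. -/
def twFiber (N : Submodule F (twSpace F V i)) (τ : {τ // InP i τ}) : Submodule F V where
  carrier := {z | twSingle τ z ∈ N}
  add_mem' {a b} ha hb := by
    have : twSingle (F := F) τ (a + b) = twSingle τ a + twSingle τ b := by
      refine Subtype.ext (funext fun σ => ?_)
      rw [Submodule.coe_add, Pi.add_apply, twSingle_apply, twSingle_apply, twSingle_apply]
      split_ifs <;> simp
    change twSingle τ (a + b) ∈ N
    rw [this]
    exact add_mem ha hb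
  zero_mem' := by
    have : twSingle (F := F) τ (0 : V) = 0 := by
      refine Subtype.ext (funext fun σ => ?_)
      rw [twSingle_apply, ite_self]
      rfl
    change twSingle τ 0 ∈ N
    rw [this]
    exact zero_mem N
  smul_mem' r a ha := by
    have : twSingle (F := F) τ (r • a) = r • twSingle τ a := by
      refine Subtype.ext (funext fun σ => ?_)
      rw [Submodule.coe_smul, Pi.smul_apply, twSingle_apply, twSingle_apply]
      split_ifs <;> simp
    change twSingle τ (r • a) ∈ N
    rw [this]
    exact N.smul_mem r ha

theorem mem_twFiber {N : Submodule F (twSpace F V i)} {τ : {τ // InP i τ}} {z : V} :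
    z ∈ twFiber N τ ↔ twSingle τ z ∈ N := Iff.rfl

theorem isGr_twFiber {p : ZMod 2 → Submodule F V} (hp : Disjoint (p 0) (p 1))
    {N : Submodule F (twSpace F V i)} (hN : IsGr (twPart i p) N) (τ : {τ // InP i τ}) :
    IsGr p (twFiber N τ) := by
  intro z hz
  obtain ⟨f₀, h0, f₁, h1, n0, n1, e⟩ := hN _ hz
  have ev : ∀ σ, (if σ = τ.1 then z else 0) = f₀.1 σ + f₁.1 σ := fun σ =>
    congrArg (fun g => g.1 σ) e
  have hne : ∀ σ, σ ≠ τ.1 → f₀.1 σ = 0 ∧ f₁.1 σ = 0 := by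
    intro σ hσ
    have e2 := ev σ
    rw [if_neg hσ] at e2
    have z0 := Submodule.disjoint_def.1 hp _ (h0 σ) (by
      rw [eq_neg_of_add_eq_zero_left e2.symm]
      exact neg_mem (h1 σ))
    exact ⟨z0, by rw [z0, zero_add] at e2; exact e2.symm⟩
  have e0 : twSingle τ (f₀.1 τ.1) = f₀ := by
    refine Subtype.ext (funext fun σ => ?_)
    rw [twSingle_apply]
    split_ifs with h
    · rw [h]
    · exact (hne σ h).1.symm
  have e1 : twSingle τ (f₁.1 τ.1) = f₁ := by
    refine Subtype.ext (funext fun σ => ?_)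
    rw [twSingle_apply]
    split_ifs with h
    · rw [h]
    · exact (hne σ h).2.symm
  refine ⟨_, h0 τ.1, _, h1 τ.1, ?_, ?_, ?_⟩
  · rwa [mem_twFiber, e0]
  · rwa [mem_twFiber, e1]
  · rw [← ev, if_pos rfl]

variable [IsAlgClosed F] [CharZero F]

theorem omega_ne_zero_of_admissible (hi : Alternating i) {τ : Equiv.Perm (Fin n)} (hτ : InP i τ)
    {k : Fin (n - 1)} (hk : Admissible (permWord τ i) k) :
    omega F (permWord τ i (lo k)) (permWord τ i (HeckeClifford.hi k)) ≠ 0 := by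
  rw [Ne, omega_eq_zero_iff ((hτ.alternating_and_lt hi).1.adj_ne k)]
  rw [Admissible] at hk
  omega

theorem twFiber_step_eq_top (hi : Alternating i) {N : Submodule F (twSpace F V i)}
    (hs : ∀ k, ∀ f ∈ N, twOpS X C hi k f ∈ N) {τ : {τ // InP i τ}} (hN : twFiber N τ = ⊤)
    {k : Fin (n - 1)} (hk : Admissible (permWord τ.1 i) k) :
    twFiber N ⟨simpleSwap k * τ.1, InP.step τ.1 k τ.2 hk⟩ = ⊤ := by
  have hmem : ∀ z, twSingle τ z ∈ N := fun z => by
    have : z ∈ twFiber N τ := hN ▸ Submodule.mem_top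
    exact this
  rw [eq_top_iff]
  rintro z -
  have h1 := hs k _ (hmem z)
  rw [twOpS_single_of_admissible hi k τ z hk,
    Submodule.add_mem_iff_right _ (hmem _),
    Submodule.smul_mem_iff _ (omega_ne_zero_of_admissible hi τ.2 hk)] at h1
  exact h1

/-- At an admissible step Ω_k ≠ 0, so s_k carries a full summand onto the next. Admissibility is
symmetric: the path from 1 to τ can be walked back, and every σ is then reached from 1. -/
theorem twFiber_eq_top (hi : Alternating i) {N : Submodule F (twSpace F V i)}
    (hs : ∀ k, ∀ f ∈ N, twOpS X C hi k f ∈ N) {τ : {τ // InP i τ}} (hN : twFiber N τ = ⊤) :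
    ∀ σ, twFiber N σ = ⊤ := by
  have h1 : twFiber N ⟨1, InP.one⟩ = ⊤ := by
    obtain ⟨τ, hτ⟩ := τ
    induction hτ with
    | one => exact hN
    | step τ k hτ hk ih =>
      have hk' : Admissible (permWord (simpleSwap k * τ) i) k := by
        rw [permWord_mul, Admissible, permWord_simpleSwap_lo, permWord_simpleSwap_hi]
        exact ⟨hk.2, hk.1⟩
      have := twFiber_step_eq_top hi hs hN hk'
      simp only [simpleSwap_mul_mul] at this
      exact ih this
  rintro ⟨σ, hσ⟩
  induction hσ with
  | one => exact h1
  | step σ k hσ hk ih => exact twFiber_step_eq_top hi hs ih hk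

end TwistModule

/-! ### Irreducibility and further properties of D^i -/

section Model

variable {F : Type u} [Field F] [IsAlgClosed F] [CharZero F] {n : ℕ} {i : Fin n → ℕ}

/-- A nonzero graded submodule contains some z^τ ≠ 0, then all of L(i)^τ because L(i) is
irreducible, then every summand. -/
theorem isIrr_twOp (hi : Alternating i) (L : Component F i) :
    IsIrr (V := twSpace F L.space i) (twPart i L.part) (twOpS L.X L.C hi) (twOp i L.X) (twOp i L.C) where
  nontrivial := by
    obtain ⟨z, hz⟩ := exists_ne (0 : L.space)
    refine ⟨twSingle ⟨1, InP.one⟩ z, 0, fun e => hz ?_⟩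
    have := congrArg (fun g => g.1 1) e
    simpa [twSingle_apply] using this
  eq_bot_or_eq_top N hg hN := by
    by_cases h0 : N = ⊥
    · exact Or.inl h0
    right
    obtain ⟨τ, z, hz, hmem⟩ := exists_twSingle_mem L.isWtMod hi hN.x_mem h0
    have htop : twFiber N τ = ⊤ := by
      refine L.eq_top (isGr_twFiber L.isCompl_part.disjoint hg τ) (fun k z hz => ?_)
        (fun k z hz => ?_) fun e => hz ?_
      · have := hN.x_mem (τ.1 k) _ hz
        rwa [twOp_single, perm_inv_apply] at this
      · have := hN.c_mem (τ.1 k) _ hz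
        rwa [twOp_single, perm_inv_apply] at this
      · have : z ∈ twFiber N τ := hmem
        rwa [e] at this
    rw [eq_top_iff]
    rintro f -
    induction f using twSpace_induction with
    | single σ z =>
      have : z ∈ twFiber N σ := twFiber_eq_top hi hN.s_mem htop σ ▸ Submodule.mem_top
      exact this
    | zero => exact zero_mem _
    | add f g hf hg => exact add_mem hf hg

variable {hi : Alternating i} {L : Component F i} {D : Mod.{u, v} F n}
  {e : twSpace F L.space i ≃ₗ[F] D.carrier}

theorem IsModel.intertwines (h : IsModel hi L D e) : Intertwines
    (V := twSpace F L.space i) (twOpS L.X L.C hi) (twOp i L.X) (twOp i L.C)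
    (sOp D) (xOp D) (cOp D) e.toLinearMap :=
  ⟨fun k f => (h.s k f).symm, fun k f => (h.x k f).symm, fun k f => (h.c k f).symm⟩

theorem IsModel.isCSMod (h : IsModel hi L D e) :
    IsCSMod D.part (sOp D) (xOp D) (cOp D) where
  rel := hcRel_op D
  parity := isSuper_op D
  compl := isInternal_iff.1 D.internal
  cs := (isCS_twOp L.isWtMod).of_equiv h.intertwines

theorem IsModel.isIrr (h : IsModel hi L D e) : IsIrr D.part (sOp D) (xOp D) (cOp D) :=
  (isIrr_twOp hi L).of_equiv h.intertwines (fun b f hf => by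
    rw [add_zero]
    exact h.part b f hf) (isCompl_twPart L.isCompl_part) (isInternal_iff.1 D.internal).disjoint

theorem IsModel.wt_ne_bot_iff (h : IsModel hi L D e) (j : Fin n → ℕ) :
    wt (xOp D) j ≠ ⊥ ↔ ∃ τ, InP i τ ∧ permWord τ i = j := by
  rw [← wt_ne_bot_iff_of_equiv h.intertwines, wt_twOp_ne_bot_iff L.isWtMod]

theorem IsModel.isCompletelySplittable (h : IsModel hi L D e) : IsCompletelySplittable D := by
  have : FiniteDimensional F D.carrier := Module.Finite.equiv e
  exact fun k => h.isCSMod.cs.isSemisimple k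

theorem IsModel.isIntegral (h : IsModel hi L D e) : IsIntegral D := by
  refine ⟨Module.Finite.equiv e, fun k t ht => h.isCSMod.cs.exists_of_hasEigenvalue (k := k) ?_⟩
  rwa [pow_two, act, map_mul] at ht

theorem finrank_twSpace (L : Component F i) : Module.finrank F (twSpace F L.space i) =
    2 ^ (n - (zeros i).card / 2) * Nat.card {τ // InP i τ} := by
  classical
  rw [← (twEquiv F L.space i).finrank_eq, Module.finrank_pi_fintype, Finset.sum_const,
    L.finrank_space, Finset.card_univ, ← Nat.card_eq_fintype_card, smul_eq_mul, mul_comm]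

end Model

/-! ## Standard tableaux and their words -/

namespace StrictPartition

variable (p : StrictPartition)

/-- The ends of the rows of a shifted diagram move to the left. -/
theorem add_parts_le {r t : ℕ} (hrt : r ≤ t) (ht : p.parts t ≠ 0) :
    t + p.parts t ≤ r + p.parts r := by
  induction t, hrt using Nat.le_induction with
  | base => exact le_rfl
  | succ t _ ih =>
    have h1 : p.parts t ≠ 0 := fun e => ht (p.zero t e)
    have := p.strict t h1
    have := ih h1
    omega

end StrictPartition

theorem mem_skewBoxes {lam mu : StrictPartition} {A : ℕ × ℕ} :
    A ∈ skewBoxes lam mu ↔ A.1 + mu.parts A.1 ≤ A.2 ∧ A.2 < A.1 + lam.parts A.1 := Iff.rfl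

/-- Skew shifted shapes are convex: with two boxes they contain the rectangle between them, as far
as it lies in the shifted quadrant r ≤ c. -/
theorem mem_skewBoxes_of_between {lam mu : StrictPartition} {A B : ℕ × ℕ}
    (hA : A ∈ skewBoxes lam mu) (hB : B ∈ skewBoxes lam mu) {r c : ℕ} (h1 : A.1 ≤ r) (h2 : r ≤ B.1)
    (h3 : A.2 ≤ c) (h4 : c ≤ B.2) (h5 : r ≤ c) : (r, c) ∈ skewBoxes lam mu := by
  rw [mem_skewBoxes] at *
  constructor
  · by_cases h : mu.parts r = 0
    · simpa [h] using h5
    · have := mu.add_parts_le h1 h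
      simp only
      omega
  · have := lam.add_parts_le h2 (by omega)
    simp only
    omega

namespace PlacedDiagram

variable {n : ℕ} {d e : PlacedDiagram n}

theorem row_le_col (A : d.Boxes) : A.1.1 ≤ A.1.2 := by
  have := A.2.1
  omega

theorem diagonal_eq_iff (A B : d.Boxes) :
    d.content A = d.content B ↔ A.1.2 + B.1.1 = B.1.2 + A.1.1 := by
  rw [d.content_eq, diagonal, diagonal]
  omega

theorem diagonal_succ_iff (A B : d.Boxes) :
    d.content A = d.content B + 1 ↔ A.1.2 + B.1.1 = B.1.2 + A.1.1 + 1 := by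
  rw [d.content_succ, diagonal, diagonal]
  omega

namespace Tableau

variable (T : d.Tableau)

theorem ext {T T' : d.Tableau} (h : T.label = T'.label) : T = T' := by
  cases T
  cases T'
  congr

theorem label_le {A B : d.Boxes} (h1 : A.1.1 ≤ B.1.1) (h2 : A.1.2 ≤ B.1.2) :
    T.label A ≤ T.label B := by
  have := row_le_col A
  let X : d.Boxes := ⟨(A.1.1, B.1.2),
    mem_skewBoxes_of_between A.2 B.2 le_rfl h1 h2 le_rfl (by omega)⟩
  have hAX : T.label A ≤ T.label X := by
    rcases h2.eq_or_lt with e | e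
    · have : A = X := Subtype.ext (Prod.ext rfl e)
      rw [← this]
    · exact (T.row A X rfl e).le
  refine hAX.trans ?_
  rcases h1.eq_or_lt with e | e
  · have : X = B := Subtype.ext (Prod.ext e rfl)
    rw [this]
  · exact (T.col X B rfl e).le

theorem label_lt {A B : d.Boxes} (h1 : A.1.1 ≤ B.1.1) (h2 : A.1.2 ≤ B.1.2)
    (h3 : A.1.1 < B.1.1 ∨ A.1.2 < B.1.2) : T.label A < T.label B := by
  refine lt_of_le_of_ne (T.label_le h1 h2) fun e => ?_
  have := T.label.injective e
  subst this
  omega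

theorem word_label (A : d.Boxes) : T.word (T.label A) = d.content A := by
  rw [word, Equiv.symm_apply_apply]

/-- Boxes on the same or on neighbouring diagonals are comparable. -/
theorem le_of_label_lt {A B : d.Boxes} (h : T.label A < T.label B)
    (hd : d.content A = d.content B ∨ d.content A = d.content B + 1 ∨
      d.content B = d.content A + 1) : A.1.1 ≤ B.1.1 ∧ A.1.2 ≤ B.1.2 := by
  rw [diagonal_eq_iff, diagonal_succ_iff, diagonal_succ_iff] at hd
  by_contra hne
  exact absurd (T.label_le (A := B) (B := A) (by omega) (by omega)) (not_le.2 h)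

/-- The box is the right neighbour of A for the larger content and the one below A for the smaller.
If A lies on the edge r = c there is no box below it; then the contents axiom `content_zero`
applies, and content 0 has no smaller neighbour. -/
theorem exists_between {A B : d.Boxes} (h1 : A.1.1 < B.1.1) (h2 : A.1.2 < B.1.2) {b : ℕ}
    (hb : b = d.content A + 1 ∨ d.content A = b + 1) :
    ∃ X : d.Boxes, d.content X = b ∧ A.1.1 ≤ X.1.1 ∧ X.1.1 ≤ A.1.1 + 1 ∧ A.1.2 ≤ X.1.2 ∧
      X.1.2 ≤ A.1.2 + 1 := by
  have hrc := row_le_col A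
  rcases hb with rfl | hb
  · let X : d.Boxes := ⟨(A.1.1, A.1.2 + 1), mem_skewBoxes_of_between A.2 B.2 le_rfl h1.le
      (Nat.le_succ _) h2 (by omega)⟩
    refine ⟨X, ?_, ?_⟩
    · rw [diagonal_succ_iff]
      simp only [X]
      omega
    · simp only [X]
      omega
  · by_cases hlt : A.1.1 < A.1.2
    · let X : d.Boxes := ⟨(A.1.1 + 1, A.1.2), mem_skewBoxes_of_between A.2 B.2 (Nat.le_succ _) h1
        le_rfl h2.le hlt⟩
      refine ⟨X, ?_, ?_⟩
      · have : d.content A = d.content X + 1 := by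
          rw [diagonal_succ_iff]
          simp only [X]
          omega
        omega
      · simp only [X]
        omega
    · have h0 : d.content A = 0 := d.content_zero A
        (mem_skewBoxes_of_between A.2 B.2 le_rfl h1.le (Nat.le_succ _) h2 (by omega))
        (mem_skewBoxes_of_between A.2 B.2 (Nat.le_succ _) h1 (Nat.le_succ _) h2 (by omega))
        (fun h => by
          have := h.1
          simp only at this
          omega)
      omega

/-- Of two boxes on one diagonal, the one with the larger label lies strictly southeast of the
other; the right and lower neighbours of the first box lie between them, and so do their labels. -/
theorem alternating_word : Alternating T.word := by
  intro k l hkl hw b hb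
  obtain ⟨A, rfl⟩ := T.label.surjective k
  obtain ⟨B, rfl⟩ := T.label.surjective l
  rw [T.word_label, T.word_label] at hw
  rw [T.word_label] at hb
  have hle := T.le_of_label_lt hkl (Or.inl hw)
  have hd := (diagonal_eq_iff A B).1 hw
  have hne : A.1.1 ≠ B.1.1 := by
    intro e
    have : A = B := Subtype.ext (Prod.ext e (by omega))
    exact hkl.ne (by rw [this])
  obtain ⟨X, hX, g1, g2, g3, g4⟩ := exists_between (A := A) (B := B) (by omega) (by omega) hb
  have hXA : X.1.2 + A.1.1 ≠ A.1.2 + X.1.1 := by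
    rw [Ne, ← diagonal_eq_iff, hX]
    omega
  exact ⟨T.label X, T.label_lt g1 g3 (by omega), T.label_lt (by omega) (by omega) (by omega),
    by rw [T.word_label, hX]⟩

/-- The right side involves the word only. If B were on the next diagonal but not adjacent to A, the
box diagonally southeast of A would be labeled in between and have the content of A. -/
theorem right_iff (A B : d.Boxes) : (B.1.1 = A.1.1 ∧ B.1.2 = A.1.2 + 1) ↔
    T.label A < T.label B ∧ d.content B = d.content A + 1 ∧
      ∀ p, T.label A < p → p < T.label B → T.word p ≠ d.content A := by
  have hrc := row_le_col A
  constructor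
  · rintro ⟨e1, e2⟩
    refine ⟨T.label_lt (by omega) (by omega) (by omega), ?_, fun p h1 h2 hp => ?_⟩
    · rw [diagonal_succ_iff]
      omega
    · obtain ⟨X, rfl⟩ := T.label.surjective p
      rw [T.word_label] at hp
      have g1 := T.le_of_label_lt h1 (Or.inl hp.symm)
      have hd := (diagonal_eq_iff X A).1 hp
      refine absurd (T.label_le (A := B) (B := X) ?_ ?_) (not_le.2 h2)
      · omega
      · by_contra hlt
        have : X = A := Subtype.ext (Prod.ext (by omega) (by omega))
        exact h1.ne (by rw [this])
  · rintro ⟨h1, h2, h3⟩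
    have hle := T.le_of_label_lt h1 (Or.inr (Or.inr h2))
    rw [diagonal_succ_iff] at h2
    by_contra hne
    have hlt : A.1.1 < B.1.1 := by omega
    let X : d.Boxes := ⟨(A.1.1 + 1, A.1.2 + 1), mem_skewBoxes_of_between A.2 B.2 (Nat.le_succ _)
      hlt (Nat.le_succ _) (by omega) (by omega)⟩
    refine h3 (T.label X) (T.label_lt ?_ ?_ ?_) (T.label_lt ?_ ?_ ?_) ?_
    · simp [X]
    · simp [X]
    · simp [X]
    · simp only [X]
      omega
    · simp only [X]
      omega
    · simp only [X]
      omega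
    · rw [T.word_label, diagonal_eq_iff]
      simp only [X]
      omega

theorem below_iff (A B : d.Boxes) : (B.1.1 = A.1.1 + 1 ∧ B.1.2 = A.1.2) ↔
    T.label A < T.label B ∧ d.content A = d.content B + 1 ∧
      ∀ p, T.label A < p → p < T.label B → T.word p ≠ d.content A := by
  have hrc := row_le_col A
  constructor
  · rintro ⟨e1, e2⟩
    refine ⟨T.label_lt (by omega) (by omega) (by omega), ?_, fun p h1 h2 hp => ?_⟩
    · rw [diagonal_succ_iff]
      omega
    · obtain ⟨X, rfl⟩ := T.label.surjective p
      rw [T.word_label] at hp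
      have g1 := T.le_of_label_lt h1 (Or.inl hp.symm)
      have hd := (diagonal_eq_iff X A).1 hp
      refine absurd (T.label_le (A := B) (B := X) ?_ ?_) (not_le.2 h2)
      · by_contra hlt
        have : X = A := Subtype.ext (Prod.ext (by omega) (by omega))
        exact h1.ne (by rw [this])
      · omega
  · rintro ⟨h1, h2, h3⟩
    have hle := T.le_of_label_lt h1 (Or.inr (Or.inl h2))
    rw [diagonal_succ_iff] at h2
    by_contra hne
    have hlt : A.1.2 < B.1.2 := by omega
    let X : d.Boxes := ⟨(A.1.1 + 1, A.1.2 + 1), mem_skewBoxes_of_between A.2 B.2 (Nat.le_succ _)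
      (by omega) (Nat.le_succ _) (by omega) (by omega)⟩
    refine h3 (T.label X) (T.label_lt ?_ ?_ ?_) (T.label_lt ?_ ?_ ?_) ?_
    · simp [X]
    · simp [X]
    · simp [X]
    · simp only [X]
      omega
    · simp only [X]
      omega
    · simp only [X]
      omega
    · rw [T.word_label, diagonal_eq_iff]
      simp only [X]
      omega

/-- Match boxes with equal labels; `right_iff` and `below_iff` read the adjacency relations off the
word. -/
theorem same_of_word_eq {T' : e.Tableau} (h : T.word = T'.word) : d.Same e := by
  let φ : d.Boxes ≃ e.Boxes := T.label.trans T'.label.symm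
  have hl : ∀ A, T'.label (φ A) = T.label A := fun A => by simp [φ]
  have hc : ∀ A, e.content (φ A) = d.content A := fun A => by
    rw [← T.word_label, h, ← T'.word_label, hl]
  refine ⟨φ, hc, fun A B => ?_, fun A B => ?_⟩
  · rw [T.right_iff, T'.right_iff, hl, hl, hc, hc, h]
  · rw [T.below_iff, T'.below_iff, hl, hl, hc, hc, h]

/-- A labeling is standard if it increases along neighbouring boxes. -/
def ofAdjacent (label : d.Boxes ≃ Fin n)
    (right : ∀ A B : d.Boxes, B.1.1 = A.1.1 → B.1.2 = A.1.2 + 1 → label A < label B)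
    (below : ∀ A B : d.Boxes, B.1.1 = A.1.1 + 1 → B.1.2 = A.1.2 → label A < label B) :
    d.Tableau where
  label := label
  row A B e hlt := by
    suffices H : ∀ (c : ℕ) (C : d.Boxes), C.1.1 = A.1.1 → C.1.2 = A.1.2 + (c + 1) →
        label A < label C from H (B.1.2 - A.1.2 - 1) B e.symm (by omega)
    intro c
    induction c with
    | zero => exact right A
    | succ c ih =>
      intro C h1 h2
      have := row_le_col A
      let X : d.Boxes := ⟨(A.1.1, A.1.2 + (c + 1)), mem_skewBoxes_of_between A.2 C.2 le_rfl h1.ge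
        (Nat.le_add_right _ _) (by omega) (by omega)⟩
      exact (ih X rfl rfl).trans (right X C h1 h2)
  col A B e hlt := by
    suffices H : ∀ (c : ℕ) (C : d.Boxes), C.1.1 = A.1.1 + (c + 1) → C.1.2 = A.1.2 →
        label A < label C from H (B.1.1 - A.1.1 - 1) B (by omega) e.symm
    intro c
    induction c with
    | zero => exact below A
    | succ c ih =>
      intro C h1 h2
      have := row_le_col C
      let X : d.Boxes := ⟨(A.1.1 + (c + 1), A.1.2), mem_skewBoxes_of_between A.2 C.2
        (Nat.le_add_right _ _) (by omega) le_rfl h2.ge (by omega)⟩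
      exact (ih X rfl rfl).trans (below X C h1 h2)

/-- The tableaux of a given shape are obtained from one of them by the permutations in `P_i`. -/
def equivInP : {τ // InP T.word τ} ≃ d.Tableau where
  toFun τ := ofAdjacent (T.label.trans τ.1)
    (fun A B h1 h2 => (inP_iff T.alternating_word).1 τ.2 _ _
      (T.label_lt h1.ge (by omega) (by omega)) (by
        rw [T.word_label, T.word_label, diagonal_succ_iff, diagonal_succ_iff]
        omega))
    (fun A B h1 h2 => (inP_iff T.alternating_word).1 τ.2 _ _
      (T.label_lt (by omega) h2.ge (by omega)) (by
        rw [T.word_label, T.word_label, diagonal_succ_iff, diagonal_succ_iff]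
        omega))
  invFun T' := ⟨T.label.symm.trans T'.label, (inP_iff T.alternating_word).2 fun a b hab h => by
    obtain ⟨A, rfl⟩ := T.label.surjective a
    obtain ⟨B, rfl⟩ := T.label.surjective b
    rw [T.word_label, T.word_label] at h
    have hle := T.le_of_label_lt hab (Or.inr h)
    simp only [Equiv.trans_apply, Equiv.symm_apply_apply]
    rw [diagonal_succ_iff, diagonal_succ_iff] at h
    exact T'.label_lt hle.1 hle.2 (by omega)⟩
  left_inv τ := Subtype.ext (Equiv.ext fun k => by simp [ofAdjacent])
  right_inv T' := ext (Equiv.ext fun A => by simp [ofAdjacent])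

theorem word_equivInP (τ : {τ // InP T.word τ}) : (T.equivInP τ).word = permWord τ.1 T.word :=
  rfl

theorem card_inP : Nat.card {τ // InP T.word τ} = d.numTableaux := Nat.card_congr T.equivInP

theorem card_zeros : (zeros T.word).card = d.gammaZero := by
  rw [gammaZero, Nat.card_congr (T.label.subtypeEquiv (q := fun k => T.word k = 0) fun A => by
    rw [T.word_label]), Nat.card_eq_fintype_card, Fintype.card_subtype, zeros]

end Tableau

theorem finite_boxes (d : PlacedDiagram n) : Finite d.Boxes :=
  Set.finite_of_encard_eq_coe d.card_boxes

theorem card_boxes_eq (d : PlacedDiagram n) : Nat.card d.Boxes = n := by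
  rw [Nat.card_coe_set_eq, Set.ncard, d.card_boxes, ENat.toNat_natCast]

/-- Number the boxes row by row: the lexicographic order increases along rows and down columns. -/
theorem nonempty_tableau (d : PlacedDiagram n) : Nonempty d.Tableau := by
  classical
  have := d.finite_boxes
  have := Fintype.ofFinite d.Boxes
  let S : Set (ℕ ×ₗ ℕ) := {A | ofLex A ∈ skewBoxes d.outer d.inner}
  let g : d.Boxes ≃ S := Equiv.subtypeEquiv toLex fun _ => Iff.rfl
  have := Fintype.ofEquiv _ g
  have lt_iff : ∀ A B : d.Boxes, g A < g B ↔ A.1.1 < B.1.1 ∨ A.1.1 = B.1.1 ∧ A.1.2 < B.1.2 :=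
    fun A B => Prod.Lex.toLex_lt_toLex
  let f : Fin n ≃o S := Fintype.orderIsoFinOfCardEq S
    (by rw [← Nat.card_eq_fintype_card, ← Nat.card_congr g, d.card_boxes_eq])
  exact ⟨g.trans f.symm.toEquiv,
    fun A B h1 h2 => f.symm.lt_iff_lt.2 ((lt_iff A B).2 (Or.inr ⟨h1, h2⟩)),
    fun A B _ h2 => f.symm.lt_iff_lt.2 ((lt_iff A B).2 (Or.inl h2))⟩

theorem Same.exists_word_eq (h : d.Same e) (T : d.Tableau) :
    ∃ T' : e.Tableau, T'.word = T.word := by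
  obtain ⟨φ, hc, hr, hb⟩ := h
  refine ⟨Tableau.ofAdjacent (φ.symm.trans T.label) (fun A B h1 h2 => ?_) (fun A B h1 h2 => ?_),
    funext fun k => ?_⟩
  · have := (hr (φ.symm A) (φ.symm B)).2 (by simpa using ⟨h1, h2⟩)
    exact T.label_lt this.1.ge (by omega) (by omega)
  · have := (hb (φ.symm A) (φ.symm B)).2 (by simpa using ⟨h1, h2⟩)
    exact T.label_lt (by omega) this.2.ge (by omega)
  · exact hc _

end PlacedDiagram

/-! ## The placed diagram of a word -/

section Profile

/-- A sequence descending by steps of at most one to zero. -/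
structure IsProfile (f : ℕ → ℕ) : Prop where
  succ_le : ∀ u, f (u + 1) ≤ f u
  le_succ : ∀ u, f u ≤ f (u + 1) + 1
  exists_eq_zero : ∃ u, f u = 0

variable {f g : ℕ → ℕ}

theorem IsProfile.exists_le (hf : IsProfile f) (r : ℕ) : ∃ u, f u ≤ r :=
  hf.exists_eq_zero.imp fun u h => by omega

/-- The strict partition whose `r`-th part is the least `u` with `f u ≤ r`. -/
noncomputable def IsProfile.partition (hf : IsProfile f) : StrictPartition where
  parts r := sInf {u | f u ≤ r}
  strict r h0 := by
    obtain ⟨u, hu⟩ := Nat.exists_eq_succ_of_ne_zero h0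
    have h1 : f (u + 1) ≤ r := by
      have := Nat.sInf_mem (s := {u | f u ≤ r}) (hf.exists_le r)
      rwa [hu] at this
    -- The profile drops by at most one per step, so f (u + 1) ≤ r gives f u ≤ r + 1; this is what
    -- makes the partition strict.
    have h2 : sInf {u | f u ≤ r + 1} ≤ u :=
      Nat.sInf_le ((hf.le_succ u).trans (Nat.succ_le_succ h1))
    omega
  zero r h0 := by
    have h1 : f 0 ≤ r := by
      have := Nat.sInf_mem (s := {u | f u ≤ r}) (hf.exists_le r)
      rwa [h0] at this
    exact Nat.le_zero.1 (Nat.sInf_le (Nat.le_succ_of_le h1))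

theorem IsProfile.partition_le_iff (hf : IsProfile f) {r u : ℕ} :
    hf.partition.parts r ≤ u ↔ f u ≤ r :=
  ⟨fun h => (antitone_nat_of_succ_le hf.succ_le h).trans (Nat.sInf_mem (hf.exists_le r)),
    fun h => Nat.sInf_le h⟩

/-- Passage from rows to diagonals: the shape of a word grows along diagonals, since each letter
adds a box on the diagonal of its content. -/
theorem IsProfile.mem_skewBoxes_iff (hf : IsProfile f) (hg : IsProfile g) {r u : ℕ} :
    (r, r + u) ∈ skewBoxes hg.partition hf.partition ↔ f u ≤ r ∧ r < g u := by
  rw [mem_skewBoxes, ← hf.partition_le_iff, ← not_le, ← not_le, ← hg.partition_le_iff]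
  simp only
  omega

end Profile

section Word

variable {n : ℕ} {i : Fin n → ℕ}

open Classical in
/-- The number of occurrences of the letter `u` among the first `t` letters. -/
noncomputable def letterCount (i : Fin n → ℕ) (u t : ℕ) : ℕ :=
  Nat.count (fun l => ∃ h : l < n, i ⟨l, h⟩ = u) t

theorem letterCount_succ_self (k : Fin n) :
    letterCount i (i k) (k + 1) = letterCount i (i k) k + 1 := by
  rw [letterCount, Nat.count_succ, if_pos ⟨k.2, rfl⟩, letterCount]

theorem letterCount_succ_of_ne {k : Fin n} {u : ℕ} (h : i k ≠ u) :
    letterCount i u (k + 1) = letterCount i u k := by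
  rw [letterCount, Nat.count_succ, if_neg (fun ⟨_, h'⟩ => h h'), letterCount, add_zero]

theorem letterCount_mono (u : ℕ) : Monotone (letterCount i u) := Nat.count_monotone _

theorem letterCount_eq_zero {u : ℕ} (h : ∀ k, i k ≠ u) (t : ℕ) : letterCount i u t = 0 := by
  rw [letterCount, Nat.count_iff_forall_not]
  exact fun l _ ⟨hl, e⟩ => h _ e

theorem exists_letterCount_eq {u r t : ℕ} (h : r < letterCount i u t) :
    ∃ k, i k = u ∧ letterCount i u k = r := by
  induction t with
  | zero => exact absurd h (by simp [letterCount])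
  | succ t ih =>
    by_cases h1 : ∃ h : t < n, i ⟨t, h⟩ = u
    · by_cases h2 : r < letterCount i u t
      · exact ih h2
      · obtain ⟨ht, rfl⟩ := h1
        have := letterCount_succ_self (i := i) ⟨t, ht⟩
        exact ⟨⟨t, ht⟩, rfl, by simp only at this ⊢; omega⟩
    · rw [letterCount, Nat.count_succ, if_neg h1] at h
      exact ih h

open Classical in
/-- One if among the letters `u`, `u + 1` the first one to occur is `u + 1`, zero otherwise. -/
noncomputable def firstStep (i : Fin n → ℕ) (u : ℕ) : ℕ :=
  if ∃ k, i k = u + 1 ∧ ∀ l < k, i l ≠ u then 1 else 0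

/-- The first row meeting the `u`-th diagonal. -/
noncomputable def firstRow (i : Fin n → ℕ) (u : ℕ) : ℕ :=
  ∑ v ∈ Finset.Ico u (Finset.univ.sup i), firstStep i v

/-- Adjacent diagonals start in the same row or one row apart, according to which of their letters
occurs first. Cutting the sum off at the largest letter loses nothing, as the later steps are zero.
-/
theorem firstRow_eq (u : ℕ) : firstRow i u = firstStep i u + firstRow i (u + 1) := by
  by_cases h : u < Finset.univ.sup i
  · rw [firstRow, Finset.sum_eq_sum_Ico_succ_bot h, firstRow]
  · have h1 : firstStep i u = 0 := if_neg fun ⟨k, hk, _⟩ => by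
      have := Finset.le_sup (f := i) (Finset.mem_univ k)
      omega
    rw [h1, firstRow, firstRow, Finset.Ico_eq_empty_of_le (by omega),
      Finset.Ico_eq_empty_of_le (by omega), Finset.sum_empty, add_zero]

/-- The row after the last box on the `u`-th diagonal, after `t` letters. -/
noncomputable def nextRow (i : Fin n → ℕ) (u t : ℕ) : ℕ := firstRow i u + letterCount i u t

/-- Neighbouring letters of an alternating word take turns. -/
theorem Alternating.interlacing (hi : Alternating i) (u t : ℕ) (ht : t ≤ n) :
    (nextRow i u t = nextRow i (u + 1) t ∨ nextRow i u t = nextRow i (u + 1) t + 1) ∧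
      ∀ k : Fin n, t ≤ k → (∀ l : Fin n, t ≤ l → l < k → i l ≠ u ∧ i l ≠ u + 1) →
        (i k = u → nextRow i u t = nextRow i (u + 1) t) ∧
          (i k = u + 1 → nextRow i u t = nextRow i (u + 1) t + 1) := by
  -- The second clause strengthens the induction: it states which of the two differences holds
  -- before the next letter u or u + 1, and this decides what that letter does to the difference.
  induction t with
  | zero =>
    have h0 : ∀ v, nextRow i v 0 = firstRow i v := fun v => by simp [nextRow, letterCount]
    rw [h0, h0, firstRow_eq u]
    have hle : firstStep i u ≤ 1 := by
      rw [firstStep]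
      split_ifs <;> omega
    refine ⟨by omega, fun k _ hk => ⟨fun e => ?_, fun e => ?_⟩⟩
    · have : firstStep i u = 0 := if_neg fun ⟨k', e', hk'⟩ => by
        rcases lt_trichotomy k k' with h | rfl | h
        · exact hk' k h e
        · omega
        · exact (hk k' (Nat.zero_le _) h).2 e'
      omega
    · have : firstStep i u = 1 := if_pos ⟨k, e, fun l hl => (hk l (Nat.zero_le _) hl).1⟩
      omega
  | succ t ih =>
    obtain ⟨h1, h2⟩ := ih (by omega)
    set k₀ : Fin n := ⟨t, ht⟩ with hk₀
    have hself : ∀ v, i k₀ = v → nextRow i v (t + 1) = nextRow i v t + 1 := by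
      rintro _ rfl
      rw [nextRow, letterCount_succ_self k₀, nextRow]
      rfl
    have hne : ∀ v, i k₀ ≠ v → nextRow i v (t + 1) = nextRow i v t := fun v hv => by
      rw [nextRow, letterCount_succ_of_ne hv, nextRow]
    have h3 := h2 k₀ le_rfl fun l hl hl' => absurd hl' (by
      rw [Fin.lt_def]
      exact not_lt.2 hl)
    -- By alternation, the first letter among u, u + 1 after an occurrence of one of them is the
    -- other one.
    have next : ∀ k : Fin n, t + 1 ≤ k →
        (∀ l : Fin n, t + 1 ≤ l → l < k → i l ≠ u ∧ i l ≠ u + 1) →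
        (i k₀ = u ∨ i k₀ = u + 1) → i k ≠ i k₀ := by
      intro k hk hl h4 e
      obtain ⟨p, hp1, hp2, hp3⟩ := hi k₀ k hk e.symm (if i k₀ = u then u + 1 else u) (by
        split_ifs <;> omega)
      have := hl p hp1 hp2
      split_ifs at hp3 <;> omega
    by_cases c1 : i k₀ = u
    · have e1 := hself u c1
      have e2 := hne (u + 1) (by omega)
      have e3 := h3.1 c1
      refine ⟨by omega, fun k hk hl => ⟨fun e => ?_, fun e => by omega⟩⟩
      exact absurd (e.trans c1.symm) (next k hk hl (Or.inl c1))
    · by_cases c2 : i k₀ = u + 1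
      · have e1 := hself (u + 1) c2
        have e2 := hne u c1
        have e3 := h3.2 c2
        refine ⟨by omega, fun k hk hl => ⟨fun e => by omega, fun e => ?_⟩⟩
        exact absurd (e.trans c2.symm) (next k hk hl (Or.inr c2))
      · rw [hne u c1, hne (u + 1) c2]
        refine ⟨h1, fun k hk hl => h2 k (by omega) fun l hl1 hl2 => ?_⟩
        rcases hl1.eq_or_lt with e | hlt
        · have : l = k₀ := Fin.ext e.symm
          rw [this]
          exact ⟨c1, c2⟩
        · exact hl l hlt hl2

theorem Alternating.nextRow_le (hi : Alternating i) (u : ℕ) {t : ℕ} (ht : t ≤ n) :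
    nextRow i (u + 1) t ≤ nextRow i u t ∧ nextRow i u t ≤ nextRow i (u + 1) t + 1 := by
  have := (hi.interlacing u t ht).1
  omega

theorem nextRow_mono (u : ℕ) : Monotone (nextRow i u) := fun _ _ h =>
  Nat.add_le_add_left (letterCount_mono u h) _

theorem nextRow_succ (k : Fin n) : nextRow i (i k) (k + 1) = nextRow i (i k) k + 1 := by
  rw [nextRow, letterCount_succ_self, nextRow, add_assoc]

theorem nextRow_zero (u : ℕ) : nextRow i u 0 ≤ nextRow i u n := nextRow_mono u (Nat.zero_le n)

theorem Alternating.isProfile (hi : Alternating i) {t : ℕ} (ht : t ≤ n) :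
    IsProfile fun u => nextRow i u t where
  succ_le u := (hi.nextRow_le u ht).1
  le_succ u := (hi.nextRow_le u ht).2
  exists_eq_zero := ⟨Finset.univ.sup i + 1, by
    rw [nextRow, letterCount_eq_zero (fun k e => by
      have := Finset.le_sup (f := i) (Finset.mem_univ k)
      omega), firstRow, Finset.Ico_eq_empty_of_le (by omega), Finset.sum_empty]⟩

variable (hi : Alternating i)

theorem Alternating.mem_boxes (k : Fin n) :
    (nextRow i (i k) k, nextRow i (i k) k + i k) ∈
      skewBoxes (hi.isProfile le_rfl).partition (hi.isProfile (Nat.zero_le n)).partition := by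
  rw [IsProfile.mem_skewBoxes_iff]
  refine ⟨nextRow_mono _ (Nat.zero_le _), ?_⟩
  have := nextRow_mono (i := i) (i k) (show (k : ℕ) + 1 ≤ n from k.2)
  rw [nextRow_succ] at this
  omega

/-- The box added with the `k`-th letter. -/
noncomputable def Alternating.box (k : Fin n) :
    skewBoxes (hi.isProfile le_rfl).partition (hi.isProfile (Nat.zero_le n)).partition :=
  ⟨_, hi.mem_boxes k⟩

theorem nextRow_lt {k l : Fin n} (h : k < l) : nextRow i (i k) k < nextRow i (i k) l :=
  Nat.lt_of_succ_le ((nextRow_succ k).ge.trans (nextRow_mono (i k) h))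

theorem Alternating.box_bijective : Function.Bijective hi.box := by
  constructor
  · intro k l e
    have e1 : nextRow i (i k) k = nextRow i (i l) l := congrArg (fun A => A.1.1) e
    have e2 : nextRow i (i k) k + i k = nextRow i (i l) l + i l := congrArg (fun A => A.1.2) e
    have e3 : i k = i l := by omega
    by_contra hne
    rcases lt_or_gt_of_ne hne with h | h
    · have := nextRow_lt (i := i) h
      rw [e1, e3] at this
      exact this.false
    · have := nextRow_lt (i := i) h
      rw [← e1, ← e3] at this
      exact this.false
  · rintro ⟨⟨r, c⟩, hA⟩
    obtain ⟨u, rfl⟩ := Nat.exists_eq_add_of_le (show r ≤ c by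
      have := hA.1
      simp only at this
      omega)
    have h := hA
    rw [IsProfile.mem_skewBoxes_iff] at h
    -- Row r of the diagonal u is filled by the occurrence of u number r − firstRow u, counted from
    -- 0.
    obtain ⟨k, rfl, hk⟩ := exists_letterCount_eq (i := i) (u := u) (r := r - firstRow i u) (t := n)
      (by
        have := h.2
        simp only [nextRow] at this
        have h0 := h.1
        simp only [nextRow] at h0
        omega)
    have hrow : nextRow i (i k) k = r := by
      have h0 := h.1
      simp only [nextRow] at h0
      rw [nextRow, hk]
      omega
    exact ⟨k, Subtype.ext (Prod.ext hrow (by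
      change nextRow i (i k) k + i k = r + i k
      rw [hrow]))⟩

/-- The boxes of the diagram of a word, in the order of the letters. -/
noncomputable def Alternating.boxEquiv : Fin n ≃
    skewBoxes (hi.isProfile le_rfl).partition (hi.isProfile (Nat.zero_le n)).partition :=
  Equiv.ofBijective hi.box hi.box_bijective

theorem le_of_mem_skewBoxes {lam mu : StrictPartition} (A : skewBoxes lam mu) :
    A.1.1 ≤ A.1.2 := by
  have := A.2.1
  omega

/-- The placed diagram of an alternating word: the content of a box is its diagonal. -/
noncomputable def Alternating.diagram : PlacedDiagram n where
  outer := (hi.isProfile le_rfl).partition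
  inner := (hi.isProfile (Nat.zero_le n)).partition
  inner_le r := by
    rw [IsProfile.partition_le_iff]
    exact (nextRow_zero _).trans ((hi.isProfile le_rfl).partition_le_iff.1 le_rfl)
  card_boxes := by
    rw [Set.encard, ← ENat.card_congr hi.boxEquiv]
    simp
  content A := A.1.2 - A.1.1
  content_eq A B := by
    have := le_of_mem_skewBoxes A
    have := le_of_mem_skewBoxes B
    rw [diagonal, diagonal]
    omega
  content_succ A B := by
    have := le_of_mem_skewBoxes A
    have := le_of_mem_skewBoxes B
    rw [diagonal, diagonal]
    omega
  content_zero A h1 h2 h3 := by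
    obtain ⟨⟨r, c⟩, hA⟩ := A
    simp only at h1 h2 h3 ⊢
    -- Off the edge, the box below is forced: the next lower diagonal starts at most one row further
    -- down and does not end earlier.
    by_contra h0
    obtain ⟨u, rfl⟩ := Nat.exists_eq_add_of_lt (show r < c by omega)
    apply h3
    have e1 : (r + 1, r + u + 1) = (r + 1, (r + 1) + u) := by
      rw [Prod.mk.injEq]
      omega
    have e2 : (r + 1, r + u + 1 + 1) = (r + 1, (r + 1) + (u + 1)) := by
      rw [Prod.mk.injEq]
      omega
    have e3 : (r, r + u + 1) = (r, r + (u + 1)) := rfl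
    rw [e1, IsProfile.mem_skewBoxes_iff]
    rw [e2, IsProfile.mem_skewBoxes_iff] at h2
    rw [e3, IsProfile.mem_skewBoxes_iff] at hA
    have g1 := hi.nextRow_le u (Nat.zero_le n)
    have g2 := hi.nextRow_le u le_rfl
    omega

theorem Alternating.boxEquiv_symm_lt_of_right
    (A B : skewBoxes (hi.isProfile le_rfl).partition (hi.isProfile (Nat.zero_le n)).partition)
    (h1 : B.1.1 = A.1.1) (h2 : B.1.2 = A.1.2 + 1) : hi.boxEquiv.symm A < hi.boxEquiv.symm B := by
  obtain ⟨k, rfl⟩ := hi.boxEquiv.surjective A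
  obtain ⟨l, rfl⟩ := hi.boxEquiv.surjective B
  rw [Equiv.symm_apply_apply, Equiv.symm_apply_apply]
  change nextRow i (i l) l = nextRow i (i k) k at h1
  change nextRow i (i l) l + i l = nextRow i (i k) k + i k + 1 at h2
  have e : i l = i k + 1 := by omega
  -- If l came first, then before letter k the upper diagonal would already extend below the lower
  -- one, contrary to `nextRow_le`.
  by_contra hle
  have hlt : l < k := lt_of_le_of_ne (not_lt.1 hle) (by rintro rfl; omega)
  have g1 := nextRow_lt (i := i) hlt
  have g2 := (hi.nextRow_le (i k) k.2.le).1
  rw [e] at g1 h1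
  omega

theorem Alternating.boxEquiv_symm_lt_of_below
    (A B : skewBoxes (hi.isProfile le_rfl).partition (hi.isProfile (Nat.zero_le n)).partition)
    (h1 : B.1.1 = A.1.1 + 1) (h2 : B.1.2 = A.1.2) : hi.boxEquiv.symm A < hi.boxEquiv.symm B := by
  obtain ⟨k, rfl⟩ := hi.boxEquiv.surjective A
  obtain ⟨l, rfl⟩ := hi.boxEquiv.surjective B
  rw [Equiv.symm_apply_apply, Equiv.symm_apply_apply]
  change nextRow i (i l) l = nextRow i (i k) k + 1 at h1
  change nextRow i (i l) l + i l = nextRow i (i k) k + i k at h2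
  have e : i k = i l + 1 := by omega
  by_contra hle
  have hlt : l < k := lt_of_le_of_ne (not_lt.1 hle) (by rintro rfl; omega)
  have g1 := nextRow_lt (i := i) hlt
  have g2 := (hi.nextRow_le (i l) k.2.le).2
  rw [e] at h1
  omega

/-- The standard tableau of an alternating word. -/
noncomputable def Alternating.tableau : hi.diagram.Tableau :=
  PlacedDiagram.Tableau.ofAdjacent hi.boxEquiv.symm hi.boxEquiv_symm_lt_of_right
    hi.boxEquiv_symm_lt_of_below

theorem Alternating.word_tableau : hi.tableau.word = i := by
  funext k
  change nextRow i (i k) k + i k - nextRow i (i k) k = i k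
  omega

end Word

/-! ## The modules of placed diagrams -/

section IsD

variable {F : Type u} [Field F] [IsAlgClosed F] [CharZero F] {n : ℕ}

theorem PlacedDiagram.exists_isD (d : PlacedDiagram n) : ∃ D : Mod.{u, u} F n, IsD d D := by
  obtain ⟨T⟩ := d.nonempty_tableau
  obtain ⟨L⟩ := nonempty_component F T.word
  obtain ⟨D, hD⟩ := exists_affords T.alternating_word L
  exact ⟨D, T, L, hD⟩

variable {d e : PlacedDiagram n}

theorem IsD.isCSMod {D : Mod.{u, v} F n} (h : IsD d D) :
    IsCSMod D.part (sOp D) (xOp D) (cOp D) := by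
  obtain ⟨T, L, h⟩ := h
  obtain ⟨_, h⟩ := (affords_iff T.alternating_word L D).1 h
  exact h.isCSMod

theorem IsD.isIrr {D : Mod.{u, v} F n} (h : IsD d D) :
    IsIrr D.part (sOp D) (xOp D) (cOp D) := by
  obtain ⟨T, L, h⟩ := h
  obtain ⟨_, h⟩ := (affords_iff T.alternating_word L D).1 h
  exact h.isIrr

/-- The weights of `D(c, λ/μ)` are the words of the standard tableaux. -/
theorem IsD.wt_ne_bot_iff {D : Mod.{u, v} F n} (h : IsD d D) (j : Fin n → ℕ) :
    wt (xOp D) j ≠ ⊥ ↔ ∃ T : d.Tableau, T.word = j := by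
  obtain ⟨T, L, h⟩ := h
  obtain ⟨_, h⟩ := (affords_iff T.alternating_word L D).1 h
  rw [h.wt_ne_bot_iff]
  constructor
  · rintro ⟨τ, hτ, rfl⟩
    exact ⟨T.equivInP ⟨τ, hτ⟩, T.word_equivInP _⟩
  · rintro ⟨T', rfl⟩
    obtain ⟨τ, rfl⟩ := T.equivInP.surjective T'
    exact ⟨τ.1, τ.2, (T.word_equivInP τ).symm⟩

theorem IsD.isCompletelySplittable {D : Mod.{u, v} F n} (h : IsD d D) :
    IsCompletelySplittable D := by
  obtain ⟨T, L, h⟩ := h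
  obtain ⟨_, h⟩ := (affords_iff T.alternating_word L D).1 h
  exact h.isCompletelySplittable

theorem IsD.isIntegral {D : Mod.{u, v} F n} (h : IsD d D) : IsIntegral D := by
  obtain ⟨T, L, h⟩ := h
  obtain ⟨_, h⟩ := (affords_iff T.alternating_word L D).1 h
  exact h.isIntegral

theorem IsD.finrank {D : Mod.{u, v} F n} (h : IsD d D) :
    Module.finrank F D.carrier = 2 ^ (n - d.gammaZero / 2) * d.numTableaux := by
  obtain ⟨T, L, h⟩ := h
  obtain ⟨f, -⟩ := (affords_iff T.alternating_word L D).1 h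
  rw [← f.finrank_eq, finrank_twSpace, T.card_zeros, T.card_inP]

theorem IsD.type {D : Mod.{u, v} F n} (h : IsD d D) :
    (Super.IsTypeM D ↔ Even d.gammaZero) ∧ (Super.IsTypeQ D ↔ Odd d.gammaZero) := by
  have := h.isIntegral.1
  obtain ⟨T⟩ := d.nonempty_tableau
  have hw := (h.wt_ne_bot_iff T.word).2 ⟨T, rfl⟩
  rw [Super.IsTypeM, Super.IsTypeQ, ← T.card_zeros]
  rcases Nat.even_or_odd (zeros T.word).card with h0 | h0
  · rw [finrank_hom_of_even h.isCSMod h.isIrr hw h0]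
    simpa using h0
  · rw [finrank_hom_of_odd h.isCSMod h.isIrr hw h0]
    simpa using h0

/-- Irreducible completely splittable integral modules with a common weight are isomorphic. -/
theorem isomorphic_of_common_wt {M : Mod.{u, v} F n} {N : Mod.{u, w} F n}
    (hM : IsCSMod M.part (sOp M) (xOp M) (cOp M)) (hMi : IsIrr M.part (sOp M) (xOp M) (cOp M))
    (hN : IsCSMod N.part (sOp N) (xOp N) (cOp N)) (hNi : IsIrr N.part (sOp N) (xOp N) (cOp N))
    {j : Fin n → ℕ} (h1 : wt (xOp M) j ≠ ⊥) (h2 : wt (xOp N) j ≠ ⊥) : Super.Isomorphic M N := by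
  obtain ⟨a, f, h3, h4⟩ := exists_equiv_of_common_wt hM hN hMi hNi h1 h2
  exact isomorphic_of_equiv f h3 h4

/-- Weights are isomorphism invariants, one common weight already gives an isomorphism, and a
content word determines its diagram. The case of equal diagrams is the independence of the choices
of T and L(i). -/
theorem IsD.isomorphic_iff {D : Mod.{u, v} F n} {E : Mod.{u, w} F n} (hD : IsD d D)
    (hE : IsD e E) : Super.Isomorphic D E ↔ d.Same e := by
  obtain ⟨T⟩ := d.nonempty_tableau
  have hw := (hD.wt_ne_bot_iff T.word).2 ⟨T, rfl⟩
  constructor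
  · intro h
    obtain ⟨T', h'⟩ := (hE.wt_ne_bot_iff _).1 (wt_ne_bot_of_isomorphic h hw)
    exact T.same_of_word_eq h'.symm
  · intro h
    exact isomorphic_of_common_wt hD.isCSMod hD.isIrr hE.isCSMod hE.isIrr hw
      ((hE.wt_ne_bot_iff _).2 (h.exists_word_eq T))

/-- Any weight of M is alternating, hence the word of a tableau of the diagram built from it, and
the module of that diagram has the same weight. -/
theorem exists_isD_isomorphic (M : Mod.{u, v} F n) (hirr : Super.IsIrreducible M)
    (hcs : IsCompletelySplittable M) (hint : IsIntegral M) :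
    ∃ (d : PlacedDiagram n) (D : Mod.{u, u} F n), IsD d D ∧ Super.Isomorphic M D := by
  have hM := isCSMod_op M hcs hint
  have hMi := (isIrreducible_iff M).1 hirr
  obtain ⟨j, hj⟩ : ∃ j, wt (xOp M) j ≠ ⊥ := by
    by_contra! h0
    have := hMi.nontrivial
    exact bot_ne_top ((iSup_eq_bot.2 h0).symm.trans hM.cs.span)
  have ha := hM.rel.alternating_of_wt_ne_bot hM.cs hj
  obtain ⟨D, hD⟩ := ha.diagram.exists_isD (F := F)
  exact ⟨_, D, hD, isomorphic_of_common_wt hM hMi hD.isCSMod hD.isIrr hj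
    ((hD.wt_ne_bot_iff j).2 ⟨ha.tableau, ha.word_tableau⟩)⟩

end IsD
end HeckeClifford

/-! ### The classification theorem -/

theorem mainTheorem3 {F : Type u} [Field F] [IsAlgClosed F] [CharZero F] (n : ℕ) :
    -- the modules exist, and the defining formulas give a module for all choices made
    (∀ d : HeckeClifford.PlacedDiagram n,
      ∃ D : HeckeClifford.Mod.{u, u} F n, HeckeClifford.IsD d D) ∧
    (∀ (d : HeckeClifford.PlacedDiagram n) (T : d.Tableau)
      (L : HeckeClifford.Component F T.word),
      ∃ D : HeckeClifford.Mod.{u, u} F n, HeckeClifford.Affords L D) ∧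
    -- type and dimension
    (∀ (d : HeckeClifford.PlacedDiagram n) (D : HeckeClifford.Mod.{u, u} F n),
      HeckeClifford.IsD d D →
        (Super.IsTypeM D ↔ Even d.gammaZero) ∧
        (Super.IsTypeQ D ↔ Odd d.gammaZero) ∧
        Module.finrank F D.carrier = 2 ^ (n - d.gammaZero / 2) * d.numTableaux) ∧
    -- irreducible completely splittable integral modules
    (∀ (d : HeckeClifford.PlacedDiagram n) (D : HeckeClifford.Mod.{u, u} F n),
      HeckeClifford.IsD d D →
        Super.IsIrreducible D ∧ HeckeClifford.IsCompletelySplittable D ∧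
        HeckeClifford.IsIntegral D) ∧
    -- well defined and pairwise non-isomorphic
    (∀ (d e : HeckeClifford.PlacedDiagram n) (D E : HeckeClifford.Mod.{u, u} F n),
      HeckeClifford.IsD d D → HeckeClifford.IsD e E →
        (Super.Isomorphic D E ↔ d.Same e)) ∧
    -- complete
    (∀ M : HeckeClifford.Mod.{u, v} F n,
      Super.IsIrreducible M → HeckeClifford.IsCompletelySplittable M →
      HeckeClifford.IsIntegral M →
        ∃ (d : HeckeClifford.PlacedDiagram n) (D : HeckeClifford.Mod.{u, u} F n),
          HeckeClifford.IsD d D ∧ Super.Isomorphic M D) :=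
  ⟨fun d => d.exists_isD, fun _ T L => HeckeClifford.exists_affords T.alternating_word L,
    fun _ _ h => ⟨h.type.1, h.type.2, h.finrank⟩,
    fun _ _ h => ⟨(HeckeClifford.isIrreducible_iff _).2 h.isIrr, h.isCompletelySplittable,
      h.isIntegral⟩,
    fun _ _ _ _ hD hE => hD.isomorphic_iff hE,
    fun M h1 h2 h3 => HeckeClifford.exists_isD_isomorphic M h1 h2 h3⟩
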